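/- Let $S\subset\mathbb R^3$ be the unit sphere with surface measure $dS$, and let $L^2(TS)$ be the space of square integrable complex tangential vector fields on $S$, with inner product $(\mathbf v,\mathbf w)=\int_S \mathbf v\cdot\overline{\mathbf w}\,dS$ and norm $\|\cdot\|$. For smooth $\psi:S\to\mathbb C$ put $\mathrm{Curl}\,\psi=-\hat x\times\mathrm{Grad}\,\psi$, and let $H$ and $V$ be the closures of $\{\mathrm{Curl}\,\psi:\psi\in C^\infty(S)\}$ in $L^2(TS)$ and in $H^1(TS)$. Let $Y_{L,m}$ be the orthonormal spherical harmonics, $\lambda_L=L(L+1)$ and $\mathbf Z_{L,m}=\lambda_L^{-1/2}\,\mathrm{Curl}\,Y_{L,m}$ ($L\ge1$, $-L\le m\le L$), the eigenfields of the Stokes operator $\mathbf A$. For real $s$ put $\mathbf A^{s}\mathbf v=\sum_{L,m}\lambda_L^{s}(\mathbf v,\mathbf Z_{L,m})\mathbf Z_{L,m}$ for those $\mathbf v\in H$ with $\sum_{L,m}\lambda_L^{2s}|(\mathbf v,\mathbf Z_{L,m})|^2<\infty$, and equip $V$ with the norm $\|\mathbf A^{1/2}\cdot\|$. For $\mathbf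 u,\mathbf v\in V$ let $\mathbf B(\mathbf u,\mathbf v)\in V^*$ be the conjugate-linear functional $$\mathbf w\mapsto(\mathbf B(\mathbf u,\mathbf v),\mathbf w)=\int_S \nabla_{\mathbf u}\mathbf v\cdot\overline{\mathbf w}\,dS,\qquad \mathbf w\in V,$$ where $\nabla_{\mathbf u}\mathbf v$ is the (weak) covariant derivative on $S$, and for $F\in V^*$ put $\mathbf A^{-\delta}F=\sum_{L,m}\lambda_L^{-\delta}F(\mathbf Z_{L,m})\mathbf Z_{L,m}$. Let $\delta\in(1/2,1)$. For all $\mathbf u,\mathbf v\in V$ the objects involved are well defined: $\nabla_{\mathbf u}\mathbf v\cdot\overline{\mathbf w}$ is integrable for all $\mathbf w\in V$, $\mathbf B(\mathbf u,\mathbf v)$ is a bounded conjugate-linear functional on $V$, $\sum_{L,m}\lambda_L^{-2\delta}|(\mathbf B(\mathbf u,\mathbf v),\mathbf Z_{L,m})|^2<\infty$ (so $\mathbf A^{-\delta}\mathbf B(\mathbf u,\mathbf v)\in H$), and $\mathbf A^{1-\delta}\mathbf u$, $\mathbf A^{1/2}\mathbf u$ are defined. There is a constant $C$, depending only on $\delta$,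 such that for all $\mathbf u,\mathbf v\in V$ $$\|\mathbf A^{-\delta}\mathbf B(\mathbf u,\mathbf v)\|\le C\,\|\mathbf A^{1-\delta}\mathbf u\|\,\|\mathbf v\|\qquad\text{and}\qquad \|\mathbf A^{-\delta}\mathbf B(\mathbf u,\mathbf v)\|\le C\,\|\mathbf u\|\,\|\mathbf A^{1-\delta}\mathbf v\|.$$ Moreover, for every $M$ there is a constant $C'$, depending only on $\delta$ and $M$, such that $$\|\mathbf A^{-\delta}(\mathbf B(\mathbf v,\mathbf v)-\mathbf B(\mathbf w,\mathbf w))\|\le C'\,\|\mathbf v-\mathbf w\|$$ for all $\mathbf v,\mathbf w\in V$ with $\|\mathbf A^{1/2}\mathbf v\|\le M$ and $\|\mathbf A^{1/2}\mathbf w\|\le M$. -/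

import Mathlib

open MeasureTheory Filter Topology
open scoped ContDiff Matrix ComplexConjugate

noncomputable section

namespace SphereNSE

/-! ## The sphere, its surface measure, smooth fields and first order operators

A smooth function on the unit sphere is the same thing as the restriction to the sphere of a smooth
function on the ambient space, so `C^∞` functions and fields on the sphere are represented by smooth
functions on `ℝ³`. All operators below, evaluated at points of the sphere, only depend on the
restriction of their argument to the sphere. -/

/-- The ambient Euclidean space `ℝ³`. -/
abbrev E3 := EuclideanSpace ℝ (Fin 3)

/-- The space `ℂ³` in which (complex) vector fields take their values. -/
abbrev C3 := EuclideanSpace ℂ (Fin 3)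

/-- The unit sphere of `ℝ³`. -/
abbrev S2 := Metric.sphere (0 : E3) 1

/-- The surface measure on the unit sphere (of total mass `4π`). -/
def dS : Measure S2 := (volume : Measure E3).toSphere

instance : IsFiniteMeasure dS := by unfold dS; infer_instance

/-- The (complex bilinear) product `y · a` of a real vector with a complex one. -/
def dotC (y : E3) (a : C3) : ℂ := ∑ j, (y j : ℂ) * a j

/-- `a - (y · a) y`. For `‖y‖ = 1` this is the orthogonal projection of `a` to the complexified
tangent plane of the sphere at `y`. -/
def tangProj (y : E3) (a : C3) : C3 := WithLp.toLp 2 fun i => a i - dotC y a * (y i : ℂ)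

/-- The ambient gradient of a complex-valued function. -/
def ambGrad (ψ : E3 → ℂ) (y : E3) : C3 :=
  WithLp.toLp 2 fun j => fderiv ℝ ψ y (EuclideanSpace.single j 1)

/-- The surface gradient `Grad ψ`: the tangential part of the ambient gradient. -/
def surfGrad (ψ : E3 → ℂ) (y : E3) : C3 := tangProj y (ambGrad ψ y)

/-- The surface divergence of a (tangential) field, the trace of its tangential derivative. -/
def surfDiv (φ : E3 → C3) (y : E3) : ℂ := ∑ j, surfGrad (fun z => φ z j) y j

/-- The cross product `y × a` of a real vector with a complex one. -/
def crossC (y : E3) (a : C3) : C3 :=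
  WithLp.toLp 2 ((fun i => (y i : ℂ)) ⨯₃ (fun i => a i))

/-- `Curl ψ = - x × Grad ψ`, a tangential divergence-free field on the sphere. -/
def surfCurl (ψ : E3 → ℂ) (y : E3) : C3 := - crossC y (surfGrad ψ y)

/-! ## Function spaces -/

/-- Square integrable `ℂ³`-valued fields on the sphere, with the norm and inner product of `L²`. The
space `L²(TS)` is the subspace of the fields that are tangential almost everywhere; all fields in
`H` and `V` below are. -/
abbrev L2 := Lp C3 2 dS

/-- `g` is the weak surface gradient of the scalar function `f`: both are square integrable, `g` is
tangential, and `∫ f Div φ = - ∫ g · φ` for all smooth tangential fields `φ`. -/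
structure IsWeakGrad (f : S2 → ℂ) (g : S2 → C3) : Prop where
  memLp_fun : MemLp f 2 dS
  memLp_grad : MemLp g 2 dS
  tangential : ∀ᵐ x : S2 ∂dS, dotC x (g x) = 0
  integral_eq : ∀ φ : E3 → C3, ContDiff ℝ ∞ φ → (∀ x : S2, dotC x (φ x) = 0) →
    ∫ x : S2, f x * surfDiv φ x ∂dS = - ∫ x : S2, ∑ j, g x j * φ x j ∂dS

/-- `G i` is the weak surface gradient of the `i`-th Cartesian component of the field `v`. -/
def IsWeakJac (v : L2) (G : Fin 3 → L2) : Prop :=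
  ∀ i, IsWeakGrad (fun x => v x i) (fun x => G i x)

/-- `H`: the closure in `L²` of the fields `Curl ψ` with `ψ` smooth. -/
def H : Set L2 :=
  {v | ∃ ψ : ℕ → E3 → ℂ, (∀ n, ContDiff ℝ ∞ (ψ n)) ∧
    Tendsto (fun n => eLpNorm (fun x : S2 => v x - surfCurl (ψ n) x) 2 dS) atTop (𝓝 0)}

/-- `V`: the closure in `H¹` of the fields `Curl ψ` with `ψ` smooth; convergence in `H¹` is
convergence in `L²` of the fields and of their surface gradients, component by component. -/
def V : Set L2 :=
  {v | ∃ G : Fin 3 → L2, IsWeakJac v G ∧ ∃ ψ : ℕ → E3 → ℂ, (∀ n, ContDiff ℝ ∞ (ψ n)) ∧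
    Tendsto (fun n => eLpNorm (fun x : S2 => v x - surfCurl (ψ n) x) 2 dS) atTop (𝓝 0) ∧
    ∀ i, Tendsto (fun n => eLpNorm
      (fun x : S2 => G i x - surfGrad (fun y => surfCurl (ψ n) y i) x) 2 dS) atTop (𝓝 0)}

/-! ## Spherical harmonics and the powers of the Stokes operator -/

/-- The Legendre polynomial `P_L`, by Rodrigues' formula. -/
def legendre (L : ℕ) : Polynomial ℂ :=
  Polynomial.C (((2 : ℂ) ^ L * (L.factorial : ℂ))⁻¹) *
    Polynomial.derivative^[L] ((Polynomial.X ^ 2 - 1) ^ L)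

/-- The orthonormal spherical harmonic `Y_{L,m}` as a function of `x = (sin θ cos φ, sin θ sin φ,
cos θ)`. For `m ≥ 0`, with `P_L^m(t) = (-1)^m (1-t²)^{m/2} (d/dt)^m P_L(t)`, one has
`P_L^m(cos θ) e^{imφ} = (-1)^m (x₀ + i x₁)^m P_L^{(m)}(x₂)`; for `m < 0` the convention is the one
for which `conj Y_{L,m} = (-1)^m Y_{L,-m}`. -/
def sphHarm (L : ℕ) (m : ℤ) (x : E3) : ℂ :=
  (Real.sqrt ((2 * L + 1) / (4 * Real.pi) *
      (((L - m.natAbs).factorial : ℝ) / ((L + m.natAbs).factorial : ℝ))) : ℂ) *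
    (if 0 ≤ m then (-1) ^ m.natAbs * ((x 0 : ℂ) + Complex.I * (x 1 : ℂ)) ^ m.natAbs
      else ((x 0 : ℂ) - Complex.I * (x 1 : ℂ)) ^ m.natAbs) *
    (Polynomial.derivative^[m.natAbs] (legendre L)).eval (x 2 : ℂ)

/-- The index set `{(L, m) : L ≥ 1, -L ≤ m ≤ L}`. -/
abbrev Idx := {p : ℕ × ℤ // 1 ≤ p.1 ∧ -(p.1 : ℤ) ≤ p.2 ∧ p.2 ≤ (p.1 : ℤ)}

/-- The eigenvalue `λ_L = L (L + 1)` of the Stokes operator. -/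
def lam (p : Idx) : ℝ := (p.1.1 : ℝ) * ((p.1.1 : ℝ) + 1)

/-- The eigenfields `Z_{L,m} = λ_L^{-1/2} Curl Y_{L,m}` of the Stokes operator. -/
def zField (p : Idx) (x : S2) : C3 :=
  ((lam p ^ (-(1 / 2) : ℝ) : ℝ) : ℂ) • surfCurl (sphHarm p.1.1 p.1.2) x

lemma contDiff_sphHarm (L : ℕ) (m : ℤ) : ContDiff ℝ ∞ (sphHarm L m) := by
  have hc : ∀ i, ContDiff ℝ ∞ (fun x : E3 => (x i : ℂ)) := fun i => by
    have h1 : ContDiff ℝ ∞ (fun x : E3 => x i) := by fun_prop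
    exact Complex.ofRealCLM.contDiff.comp h1
  have h0 := hc 0
  have h1 := hc 1
  have h2 := hc 2
  have hp : ∀ q : Polynomial ℂ, ContDiff ℝ ∞ (fun x : E3 => q.eval (x 2 : ℂ)) := fun q => by
    induction q using Polynomial.induction_on' with
    | add p q hp hq => simpa only [Polynomial.eval_add] using hp.add hq
    | monomial n a =>
      simp only [Polynomial.eval_monomial]
      exact contDiff_const.mul (h2.pow n)
  unfold sphHarm
  refine ContDiff.mul (ContDiff.mul contDiff_const ?_) (hp _)
  split_ifs
  · exact contDiff_const.mul ((h0.add (contDiff_const.mul h1)).pow _)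
  · exact (h0.sub (contDiff_const.mul h1)).pow _

lemma continuous_surfCurl {ψ : E3 → ℂ} (h : ContDiff ℝ ∞ ψ) : Continuous (surfCurl ψ) := by
  have hd : ∀ j : Fin 3, Continuous fun y => fderiv ℝ ψ y (EuclideanSpace.single j 1) := fun j =>
    (h.continuous_fderiv (by simp)).clm_apply continuous_const
  have hc : ∀ i : Fin 3, Continuous (fun x : E3 => (x i : ℂ)) := fun i => by fun_prop
  unfold surfCurl crossC surfGrad tangProj ambGrad dotC
  refine (Continuous.neg ?_)
  refine (PiLp.continuous_toLp 2 _).comp (continuous_pi fun i => ?_)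
  fin_cases i <;> simp [cross_apply, Fin.sum_univ_three] <;> fun_prop

lemma memLp_zField (p : Idx) : MemLp (zField p) 2 dS := by
  have hc : Continuous (zField p) := by
    have := (continuous_surfCurl (contDiff_sphHarm p.1.1 p.1.2)).comp
      (continuous_subtype_val : Continuous (Subtype.val : S2 → E3))
    unfold zField
    exact this.const_smul (((lam p ^ (-(1 / 2) : ℝ) : ℝ) : ℂ))
  exact hc.memLp_of_hasCompactSupport (HasCompactSupport.of_compactSpace _)

/-- `Z_{L,m}` as an element of `L²`. -/
def Z (p : Idx) : L2 := (memLp_zField p).toLp (zField p)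

/-- The Fourier coefficient `(v, Z_{L,m})` of a field; Mathlib's inner product is conjugate linear
in its first argument. -/
def coeff (v : L2) (p : Idx) : ℂ := inner ℂ (Z p) v

/-- The domain `D(A^s)`: the fields of `H` with `∑ λ_L^{2s} |(v, Z_{L,m})|² < ∞`. -/
def domPow (s : ℝ) : Set L2 :=
  {v | v ∈ H ∧ Summable fun p => lam p ^ (2 * s) * ‖coeff v p‖ ^ 2}

/-- `A^s v = ∑ λ_L^s (v, Z_{L,m}) Z_{L,m}`, for `v` in `D(A^s)`. -/
def stokesPow (s : ℝ) (v : L2) : L2 :=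
  ∑' p, (((lam p ^ s : ℝ) : ℂ) * coeff v p) • Z p

/-- `F` belongs to the (anti)dual `V*` of `V`, where `V` has the norm `‖A^{1/2} w‖`. -/
structure MemVDual (F : L2 → ℂ) : Prop where
  antilinear : ∀ w ∈ V, ∀ z ∈ V, ∀ c : ℂ, F (c • w + z) = conj c * F w + F z
  bounded : ∃ K : ℝ, ∀ w ∈ V, ‖F w‖ ≤ K * ‖stokesPow (1 / 2) w‖

/-- For a functional `F` with coefficients `F(Z_{L,m})`, the condition
`∑ λ_L^{2s} |F(Z_{L,m})|² < ∞`, which says that `A^s F` is an element of `H`. -/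
def DualInDom (s : ℝ) (F : L2 → ℂ) : Prop :=
  Summable fun p => lam p ^ (2 * s) * ‖F (Z p)‖ ^ 2

/-- `A^s F = ∑ λ_L^s F(Z_{L,m}) Z_{L,m}` for a functional `F`. It extends `stokesPow`: a field `v` is
identified with the functional `w ↦ (v, w)`, whose value at `Z_{L,m}` is `coeff v`. -/
def stokesPowDual (s : ℝ) (F : L2 → ℂ) : L2 :=
  ∑' p, (((lam p ^ s : ℝ) : ℂ) * F (Z p)) • Z p

/-! ## The nonlinearity -/

open Classical in
/-- The weak surface gradients of the three components of `v` (when they exist, as for `v` in `V`;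
they are unique). -/
def weakJac (v : L2) : Fin 3 → L2 :=
  if h : ∃ G, IsWeakJac v G then h.choose else 0

/-- The covariant derivative `∇_u v` on the sphere: the tangential part of the derivative of `v` in
the direction `u`. -/
def covDeriv (u v : L2) (x : S2) : C3 :=
  tangProj x (WithLp.toLp 2 fun i => ∑ j, u x j * weakJac v i x j)

/-- The integrand `∇_u v · conj w` of the trilinear form. -/
def bIntegrand (u v w : L2) (x : S2) : ℂ := ∑ i, covDeriv u v x i * conj (w x i)

/-- The functional `B(u, v)`, given by `(B(u, v), w) = b(u, v, w) = ∫ ∇_u v · conj w dS`. -/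
def B (u v : L2) (w : L2) : ℂ := ∫ x, bIntegrand u v w x ∂dS

end SphereNSE

end

/-!
The fields `u`, `v` of `V` are limits of fields `Curl ψ`, which are divergence free and tangential.
Hence the trilinear form, tested with an eigenfield, is skew-symmetric (`B_Z_eq`): the derivative
passes from `v` to the test field, and only the product `u_j v_i` of Cartesian components is left,
integrated against the components of `∇ Z_{L,m}`. Testing with a finite combination whose
coefficients are those of `A^{-δ} B(u, v)` itself (`sum_norm_sq_B_Z_le`) reduces both estimates to a
bound, by Cauchy-Schwarz, for the `L²` norm of the product of one of the two fields with the gradient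
of a field `A^{-δ} g`, `g ∈ H`.

That bound is the product estimate `H^s × H^{1-s} → L²` for `0 < s < 1`, the two-dimensional Sobolev
product law (`eLpNorm_mul_le_of_hasSum`). With `s = 2(1 - δ)` the field in question is measured by
`‖A^{1-δ} ·‖`, and the gradient of `A^{-δ} g` has the `1 - s = 2δ - 1` derivatives that are left.
The case `s = 1/2` shows that products of fields in `V` are square integrable, so that `B(u, v)` is
defined and bounded on `V`. No Sobolev embedding is used. Expansions are cut into dyadic blocks
`2^j ≤ L < 2^{j+1}`; in the product of two blocks, the one of lower frequency is bounded uniformly by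
a Bernstein inequality and the other one in `L²`, and the resulting double sum decays geometrically
away from the diagonal (`schur_le`). The Bernstein inequality is the addition theorem
`∑_m |Y_{L,m}|² = (2L + 1) / 4π` (`sum_sphHarm_mul_conj`). It passes to the components of the
eigenfields and of their gradients because derivatives of spherical harmonics along infinitesimal
rotations are combinations of neighbouring harmonics of the same degree (`exists_ladderOp_sphHarm`).

What is needed about spherical harmonics is derived from Rodrigues' formula through the generators
`rot k` of the rotations, which are skew-adjoint by the rotation invariance of the surface measure
and are the components of `Curl`: the ladder relations give the eigenvalues, the orthonormality and
the addition theorem, and the Stone-Weierstrass theorem gives completeness, hence the expansion of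
every field of `H` in the eigenfields (`hasSum_coeff`) and `V ⊆ D(A^{1/2})` (`mem_domPow_half`).

The Lipschitz property follows from the two estimates and
`B(v, v) - B(w, w) = B(v - w, v) + B(w, v - w)`.
-/

noncomputable section

namespace SphereNSE

/-! ### Infinitesimal rotations -/

/-- The generator of the rotations about the `k`-th coordinate axis, `x ↦ - e_k × x`. The indices
`k + 1` and `k + 2` are taken modulo `3`. -/
def rotGen (k : Fin 3) : E3 →L[ℝ] E3 :=
  (EuclideanSpace.proj (k + 2) : E3 →L[ℝ] ℝ).smulRight (EuclideanSpace.single (k + 1) (1 : ℝ)) -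
    (EuclideanSpace.proj (k + 1) : E3 →L[ℝ] ℝ).smulRight (EuclideanSpace.single (k + 2) (1 : ℝ))

lemma rotGen_apply (k : Fin 3) (x : E3) (j : Fin 3) :
    rotGen k x j = (if j = k + 1 then x (k + 2) else 0) - (if j = k + 2 then x (k + 1) else 0) := by
  simp [rotGen]

/-- The derivative of `ψ` along the infinitesimal rotation about the `k`-th axis; by
`surfCurl_apply` it is the `k`-th component of `Curl ψ`. It is defined on all of `ℝ³`, but at points
of the sphere it only depends on the restriction of `ψ` to the sphere (`rot_congr`). -/
def rot (k : Fin 3) (ψ : E3 → ℂ) (y : E3) : ℂ := fderiv ℝ ψ y (rotGen k y)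

lemma surfCurl_apply (ψ : E3 → ℂ) (y : E3) (k : Fin 3) : surfCurl ψ y k = rot k ψ y := by
  have h : rotGen k y = y (k + 2) • EuclideanSpace.single (k + 1) (1 : ℝ)
      - y (k + 1) • EuclideanSpace.single (k + 2) (1 : ℝ) := by simp [rotGen]
  unfold rot
  rw [h, map_sub, map_smul, map_smul]
  fin_cases k <;>
  simp [surfCurl, crossC, surfGrad, tangProj, ambGrad, dotC, cross_apply, Fin.sum_univ_three] <;>
  ring

/-- The rotation `exp (t • rotGen k)` about the `k`-th axis, by Rodrigues' rotation formula. -/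
def rotFlow (k : Fin 3) (t : ℝ) : E3 →L[ℝ] E3 :=
  ContinuousLinearMap.id ℝ E3 + Real.sin t • rotGen k +
    (1 - Real.cos t) • (rotGen k).comp (rotGen k)

lemma rotFlow_apply (k : Fin 3) (t : ℝ) (x : E3) : rotFlow k t x =
    x + Real.sin t • rotGen k x + (1 - Real.cos t) • rotGen k (rotGen k x) := rfl

lemma rotGen_cube (k : Fin 3) (x : E3) : rotGen k (rotGen k (rotGen k x)) = - rotGen k x := by
  ext j
  fin_cases k <;> fin_cases j <;> simp [rotGen_apply]

lemma norm_rotFlow (k : Fin 3) (t : ℝ) (x : E3) : ‖rotFlow k t x‖ = ‖x‖ := by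
  have h : ‖rotFlow k t x‖ ^ 2 = ‖x‖ ^ 2 := by
    have hs := Real.sin_sq_add_cos_sq t
    simp only [EuclideanSpace.real_norm_sq_eq, Fin.sum_univ_three, rotFlow_apply, PiLp.add_apply,
      PiLp.smul_apply, rotGen_apply, smul_eq_mul]
    fin_cases k <;> simp
    · linear_combination (x 1 ^ 2 + x 2 ^ 2) * hs
    · linear_combination (x 0 ^ 2 + x 2 ^ 2) * hs
    · linear_combination (x 0 ^ 2 + x 1 ^ 2) * hs
  exact (sq_eq_sq₀ (norm_nonneg _) (norm_nonneg _)).1 h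

lemma rotFlow_zero (k : Fin 3) (x : E3) : rotFlow k 0 x = x := by simp [rotFlow_apply]

lemma hasDerivAt_rotFlow (k : Fin 3) (t : ℝ) (x : E3) :
    HasDerivAt (fun t => rotFlow k t x) (rotGen k (rotFlow k t x)) t := by
  have h := (((Real.hasDerivAt_sin t).smul_const (rotGen k x)).const_add x).add
    (((Real.hasDerivAt_cos t).const_sub 1).smul_const (rotGen k (rotGen k x)))
  refine h.congr_deriv ?_
  simp only [rotFlow_apply, map_add, map_smul, rotGen_cube]
  module

lemma rotFlow_mem (k : Fin 3) (t : ℝ) (x : S2) : rotFlow k t x ∈ Metric.sphere (0 : E3) 1 := by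
  have := x.2
  simp only [mem_sphere_zero_iff_norm, norm_rotFlow] at this ⊢
  exact this

/-- The rotation about the `k`-th axis, as a map of the sphere. -/
def rotSphere (k : Fin 3) (t : ℝ) (x : S2) : S2 := ⟨rotFlow k t x, rotFlow_mem k t x⟩

lemma hasDerivAt_comp_rotFlow {ψ : E3 → ℂ} (h : ContDiff ℝ ∞ ψ) (k : Fin 3) (t : ℝ) (x : E3) :
    HasDerivAt (fun t => ψ (rotFlow k t x)) (rot k ψ (rotFlow k t x)) t :=
  (h.differentiable (by simp) (rotFlow k t x)).hasFDerivAt.comp_hasDerivAt t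
    (hasDerivAt_rotFlow k t x)

lemma rot_congr {f g : E3 → ℂ} (hf : ContDiff ℝ ∞ f) (hg : ContDiff ℝ ∞ g)
    (h : ∀ x : S2, f x = g x) (k : Fin 3) (x : S2) : rot k f x = rot k g x := by
  have h1 := hasDerivAt_comp_rotFlow hf k 0 x
  have h2 := hasDerivAt_comp_rotFlow hg k 0 x
  have e : (fun t => f (rotFlow k t x)) = fun t => g (rotFlow k t x) :=
    funext fun t => h (rotSphere k t x)
  rw [e] at h1
  simpa [rotFlow_zero] using h1.unique h2

lemma contDiff_rot {ψ : E3 → ℂ} (h : ContDiff ℝ ∞ ψ) (k : Fin 3) : ContDiff ℝ ∞ (rot k ψ) :=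
  (h.fderiv_right (m := ∞) (by simp)).clm_apply (rotGen k).contDiff

lemma rot_const (k : Fin 3) (c : ℂ) (y : E3) : rot k (fun _ => c) y = 0 := by simp [rot]

lemma rot_add {f g : E3 → ℂ} (hf : ContDiff ℝ ∞ f) (hg : ContDiff ℝ ∞ g) (k : Fin 3) (y : E3) :
    rot k (fun z => f z + g z) y = rot k f y + rot k g y := by
  unfold rot
  rw [fderiv_fun_add (hf.differentiable (by simp) y) (hg.differentiable (by simp) y)]
  simp

lemma rot_sub {f g : E3 → ℂ} (hf : ContDiff ℝ ∞ f) (hg : ContDiff ℝ ∞ g) (k : Fin 3) (y : E3) :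
    rot k (fun z => f z - g z) y = rot k f y - rot k g y := by
  unfold rot
  rw [fderiv_fun_sub (hf.differentiable (by simp) y) (hg.differentiable (by simp) y)]
  simp

lemma rot_sum {ι : Type*} {f : ι → E3 → ℂ} (hf : ∀ i, ContDiff ℝ ∞ (f i)) (s : Finset ι)
    (k : Fin 3) (y : E3) : rot k (fun z => ∑ i ∈ s, f i z) y = ∑ i ∈ s, rot k (f i) y := by
  unfold rot
  rw [fderiv_fun_sum fun i _ => (hf i).differentiable (by simp) y]
  simp

lemma rot_mul {f g : E3 → ℂ} (hf : ContDiff ℝ ∞ f) (hg : ContDiff ℝ ∞ g) (k : Fin 3) (y : E3) :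
    rot k (fun z => f z * g z) y = rot k f y * g y + f y * rot k g y := by
  unfold rot
  rw [fderiv_fun_mul (hf.differentiable (by simp) y) (hg.differentiable (by simp) y)]
  simp
  ring

lemma rot_const_mul {f : E3 → ℂ} (hf : ContDiff ℝ ∞ f) (c : ℂ) (k : Fin 3) (y : E3) :
    rot k (fun z => c * f z) y = c * rot k f y := by
  rw [rot_mul contDiff_const hf, rot_const]; ring

lemma rot_pow {f : E3 → ℂ} (hf : ContDiff ℝ ∞ f) (n : ℕ) (k : Fin 3) (y : E3) :
    rot k (fun z => f z ^ n) y = n * f y ^ (n - 1) * rot k f y := by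
  unfold rot
  rw [((hf.differentiable (by simp) y).hasFDerivAt.pow n).fderiv]
  simp

lemma rot_eval {f : E3 → ℂ} (hf : ContDiff ℝ ∞ f) (q : Polynomial ℂ) (k : Fin 3) (y : E3) :
    rot k (fun z => q.eval (f z)) y = q.derivative.eval (f y) * rot k f y := by
  unfold rot
  have h := ((q.hasDerivAt (f y)).hasFDerivAt.restrictScalars ℝ).comp y
    (hf.differentiable (by simp) y).hasFDerivAt
  have e : (fun z => q.eval (f z)) = (fun z => q.eval z) ∘ f := rfl
  rw [e, h.fderiv]
  simp [mul_comm]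

lemma rot_conj {f : E3 → ℂ} (hf : ContDiff ℝ ∞ f) (k : Fin 3) (y : E3) :
    rot k (fun z => conj (f z)) y = conj (rot k f y) := by
  unfold rot
  have h := Complex.conjCLE.toContinuousLinearMap.hasFDerivAt.comp y
    (hf.differentiable (by simp) y).hasFDerivAt
  have e : (fun z => conj (f z)) = Complex.conjCLE.toContinuousLinearMap ∘ f := rfl
  rw [e, h.fderiv]
  simp

lemma contDiff_conj {f : E3 → ℂ} (hf : ContDiff ℝ ∞ f) : ContDiff ℝ ∞ (fun z => conj (f z)) :=
  Complex.conjCLE.contDiff.comp hf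

lemma contDiff_coord (j : Fin 3) : ContDiff ℝ ∞ (fun x : E3 => (x j : ℂ)) :=
  Complex.ofRealCLM.contDiff.comp (by fun_prop : ContDiff ℝ ∞ (fun x : E3 => x j))

lemma rot_coord (k j : Fin 3) (y : E3) :
    rot k (fun x : E3 => (x j : ℂ)) y = (rotGen k y j : ℂ) := by
  unfold rot
  have h := (Complex.ofRealCLM.comp (EuclideanSpace.proj j : E3 →L[ℝ] ℝ)).hasFDerivAt (x := y)
  have e : (fun x : E3 => (x j : ℂ)) =
      Complex.ofRealCLM.comp (EuclideanSpace.proj j : E3 →L[ℝ] ℝ) := rfl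
  rw [e, h.fderiv]
  simp

lemma rot_rot {ψ : E3 → ℂ} (h : ContDiff ℝ ∞ ψ) (k l : Fin 3) (y : E3) :
    rot k (rot l ψ) y = fderiv ℝ (fderiv ℝ ψ) y (rotGen k y) (rotGen l y) +
      fderiv ℝ ψ y (rotGen l (rotGen k y)) := by
  have hd : DifferentiableAt ℝ (fderiv ℝ ψ) y :=
    (h.fderiv_right (m := ∞) (by simp)).differentiable (by simp) y
  have h1 := hd.hasFDerivAt.clm_apply ((rotGen l).hasFDerivAt (x := y))
  have e : rot l ψ = fun y => fderiv ℝ ψ y (rotGen l y) := rfl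
  rw [e]
  unfold rot
  rw [h1.fderiv]
  simp [add_comm]

/-- The commutation relations of the rotation algebra. -/
lemma rot_comm {ψ : E3 → ℂ} (h : ContDiff ℝ ∞ ψ) (k : Fin 3) (y : E3) :
    rot k (rot (k + 1) ψ) y - rot (k + 1) (rot k ψ) y = rot (k + 2) ψ y := by
  have hs : IsSymmSndFDerivAt ℝ ψ y := h.contDiffAt.isSymmSndFDerivAt
    (by simp only [minSmoothness_of_isRCLikeNormedField]; exact WithTop.coe_le_coe.2 le_top)
  rw [rot_rot h, rot_rot h, hs.eq (rotGen k y)]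
  have : rotGen (k + 2) y = rotGen (k + 1) (rotGen k y) - rotGen k (rotGen (k + 1) y) := by
    ext j
    fin_cases k <;> fin_cases j <;> simp [rotGen_apply]
  unfold rot
  rw [this, map_sub]
  ring

/-- Curls are tangential. -/
lemma sum_coord_mul_rot (ψ : E3 → ℂ) (y : E3) : ∑ k, (y k : ℂ) * rot k ψ y = 0 := by
  have h : ∑ k, y k • rotGen k y = 0 := by
    ext j
    fin_cases j <;> simp [rotGen_apply, Fin.sum_univ_three] <;> ring
  have := congrArg (fderiv ℝ ψ y) h
  simpa [rot] using this

lemma sum_coord_sq (x : S2) : ∑ k, ((x : E3) k : ℂ) ^ 2 = 1 := by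
  have h : ‖(x : E3)‖ ^ 2 = 1 := by rw [mem_sphere_zero_iff_norm.1 x.2]; norm_num
  rw [EuclideanSpace.real_norm_sq_eq] at h
  exact_mod_cast h

/-- On the sphere, `Grad ψ = x × Curl ψ`. -/
lemma surfGrad_apply (ψ : E3 → ℂ) (x : S2) (j : Fin 3) :
    surfGrad ψ x j = (x : E3) (j + 1) * rot (j + 2) ψ x - (x : E3) (j + 2) * rot (j + 1) ψ x := by
  have h : ∀ k, rotGen k (x : E3) = (x : E3) (k + 2) • EuclideanSpace.single (k + 1) (1 : ℝ)
      - (x : E3) (k + 1) • EuclideanSpace.single (k + 2) (1 : ℝ) := fun k => by simp [rotGen]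
  have hx := sum_coord_sq x
  rw [Fin.sum_univ_three] at hx
  unfold rot
  rw [h, h, map_sub, map_sub, map_smul, map_smul, map_smul, map_smul]
  fin_cases j <;> simp [surfGrad, tangProj, ambGrad, dotC, Fin.sum_univ_three]
  · linear_combination (-fderiv ℝ ψ x (EuclideanSpace.single 0 1)) * hx
  · linear_combination (-fderiv ℝ ψ x (EuclideanSpace.single 1 1)) * hx
  · linear_combination (-fderiv ℝ ψ x (EuclideanSpace.single 2 1)) * hx

/-! ### Rotation invariance of the surface measure and integration by parts -/

lemma dS_real_univ : dS.real Set.univ = 4 * Real.pi := by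
  rw [dS, Measure.toSphere_real_apply_univ, Measure.real, EuclideanSpace.volume_ball_fin_three]
  simp only [ENNReal.ofReal_one, one_pow, one_mul, finrank_euclideanSpace, Fintype.card_fin,
    Nat.cast_ofNat]
  rw [ENNReal.toReal_ofReal (by positivity)]
  ring

lemma integrable_of_continuous {F : Type*} [NormedAddCommGroup F] {f : S2 → F} (hf : Continuous f) :
    Integrable f dS :=
  hf.integrable_of_hasCompactSupport (HasCompactSupport.of_compactSpace _)

lemma memLp_of_continuous {F : Type*} [NormedAddCommGroup F] {f : S2 → F} (hf : Continuous f)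
    (p : ENNReal) : MemLp f p dS :=
  hf.memLp_of_hasCompactSupport (HasCompactSupport.of_compactSpace _)

lemma continuous_res {F : Type*} [TopologicalSpace F] {f : E3 → F} (hf : Continuous f) :
    Continuous (fun x : S2 => f x) := hf.comp continuous_subtype_val

lemma integrable_res {f : E3 → ℂ} (hf : ContDiff ℝ ∞ f) : Integrable (fun x : S2 => f x) dS :=
  integrable_of_continuous (continuous_res hf.continuous)

lemma continuous_rotSphere (k : Fin 3) (t : ℝ) : Continuous (rotSphere k t) :=
  ((rotFlow k t).continuous.comp continuous_subtype_val).subtype_mk _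

/-- The rotation about the `k`-th axis as a linear isometry of the ambient space. -/
def rotIsometry (k : Fin 3) (t : ℝ) : E3 ≃ₗᵢ[ℝ] E3 :=
  LinearIsometry.toLinearIsometryEquiv ⟨(rotFlow k t).toLinearMap, norm_rotFlow k t⟩ rfl

open scoped Pointwise in
lemma measurePreserving_rotSphere (k : Fin 3) (t : ℝ) :
    MeasurePreserving (rotSphere k t) dS dS := by
  refine ⟨(continuous_rotSphere k t).measurable, ?_⟩
  ext s hs
  rw [Measure.map_apply (continuous_rotSphere k t).measurable hs, dS,
    Measure.toSphere_apply' _ hs,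
    Measure.toSphere_apply' _ ((continuous_rotSphere k t).measurable hs)]
  congr 1
  rw [← (rotIsometry k t).measurePreserving.measure_preimage_emb
    (rotIsometry k t).toHomeomorph.measurableEmbedding (Set.Ioo (0 : ℝ) 1 • (Subtype.val '' s))]
  congr 1
  ext y
  simp only [Set.mem_smul, Set.mem_image, Set.mem_preimage]
  constructor
  · rintro ⟨r, hr, _, ⟨z, hz, rfl⟩, rfl⟩
    exact ⟨r, hr, rotSphere k t z, ⟨_, hz, rfl⟩, ((rotFlow k t).map_smul r z).symm⟩
  · rintro ⟨r, hr, _, ⟨z, hz, rfl⟩, hy⟩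
    have hz' : (rotIsometry k t).symm z ∈ Metric.sphere (0 : E3) 1 := by
      rw [mem_sphere_zero_iff_norm, LinearIsometryEquiv.norm_map]
      exact mem_sphere_zero_iff_norm.1 z.2
    refine ⟨r, hr, _, ⟨⟨_, hz'⟩, ?_, rfl⟩, ?_⟩
    · convert hz
      exact Subtype.ext ((rotIsometry k t).apply_symm_apply z)
    · apply (rotIsometry k t).injective
      rw [← hy, map_smul, LinearIsometryEquiv.apply_symm_apply]

lemma integral_comp_rotSphere (k : Fin 3) (t : ℝ) (f : S2 → ℂ) (hf : Continuous f) :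
    ∫ x, f (rotSphere k t x) ∂dS = ∫ x, f x ∂dS := by
  have h := measurePreserving_rotSphere k t
  rw [← h.map_eq, integral_map h.measurable.aemeasurable
    hf.measurable.aestronglyMeasurable, h.map_eq]

/-- Rotation invariance of the surface measure, in infinitesimal form. -/
lemma integral_rot {ψ : E3 → ℂ} (h : ContDiff ℝ ∞ ψ) (k : Fin 3) :
    ∫ x : S2, rot k ψ x ∂dS = 0 := by
  have hc : Continuous (fun x : S2 => rot k ψ x) := continuous_res (contDiff_rot h k).continuous
  obtain ⟨K, hK⟩ := isCompact_univ.exists_bound_of_continuousOn hc.continuousOn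
  have hd := hasDerivAt_integral_of_dominated_loc_of_deriv_le (μ := dS) (x₀ := (0 : ℝ))
    (F := fun t (x : S2) => ψ (rotSphere k t x)) (F' := fun t (x : S2) => rot k ψ (rotSphere k t x))
    (bound := fun _ => K) (s := Set.univ) Filter.univ_mem
    (Eventually.of_forall fun t => ((continuous_res h.continuous).comp
      (continuous_rotSphere k t)).aestronglyMeasurable)
    (integrable_of_continuous ((continuous_res h.continuous).comp (continuous_rotSphere k 0)))
    (hc.comp (continuous_rotSphere k 0)).aestronglyMeasurable
    (Eventually.of_forall fun x t _ => hK _ trivial) (integrable_const _)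
    (Eventually.of_forall fun x t _ => hasDerivAt_comp_rotFlow h k t x)
  have hconst : (fun t => ∫ x : S2, ψ (rotSphere k t x) ∂dS) = fun _ => ∫ x : S2, ψ x ∂dS :=
    funext fun t => integral_comp_rotSphere k t (fun x : S2 => ψ x) (continuous_res h.continuous)
  have h0 := hd.2
  rw [hconst] at h0
  have := h0.unique (hasDerivAt_const (0 : ℝ) _)
  simpa [rotSphere, rotFlow_zero] using this

/-- The infinitesimal rotations are skew-adjoint. -/
lemma integral_rot_mul_conj {f g : E3 → ℂ} (hf : ContDiff ℝ ∞ f) (hg : ContDiff ℝ ∞ g) (k : Fin 3) :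
    ∫ x : S2, rot k f x * conj (g x) ∂dS = - ∫ x : S2, f x * conj (rot k g x) ∂dS := by
  have h := integral_rot (hf.mul (contDiff_conj hg)) k
  have e : ∀ x : E3, rot k (fun z => f z * conj (g z)) x
      = rot k f x * conj (g x) + f x * conj (rot k g x) := fun x => by
    rw [rot_mul hf (contDiff_conj hg), rot_conj hg]
  simp only [e] at h
  rw [integral_add (integrable_res ((contDiff_rot hf k).mul (contDiff_conj hg)))
    (integrable_res (hf.mul (contDiff_conj (contDiff_rot hg k))))] at h
  exact eq_neg_of_add_eq_zero_left h

/-- A function annihilated by all infinitesimal rotations is constant on the sphere. -/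
lemma eq_north_of_rot_eq_zero {f : E3 → ℂ} (hf : ContDiff ℝ ∞ f)
    (h : ∀ k (x : S2), rot k f x = 0) (x : S2) : f x = f (EuclideanSpace.single 2 (1 : ℝ)) := by
  have inv : ∀ k t (x : S2), f (rotFlow k t x) = f x := fun k t x => by
    have := is_const_of_deriv_eq_zero (f := fun t => f (rotFlow k t x))
      (fun t => (hasDerivAt_comp_rotFlow hf k t x).differentiableAt)
      (fun t => by rw [(hasDerivAt_comp_rotFlow hf k t x).deriv]; exact h k (rotSphere k t x)) t 0
    simpa [rotFlow_zero] using this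
  -- A rotation about the third axis moves `x` into the half plane `x 1 = 0 ≤ x 0`, and a rotation
  -- about the second axis moves it on to the north pole.
  have polar : ∀ a b : ℝ, ∃ t r : ℝ, r ^ 2 = a ^ 2 + b ^ 2 ∧ 0 ≤ r ∧ r * Real.cos t = a ∧
      r * Real.sin t = b := fun a b =>
    ⟨Complex.arg ⟨a, b⟩, ‖(⟨a, b⟩ : ℂ)‖, by rw [Complex.sq_norm, Complex.normSq_apply]; ring,
      norm_nonneg _, Complex.norm_mul_cos_arg _, Complex.norm_mul_sin_arg _⟩
  have hx : (x : E3) 0 ^ 2 + (x : E3) 1 ^ 2 + (x : E3) 2 ^ 2 = 1 := by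
    rw [← Fin.sum_univ_three (fun j => (x : E3) j ^ 2), ← EuclideanSpace.real_norm_sq_eq,
      mem_sphere_zero_iff_norm.1 x.2, one_pow]
  obtain ⟨t, r, hr, hr0, hc, hs⟩ := polar ((x : E3) 0) ((x : E3) 1)
  obtain ⟨t', r', hr', hr0', hc', hs'⟩ := polar ((x : E3) 2) r
  have hr1 : r' = 1 := by nlinarith
  refine (inv 2 t x).symm.trans ((inv 1 t' (rotSphere 2 t x)).symm.trans ?_)
  congr 1
  have e := Real.sin_sq_add_cos_sq t
  have e' := Real.sin_sq_add_cos_sq t'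
  subst hr1
  rw [one_mul] at hc' hs'
  ext j
  fin_cases j <;> simp [rotSphere, rotFlow_apply, rotGen_apply, ← hc, ← hs, ← hc', ← hs']
  · linear_combination (Real.cos t' * Real.sin t') * e
  · ring
  · linear_combination Real.sin t' ^ 2 * e + e'

/-- The fields `Curl φ` are divergence free, in the weak sense. With `g = - x × Curl φ` the integrand
is `∑ l, rot l F * g l`, and `∑ l, rot l (g l) = 0` is a combination of the commutation relations. -/
lemma integral_surfCurl_mul_surfGrad {φ F : E3 → ℂ} (hφ : ContDiff ℝ ∞ φ) (hF : ContDiff ℝ ∞ F) :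
    ∫ x : S2, ∑ j, surfCurl φ x j * surfGrad F x j ∂dS = 0 := by
  set g : Fin 3 → E3 → ℂ := fun l y => y (l + 2) * rot (l + 1) φ y - y (l + 1) * rot (l + 2) φ y
    with hg
  have hgs : ∀ l, ContDiff ℝ ∞ (g l) := fun l =>
    ((contDiff_coord _).mul (contDiff_rot hφ _)).sub ((contDiff_coord _).mul (contDiff_rot hφ _))
  have hdiv : ∀ y, ∑ l, rot l (g l) y = 0 := fun y => by
    have hr : ∀ l, rot l (g l) y = ((rotGen l y (l + 2) : ℝ) : ℂ) * rot (l + 1) φ y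
        + y (l + 2) * rot l (rot (l + 1) φ) y - (((rotGen l y (l + 1) : ℝ) : ℂ) * rot (l + 2) φ y
        + y (l + 1) * rot l (rot (l + 2) φ) y) := fun l => by
      simp only [hg]
      rw [rot_sub ((contDiff_coord _).mul (contDiff_rot hφ _))
        ((contDiff_coord _).mul (contDiff_rot hφ _)), rot_mul (contDiff_coord _) (contDiff_rot hφ _),
        rot_mul (contDiff_coord _) (contDiff_rot hφ _), rot_coord, rot_coord]
    have h0 := rot_comm hφ 0 y
    have h1 := rot_comm hφ 1 y
    have h2 := rot_comm hφ 2 y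
    have hs := sum_coord_mul_rot φ y
    simp only [hr, Fin.sum_univ_three, rotGen_apply] at hs ⊢
    simp at h0 h1 h2 hs ⊢
    linear_combination (y 2 : ℂ) * h0 + (y 0 : ℂ) * h1 + (y 1 : ℂ) * h2 - hs
  have e : ∀ x : S2, ∑ j, surfCurl φ x j * surfGrad F x j = ∑ l, rot l (fun z => F z * g l z) x :=
    fun x => by
    have h1 : ∑ l, rot l (fun z => F z * g l z) x
        = ∑ l, (rot l F x * g l x) + F x * ∑ l, rot l (g l) x := by
      rw [Finset.mul_sum, ← Finset.sum_add_distrib]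
      exact Finset.sum_congr rfl fun l _ => rot_mul hF (hgs l) l x
    rw [h1, hdiv]
    simp only [surfCurl_apply, surfGrad_apply, hg, Fin.sum_univ_three]
    simp
    ring
  simp only [e]
  rw [integral_finsetSum _ fun l _ => integrable_res (contDiff_rot (hF.mul (hgs l)) l)]
  exact Finset.sum_eq_zero fun l _ => integral_rot (hF.mul (hgs l)) l

/-! ### Legendre polynomials -/

/-- The `m`-th derivative of the Legendre polynomial `P_L`. -/
def legendreDeriv (L m : ℕ) : Polynomial ℂ := Polynomial.derivative^[m] (legendre L)

lemma derivative_legendreDeriv (L m : ℕ) :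
    Polynomial.derivative (legendreDeriv L m) = legendreDeriv L (m + 1) :=
  (Function.iterate_succ_apply' _ _ _).symm

open Polynomial in
/-- The derivatives of `u = (X² - 1)^L` satisfy the equations obtained by differentiating
`(X² - 1) u' = 2 L X u`. -/
lemma iterate_derivative_sq_sub_one_pow (L k : ℕ) :
    (X ^ 2 - 1 : ℂ[X]) * derivative^[k + 2] ((X ^ 2 - 1) ^ L)
      + 2 * ((k : ℂ[X]) + 1 - (L : ℂ[X])) * X * derivative^[k + 1] ((X ^ 2 - 1) ^ L)
      + ((k : ℂ[X]) + 1) * ((k : ℂ[X]) - 2 * (L : ℂ[X])) * derivative^[k] ((X ^ 2 - 1) ^ L) = 0 := by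
  have hC : (C 2 : ℂ[X]) = 2 := map_ofNat C 2
  induction k with
  | zero =>
    have h0 : (X ^ 2 - 1 : ℂ[X]) * derivative ((X ^ 2 - 1) ^ L)
        = 2 * (L : ℂ[X]) * X * (X ^ 2 - 1) ^ L := by
      rcases L with _ | n
      · simp
      · rw [derivative_pow]
        simp only [derivative_sub, derivative_X_pow, derivative_one, Nat.add_sub_cancel, map_natCast,
          Nat.cast_ofNat, hC]
        ring
    have h1 := congrArg derivative h0
    simp only [derivative_mul, derivative_sub, derivative_X_pow, derivative_one, derivative_X,
      derivative_natCast, derivative_ofNat, Nat.cast_ofNat, hC] at h1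
    simp only [Function.iterate_succ, Function.comp, Function.iterate_zero, id, zero_add]
    norm_num at h1 ⊢
    linear_combination h1
  | succ k ih =>
    have h1 := congrArg derivative ih
    simp only [derivative_mul, derivative_add, derivative_sub, derivative_X_pow, derivative_one,
      derivative_X, derivative_natCast, derivative_ofNat, derivative_zero, Nat.cast_ofNat, hC,
      ← Function.iterate_succ_apply'] at h1
    norm_num at h1 ⊢
    linear_combination h1

open Polynomial in
/-- The Legendre equation, differentiated `m` times. -/
lemma legendreDeriv_ode (L m : ℕ) (t : ℂ) :
    (1 - t ^ 2) * (legendreDeriv L (m + 2)).eval t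
      - 2 * ((m : ℂ) + 1) * t * (legendreDeriv L (m + 1)).eval t
      + ((L : ℂ) + m + 1) * (L - m) * (legendreDeriv L m).eval t = 0 := by
  have h := congrArg (eval t) (iterate_derivative_sq_sub_one_pow L (m + L))
  have e : ∀ n, (legendreDeriv L n).eval t = ((2 : ℂ) ^ L * (L.factorial : ℂ))⁻¹ *
      (derivative^[n + L] ((X ^ 2 - 1 : ℂ[X]) ^ L)).eval t := fun n => by
    rw [legendreDeriv, legendre, iterate_derivative_C_mul, ← Function.iterate_add_apply, eval_mul,
      eval_C]
  simp only [eval_add, eval_mul, eval_sub, eval_pow, eval_X, eval_one, eval_zero, eval_natCast,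
    eval_ofNat, Nat.cast_add] at h
  rw [e, e, e, show m + 2 + L = m + L + 2 by ring, show m + 1 + L = m + L + 1 by ring]
  linear_combination (-((2 : ℂ) ^ L * (L.factorial : ℂ))⁻¹) * h

open Polynomial in
lemma natDegree_sq_sub_one_pow (L : ℕ) : ((X ^ 2 - 1 : ℂ[X]) ^ L).natDegree = 2 * L := by
  rw [natDegree_pow, show (X ^ 2 - 1 : ℂ[X]) = X ^ 2 - C 1 by simp, natDegree_X_pow_sub_C, mul_comm]

open Polynomial in
lemma natDegree_iterate_derivative_eq (p : ℂ[X]) (k : ℕ) :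
    (derivative^[k] p).natDegree = p.natDegree - k := by
  induction k with
  | zero => simp
  | succ k ih => rw [Function.iterate_succ_apply', natDegree_derivative, ih]; omega

open Polynomial in
lemma natDegree_legendre (L : ℕ) : (legendre L).natDegree = L := by
  rw [legendre, natDegree_C_mul (by simp [Nat.factorial_ne_zero]), natDegree_iterate_derivative_eq,
    natDegree_sq_sub_one_pow]
  omega

lemma natDegree_legendreDeriv (L m : ℕ) : (legendreDeriv L m).natDegree = L - m := by
  rw [legendreDeriv, natDegree_iterate_derivative_eq, natDegree_legendre]

lemma legendreDeriv_eq_zero {L m : ℕ} (h : L < m) : legendreDeriv L m = 0 :=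
  Polynomial.iterate_derivative_eq_zero (by rwa [natDegree_legendre])

open Polynomial in
lemma legendre_eval_one (L : ℕ) : (legendre L).eval 1 = 1 := by
  have h1 : (derivative^[L] ((X ^ 2 - 1 : ℂ[X]) ^ L)).eval 1 = L.factorial * 2 ^ L := by
    rw [← factorial_smul_hasseDeriv]
    change (L.factorial • hasseDeriv L ((X ^ 2 - 1 : ℂ[X]) ^ L)).eval 1 = _
    rw [nsmul_eq_mul, eval_mul, eval_natCast, ← taylor_coeff, taylor_pow]
    have : taylor 1 (X ^ 2 - 1 : ℂ[X]) = X * (X + 2) := by simp [taylor_X]; ring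
    rw [this, mul_pow, coeff_X_pow_mul']
    simp [coeff_zero_eq_eval_zero]
  rw [legendre, eval_mul, eval_C, h1, mul_comm (L.factorial : ℂ)]
  exact inv_mul_cancel₀ (mul_ne_zero (by simp) (by simp [Nat.factorial_ne_zero]))

open Polynomial in
lemma legendreDeriv_ne_zero {L m : ℕ} (h : m ≤ L) : legendreDeriv L m ≠ 0 := by
  induction m with
  | zero =>
    intro h0
    have := legendre_eval_one L
    rw [show legendre L = legendreDeriv L 0 from rfl, h0] at this
    simp at this
  | succ m ih =>
    intro h0
    rw [← derivative_legendreDeriv] at h0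
    have := derivative_eq_zero.1 h0
    rw [natDegree_legendreDeriv] at this
    omega

open Polynomial in
lemma conj_eval_legendreDeriv (L m : ℕ) (t : ℝ) :
    conj ((legendreDeriv L m).eval (t : ℂ)) = (legendreDeriv L m).eval (t : ℂ) := by
  have h : legendreDeriv L m = (derivative^[m] (C ((2 ^ L * (L.factorial : ℝ))⁻¹) *
      derivative^[L] ((X ^ 2 - 1 : ℝ[X]) ^ L))).map Complex.ofRealHom := by
    rw [legendreDeriv, legendre]
    simp [← Polynomial.iterate_derivative_map]
  rw [h, eval_map, show (t : ℂ) = Complex.ofRealHom t from rfl, eval₂_at_apply]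
  exact Complex.conj_ofReal _

/-! ### The ladder relations for the spherical harmonics -/

/-- The normalizing factor of `Y_{L,m}` and `Y_{L,-m}`. -/
def harmNorm (L m : ℕ) : ℝ := Real.sqrt ((2 * L + 1) / (4 * Real.pi) *
  (((L - m).factorial : ℝ) / ((L + m).factorial : ℝ)))

/-- The ladder coefficient `√(L(L+1) - m(m+1))`. For `|m| > L` it may be the square root of a negative
number, hence zero; the ladder relations then remain true, as `Y_{L,m} = 0`. -/
def ladder (L : ℕ) (m : ℤ) : ℝ := Real.sqrt (L * (L + 1) - m * (m + 1))

lemma harmNorm_eq {L m : ℕ} (h : m < L) : harmNorm L m = ladder L m * harmNorm L (m + 1) := by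
  have hm : (m : ℝ) + 1 ≤ L := by exact_mod_cast h
  obtain ⟨d, rfl⟩ := Nat.exists_eq_add_of_lt h
  have e1 : m + d + 1 - m = d + 1 := by omega
  have e2 : m + d + 1 - (m + 1) = d := by omega
  rw [harmNorm, harmNorm, ladder, ← Real.sqrt_mul (by push_cast at hm ⊢; nlinarith)]
  congr 1
  rw [e1, e2, show m + d + 1 + (m + 1) = (m + d + 1 + m) + 1 by ring, Nat.factorial_succ,
    Nat.factorial_succ]
  push_cast
  have h1 : ((m + d + 1 + m).factorial : ℝ) ≠ 0 := by simp [Nat.factorial_ne_zero]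
  have h2 : ((m : ℝ) + d + 1 + m + 1) ≠ 0 := by positivity
  field_simp
  ring

lemma sphHarm_natCast (L m : ℕ) (x : E3) : sphHarm L m x = (harmNorm L m : ℂ) * ((-1) ^ m *
    ((x 0 : ℂ) + Complex.I * (x 1 : ℂ)) ^ m) * (legendreDeriv L m).eval (x 2 : ℂ) := by
  simp [sphHarm, harmNorm, legendreDeriv]

lemma sphHarm_neg_natCast (L m : ℕ) (x : E3) :
    sphHarm L (-m) x = (-1) ^ m * conj (sphHarm L m x) := by
  rw [sphHarm_natCast]
  simp only [map_mul, map_pow, conj_eval_legendreDeriv]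
  have h1 : ((-1 : ℂ) ^ m) * (-1) ^ m = 1 := by rw [← mul_pow]; simp
  rcases Nat.eq_zero_or_pos m with rfl | hm
  · simp [sphHarm, harmNorm, legendreDeriv]
  · have : ¬ (0 : ℤ) ≤ -m := by omega
    simp only [sphHarm, this, if_false, Int.natAbs_neg, Int.natAbs_natCast, map_neg, map_one,
      Complex.conj_ofReal, map_add, map_mul, Complex.conj_I]
    rw [harmNorm, legendreDeriv, neg_mul, ← sub_eq_add_neg]
    linear_combination (-(Real.sqrt ((2 * L + 1) / (4 * Real.pi) *
      (((L - m).factorial : ℝ) / ((L + m).factorial : ℝ))) : ℂ) *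
        ((x 0 : ℂ) - Complex.I * (x 1 : ℂ)) ^ m *
        (Polynomial.derivative^[m] (legendre L)).eval (x 2 : ℂ)) * h1

/-- The formula for `Y_{L,m}` gives zero for the orders `|m| > L` that are not in use, so the ladder
relations below hold for all integers `m`. -/
lemma sphHarm_eq_zero {L : ℕ} {m : ℤ} (h : L < m.natAbs) (x : E3) : sphHarm L m x = 0 := by
  have := legendreDeriv_eq_zero h
  rw [legendreDeriv] at this
  simp [sphHarm, this]

/-- The raising operator `R₀ + i R₁`. -/
def rotUp (ψ : E3 → ℂ) (y : E3) : ℂ := rot 0 ψ y + Complex.I * rot 1 ψ y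

/-- The lowering operator `R₀ - i R₁`. -/
def rotDown (ψ : E3 → ℂ) (y : E3) : ℂ := rot 0 ψ y - Complex.I * rot 1 ψ y

lemma contDiff_zeta_pow (m : ℕ) :
    ContDiff ℝ ∞ (fun x : E3 => ((x 0 : ℂ) + Complex.I * (x 1 : ℂ)) ^ m) :=
  ((contDiff_coord 0).add (contDiff_const.mul (contDiff_coord 1))).pow m

lemma contDiff_eval_coord (q : Polynomial ℂ) (j : Fin 3) :
    ContDiff ℝ ∞ (fun x : E3 => q.eval (x j : ℂ)) := by
  induction q using Polynomial.induction_on' with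
  | add p q hp hq => simpa only [Polynomial.eval_add] using hp.add hq
  | monomial n a =>
    simp only [Polynomial.eval_monomial]
    exact contDiff_const.mul ((contDiff_coord j).pow n)

lemma rot_zeta_pow_mul_eval (m : ℕ) (c : ℂ) (q : Polynomial ℂ) (k : Fin 3) (y : E3) :
    rot k (fun x : E3 => c * (((x 0 : ℂ) + Complex.I * (x 1 : ℂ)) ^ m * q.eval (x 2 : ℂ))) y =
      c * (m * ((y 0 : ℂ) + Complex.I * (y 1 : ℂ)) ^ (m - 1) *
          ((rotGen k y 0 : ℂ) + Complex.I * (rotGen k y 1 : ℂ)) * q.eval (y 2 : ℂ) +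
        ((y 0 : ℂ) + Complex.I * (y 1 : ℂ)) ^ m * (q.derivative.eval (y 2 : ℂ) *
          (rotGen k y 2 : ℂ))) := by
  rw [rot_const_mul ((contDiff_zeta_pow m).mul (contDiff_eval_coord q 2)),
    rot_mul (contDiff_zeta_pow m) (contDiff_eval_coord q 2),
    rot_pow ((contDiff_coord 0).add (contDiff_const.mul (contDiff_coord 1))),
    rot_add (contDiff_coord 0) (contDiff_const.mul (contDiff_coord 1)),
    rot_const_mul (contDiff_coord 1), rot_coord, rot_coord, rot_eval (contDiff_coord 2), rot_coord]

lemma sphHarm_natCast_fun (L m : ℕ) : sphHarm L m = fun x : E3 => ((harmNorm L m : ℂ) * (-1) ^ m) *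
    (((x 0 : ℂ) + Complex.I * (x 1 : ℂ)) ^ m * (legendreDeriv L m).eval (x 2 : ℂ)) := by
  funext x
  rw [sphHarm_natCast]
  ring

lemma rot_two_sphHarm_natCast (L m : ℕ) (y : E3) :
    rot 2 (sphHarm L m) y = -(Complex.I * m) * sphHarm L m y := by
  rw [sphHarm_natCast_fun, rot_zeta_pow_mul_eval]
  simp only [rotGen_apply]
  rcases m with _ | m
  · simp
  · simp
    linear_combination ((harmNorm L (m + 1) : ℂ) * (-1) ^ (m + 1) * (m + 1) *
      ((y 0 : ℂ) + Complex.I * (y 1 : ℂ)) ^ m * (legendreDeriv L (m + 1)).eval (y 2 : ℂ) * y 1) *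
      Complex.I_sq

lemma rotUp_sphHarm_natCast (L m : ℕ) (y : E3) :
    rotUp (sphHarm L m) y = -(Complex.I * ladder L m) * sphHarm L (m + 1 : ℕ) y := by
  rw [rotUp, sphHarm_natCast_fun, rot_zeta_pow_mul_eval, rot_zeta_pow_mul_eval, sphHarm_natCast,
    derivative_legendreDeriv]
  simp only [rotGen_apply]
  rcases lt_or_ge m L with h | h
  · rw [harmNorm_eq h]
    simp
    linear_combination (-(ladder L m * harmNorm L (m + 1) : ℂ) * (-1) ^ m *
      ((y 0 : ℂ) + Complex.I * (y 1 : ℂ)) ^ m * (legendreDeriv L (m + 1)).eval (y 2 : ℂ) * y 1) *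
      Complex.I_sq
  · rw [legendreDeriv_eq_zero (Nat.lt_succ_of_le h)]
    simp
    ring

lemma rotDown_sphHarm_natCast (L m : ℕ) (x : S2) :
    rotDown (sphHarm L (m + 1 : ℕ)) x = -(Complex.I * ladder L m) * sphHarm L m x := by
  have hx := sum_coord_sq x
  rw [Fin.sum_univ_three] at hx
  have ode : _ * (legendreDeriv L (m + 1 + 1)).eval _ - _ + _ = 0 :=
    legendreDeriv_ode L m ((x : E3) 2)
  have hN : (harmNorm L (m + 1) : ℂ) * ((L + m + 1) * (L - m)) *
      (legendreDeriv L m).eval ((x : E3) 2 : ℂ) = ladder L m * harmNorm L m * (legendreDeriv L m).eval ((x : E3) 2 : ℂ) := by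
    rcases lt_trichotomy m L with h | rfl | h
    · have hm : (m : ℝ) + 1 ≤ L := by exact_mod_cast h
      have : ((ladder L m : ℂ)) * ladder L m = (L + m + 1) * (L - m) := by
        rw [← Complex.ofReal_mul, ladder, Real.mul_self_sqrt (by push_cast; nlinarith)]
        push_cast
        ring
      rw [harmNorm_eq h, Complex.ofReal_mul]
      linear_combination (-(harmNorm L (m + 1) : ℂ) *
        (legendreDeriv L m).eval ((x : E3) 2 : ℂ)) * this
    · simp [ladder]
    · simp [legendreDeriv_eq_zero h]
  rw [rotDown, sphHarm_natCast_fun, rot_zeta_pow_mul_eval, rot_zeta_pow_mul_eval, sphHarm_natCast,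
    derivative_legendreDeriv]
  simp only [rotGen_apply]
  simp
  linear_combination (-(-1) ^ m * Complex.I * ((x : E3) 0 + Complex.I * (x : E3) 1) ^ m) * hN
    + (harmNorm L (m + 1) * Complex.I * (-1) ^ m *
      ((x : E3) 0 + Complex.I * (x : E3) 1) ^ m) * (ode +
        (legendreDeriv L (m + 1 + 1)).eval ((x : E3) 2 : ℂ) * hx)
    + (harmNorm L (m + 1) * (-1) ^ m * ((x : E3) 0 + Complex.I * (x : E3) 1) ^ m *
      (x : E3) 0 * (x : E3) 1 * (legendreDeriv L (m + 1 + 1)).eval ((x : E3) 2 : ℂ)) * Complex.I_sq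

lemma sphHarm_neg (L : ℕ) (m : ℤ) (x : E3) :
    sphHarm L (-m) x = (-1) ^ m * conj (sphHarm L m x) := by
  obtain ⟨n, rfl | rfl⟩ := m.eq_nat_or_neg
  · rw [sphHarm_neg_natCast, zpow_natCast]
  · rw [sphHarm_neg_natCast, neg_neg, zpow_neg, zpow_natCast]
    simp

lemma sphHarm_neg_fun (L : ℕ) (m : ℤ) :
    sphHarm L (-m) = fun x => (-1) ^ m * conj (sphHarm L m x) := funext (sphHarm_neg L m)

lemma rotUp_const_mul_conj {f : E3 → ℂ} (hf : ContDiff ℝ ∞ f) (c : ℂ) (y : E3) :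
    rotUp (fun z => c * conj (f z)) y = c * conj (rotDown f y) := by
  rw [rotUp, rotDown, rot_const_mul (contDiff_conj hf), rot_const_mul (contDiff_conj hf),
    rot_conj hf, rot_conj hf]
  simp
  ring

lemma rotDown_const_mul_conj {f : E3 → ℂ} (hf : ContDiff ℝ ∞ f) (c : ℂ) (y : E3) :
    rotDown (fun z => c * conj (f z)) y = c * conj (rotUp f y) := by
  rw [rotUp, rotDown, rot_const_mul (contDiff_conj hf), rot_const_mul (contDiff_conj hf),
    rot_conj hf, rot_conj hf]
  simp
  ring

lemma ladder_neg (L : ℕ) (m : ℤ) : ladder L (-m) = ladder L (m - 1) := by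
  unfold ladder
  congr 1
  push_cast
  ring

lemma rotUp_sphHarm (L : ℕ) (m : ℤ) (x : S2) :
    rotUp (sphHarm L m) x = -(Complex.I * ladder L m) * sphHarm L (m + 1) x := by
  obtain ⟨n, rfl | rfl⟩ := m.eq_nat_or_neg
  · exact rotUp_sphHarm_natCast L n x
  · rcases n with _ | n
    · simpa using rotUp_sphHarm_natCast L 0 x
    · rw [sphHarm_neg_fun, rotUp_const_mul_conj (contDiff_sphHarm _ _), rotDown_sphHarm_natCast,
        ladder_neg, show -((n + 1 : ℕ) : ℤ) + 1 = -(n : ℤ) by push_cast; ring, sphHarm_neg,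
        zpow_natCast, zpow_natCast, pow_succ]
      simp
      ring

lemma rotDown_sphHarm (L : ℕ) (m : ℤ) (x : S2) :
    rotDown (sphHarm L m) x = -(Complex.I * ladder L (m - 1)) * sphHarm L (m - 1) x := by
  obtain ⟨m, rfl⟩ : ∃ n, m = -n := ⟨-m, by simp⟩
  rw [sphHarm_neg_fun, rotDown_const_mul_conj (contDiff_sphHarm _ _), rotUp_sphHarm,
    ← ladder_neg, show -m - 1 = -(m + 1) by ring, sphHarm_neg, neg_neg, zpow_add₀ (by norm_num)]
  simp
  ring

lemma rot_two_sphHarm (L : ℕ) (m : ℤ) (y : E3) :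
    rot 2 (sphHarm L m) y = -(Complex.I * m) * sphHarm L m y := by
  obtain ⟨n, rfl | rfl⟩ := m.eq_nat_or_neg
  · exact rot_two_sphHarm_natCast L n y
  · rw [sphHarm_neg_fun, rot_const_mul (contDiff_conj (contDiff_sphHarm _ _)),
      rot_conj (contDiff_sphHarm _ _), rot_two_sphHarm_natCast]
    simp
    ring

lemma ladder_sq {L : ℕ} {m : ℤ} (h : m.natAbs ≤ L) :
    (ladder L m : ℂ) * ladder L m = L * (L + 1) - m * (m + 1) := by
  have h1 : (m : ℝ) ≤ L := by exact_mod_cast (by omega : m ≤ L)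
  have h2 : -(m : ℝ) ≤ L := by exact_mod_cast (by omega : -m ≤ L)
  rw [← Complex.ofReal_mul, ladder, Real.mul_self_sqrt (by nlinarith)]
  push_cast
  ring

lemma ladder_pos {L : ℕ} {m : ℤ} (h : -(L : ℤ) ≤ m) (h' : m < L) : 0 < ladder L m := by
  have h1 : (m : ℝ) + 1 ≤ L := by exact_mod_cast h'
  have h2 : -(L : ℝ) ≤ m := by exact_mod_cast h
  exact Real.sqrt_pos.2 (by nlinarith)

/-- Derivatives along the first two axes in terms of the ladder operators. -/
lemma rot_zero_eq (ψ : E3 → ℂ) (y : E3) : rot 0 ψ y = (1 / 2) * (rotUp ψ y + rotDown ψ y) := by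
  simp only [rotUp, rotDown]; ring

lemma rot_one_eq (ψ : E3 → ℂ) (y : E3) :
    rot 1 ψ y = (-Complex.I / 2) * (rotUp ψ y - rotDown ψ y) := by
  simp only [rotUp, rotDown]
  linear_combination (rot 1 ψ y) * Complex.I_sq

lemma rotUp_congr {f g : E3 → ℂ} (hf : ContDiff ℝ ∞ f) (hg : ContDiff ℝ ∞ g)
    (h : ∀ x : S2, f x = g x) (x : S2) : rotUp f x = rotUp g x := by
  rw [rotUp, rotUp, rot_congr hf hg h, rot_congr hf hg h]

lemma rotDown_congr {f g : E3 → ℂ} (hf : ContDiff ℝ ∞ f) (hg : ContDiff ℝ ∞ g)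
    (h : ∀ x : S2, f x = g x) (x : S2) : rotDown f x = rotDown g x := by
  rw [rotDown, rotDown, rot_congr hf hg h, rot_congr hf hg h]

lemma contDiff_rotUp {ψ : E3 → ℂ} (h : ContDiff ℝ ∞ ψ) : ContDiff ℝ ∞ (rotUp ψ) :=
  (contDiff_rot h 0).add (contDiff_const.mul (contDiff_rot h 1))

lemma contDiff_rotDown {ψ : E3 → ℂ} (h : ContDiff ℝ ∞ ψ) : ContDiff ℝ ∞ (rotDown ψ) :=
  (contDiff_rot h 0).sub (contDiff_const.mul (contDiff_rot h 1))

/-- The Laplace–Beltrami operator, as the Casimir operator of the rotation algebra. -/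
def sphLap (ψ : E3 → ℂ) (y : E3) : ℂ := ∑ k, rot k (rot k ψ) y

lemma contDiff_sphLap {ψ : E3 → ℂ} (h : ContDiff ℝ ∞ ψ) : ContDiff ℝ ∞ (sphLap ψ) :=
  ContDiff.sum fun k _ => contDiff_rot (contDiff_rot h k) k

lemma sphLap_eq {ψ : E3 → ℂ} (h : ContDiff ℝ ∞ ψ) (y : E3) : sphLap ψ y =
    (1 / 2) * (rotUp (rotDown ψ) y + rotDown (rotUp ψ) y) + rot 2 (rot 2 ψ) y := by
  have h0 := contDiff_rot h 0
  have h1 := contDiff_const (c := Complex.I).mul (contDiff_rot h 1)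
  have e1 : ∀ k, rot k (rotUp ψ) y = rot k (rot 0 ψ) y + Complex.I * rot k (rot 1 ψ) y := fun k => by
    unfold rotUp
    rw [rot_add h0 h1, rot_const_mul (contDiff_rot h 1)]
  have e2 : ∀ k, rot k (rotDown ψ) y = rot k (rot 0 ψ) y - Complex.I * rot k (rot 1 ψ) y :=
    fun k => by
    unfold rotDown
    rw [rot_sub h0 h1, rot_const_mul (contDiff_rot h 1)]
  rw [rotUp, rotDown, e1, e1, e2, e2, sphLap, Fin.sum_univ_three]
  linear_combination rot 1 (rot 1 ψ) y * Complex.I_sq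

/-- The spherical harmonics are eigenfunctions of the Laplace–Beltrami operator. -/
lemma sphLap_sphHarm (L : ℕ) (m : ℤ) (x : S2) :
    sphLap (sphHarm L m) x = -(L * (L + 1)) * sphHarm L m x := by
  have hY := contDiff_sphHarm L
  rw [sphLap_eq (hY m), rotUp_congr (contDiff_rotDown (hY m)) (contDiff_const.mul (hY _))
    (rotDown_sphHarm L m), rotDown_congr (contDiff_rotUp (hY m)) (contDiff_const.mul (hY _))
    (rotUp_sphHarm L m), rot_congr (contDiff_rot (hY m) 2) (contDiff_const.mul (hY _))
    (fun x => rot_two_sphHarm L m x)]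
  have e1 : ∀ (c : ℂ) (n : ℤ), rotUp (fun z => c * sphHarm L n z) x = c * rotUp (sphHarm L n) x :=
    fun c n => by
    rw [rotUp, rotUp, rot_const_mul (hY n), rot_const_mul (hY n)]; ring
  have e2 : ∀ (c : ℂ) (n : ℤ), rotDown (fun z => c * sphHarm L n z) x
      = c * rotDown (sphHarm L n) x := fun c n => by
    rw [rotDown, rotDown, rot_const_mul (hY n), rot_const_mul (hY n)]; ring
  rw [e1, e2, rot_const_mul (hY m), rotUp_sphHarm, rotDown_sphHarm, rot_two_sphHarm,
    sub_add_cancel, add_sub_cancel_right]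
  rcases lt_or_ge L m.natAbs with h | h
  · simp [sphHarm_eq_zero h]
  · have h1 := ladder_sq h
    have h2 : (ladder L (m - 1) : ℂ) * ladder L (m - 1) = L * (L + 1) - m * (m - 1) := by
      rw [← ladder_neg, ladder_sq (by omega)]
      push_cast
      ring
    linear_combination (1 / 2 * sphHarm L m x) * (Complex.I ^ 2 * h1 + Complex.I ^ 2 * h2)
      + (sphHarm L m x * (L * (L + 1))) * Complex.I_sq

/-! ### Orthonormality of the spherical harmonics and the addition theorem -/

/-- The `L²` inner product `∫ f conj g dS` of the restrictions to the sphere of two functions. -/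
def sphInner (f g : E3 → ℂ) : ℂ := ∫ x : S2, f x * conj (g x) ∂dS

lemma integrable_mul_conj {f g : E3 → ℂ} (hf : ContDiff ℝ ∞ f) (hg : ContDiff ℝ ∞ g) :
    Integrable (fun x : S2 => f x * conj (g x)) dS := integrable_res (hf.mul (contDiff_conj hg))

lemma sphInner_congr {f f' g g' : E3 → ℂ} (hf : ∀ x : S2, f x = f' x) (hg : ∀ x : S2, g x = g' x) :
    sphInner f g = sphInner f' g' := by simp only [sphInner, hf, hg]

lemma sphInner_const_mul_left {c : ℂ} {f f' g : E3 → ℂ} (h : ∀ x : S2, f x = c * f' x) :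
    sphInner f g = c * sphInner f' g := by
  simp only [sphInner, h, mul_assoc, integral_const_mul]

lemma sphInner_const_mul_right {c : ℂ} {f g g' : E3 → ℂ} (h : ∀ x : S2, g x = c * g' x) :
    sphInner f g = conj c * sphInner f g' := by
  simp only [sphInner, h, map_mul, ← integral_const_mul]
  congr 1
  funext x
  ring

lemma sphInner_conj (f g : E3 → ℂ) : conj (sphInner f g) = sphInner g f := by
  rw [sphInner, sphInner, ← integral_conj]
  simp [mul_comm]

lemma sphInner_sum_left {ι : Type*} (s : Finset ι) {f : ι → E3 → ℂ} {g : E3 → ℂ}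
    (hf : ∀ i, ContDiff ℝ ∞ (f i)) (hg : ContDiff ℝ ∞ g) :
    sphInner (fun x => ∑ i ∈ s, f i x) g = ∑ i ∈ s, sphInner (f i) g := by
  simp only [sphInner, Finset.sum_mul]
  exact integral_finsetSum _ fun i _ => integrable_mul_conj (hf i) hg

lemma sphInner_add_left {f f' g : E3 → ℂ} (hf : ContDiff ℝ ∞ f) (hf' : ContDiff ℝ ∞ f')
    (hg : ContDiff ℝ ∞ g) : sphInner (fun x => f x + f' x) g = sphInner f g + sphInner f' g := by
  simp only [sphInner, add_mul]
  exact integral_add (integrable_mul_conj hf hg) (integrable_mul_conj hf' hg)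

lemma sphInner_rot {f g : E3 → ℂ} (hf : ContDiff ℝ ∞ f) (hg : ContDiff ℝ ∞ g) (k : Fin 3) :
    sphInner (rot k f) g = - sphInner f (rot k g) := integral_rot_mul_conj hf hg k

lemma sphInner_rot_rot {f g : E3 → ℂ} (hf : ContDiff ℝ ∞ f) (hg : ContDiff ℝ ∞ g) :
    ∑ k, sphInner (rot k f) (rot k g) = - sphInner (sphLap f) g := by
  have h : sphLap f = fun y => ∑ k, rot k (rot k f) y := rfl
  rw [h, sphInner_sum_left _ (fun k => contDiff_rot (contDiff_rot hf k) k) hg,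
    ← Finset.sum_neg_distrib]
  exact Finset.sum_congr rfl fun k _ => by rw [sphInner_rot (contDiff_rot hf k) hg, neg_neg]

lemma sphInner_sphLap {f g : E3 → ℂ} (hf : ContDiff ℝ ∞ f) (hg : ContDiff ℝ ∞ g) :
    sphInner (sphLap f) g = sphInner f (sphLap g) := by
  have h1 := sphInner_rot_rot hf hg
  have h2 := congrArg conj (sphInner_rot_rot hg hf)
  simp only [map_sum, map_neg, sphInner_conj] at h2
  exact neg_inj.1 (h1.symm.trans h2)

lemma sphInner_rotUp {f g : E3 → ℂ} (hf : ContDiff ℝ ∞ f) (hg : ContDiff ℝ ∞ g) :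
    sphInner (rotUp f) g = - sphInner f (rotDown g) := by
  have h1 := sphInner_rot hf hg 0
  have h2 := sphInner_rot hf hg 1
  have e1 : sphInner (rotUp f) g = sphInner (rot 0 f) g + Complex.I * sphInner (rot 1 f) g := by
    rw [← sphInner_const_mul_left (f := fun x => Complex.I * rot 1 f x) fun _ => rfl,
      ← sphInner_add_left (contDiff_rot hf 0) (contDiff_const.mul (contDiff_rot hf 1)) hg]
    rfl
  have e2 : sphInner (rotDown g) f = sphInner (rot 0 g) f + (-Complex.I) * sphInner (rot 1 g) f := by
    rw [← sphInner_const_mul_left (f := fun x => -Complex.I * rot 1 g x) fun _ => rfl,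
      ← sphInner_add_left (contDiff_rot hg 0) (contDiff_const.mul (contDiff_rot hg 1)) hf]
    refine sphInner_congr (fun x => ?_) fun _ => rfl
    rw [rotDown]
    ring
  rw [← sphInner_conj _ f, e2, e1, h1, h2]
  simp [sphInner_conj]
  ring

/-- Orthogonality: `rot 2` separates the orders and the Laplacian the degrees. -/
lemma sphInner_sphHarm_of_ne {p q : ℕ × ℤ} (h : p ≠ q) :
    sphInner (sphHarm p.1 p.2) (sphHarm q.1 q.2) = 0 := by
  have hp := contDiff_sphHarm p.1 p.2
  have hq := contDiff_sphHarm q.1 q.2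
  by_cases hL : p.1 = q.1
  · have hm : p.2 ≠ q.2 := fun e => h (Prod.ext hL e)
    have e := sphInner_rot hp hq 2
    rw [sphInner_const_mul_left fun x => rot_two_sphHarm p.1 p.2 x,
      sphInner_const_mul_right fun x => rot_two_sphHarm q.1 q.2 x] at e
    simp only [map_neg, map_mul, Complex.conj_I, map_intCast] at e
    have h3 : (Complex.I * ((p.2 : ℂ) - q.2)) ≠ 0 :=
      mul_ne_zero Complex.I_ne_zero (sub_ne_zero.2 (by exact_mod_cast hm))
    refine (mul_eq_zero.1 ?_).resolve_left h3
    linear_combination -e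
  · have e := sphInner_sphLap hp hq
    rw [sphInner_const_mul_left (sphLap_sphHarm p.1 p.2),
      sphInner_const_mul_right (sphLap_sphHarm q.1 q.2)] at e
    simp only [map_neg, map_mul, map_add, map_one, map_natCast] at e
    have h3 : ((p.1 : ℂ) - q.1) * (p.1 + q.1 + 1) ≠ 0 :=
      mul_ne_zero (sub_ne_zero.2 (by exact_mod_cast hL))
        (by exact_mod_cast Nat.succ_ne_zero (p.1 + q.1))
    refine (mul_eq_zero.1 ?_).resolve_left h3
    linear_combination -e

/-- The norm does not depend on the order, as raising and lowering are adjoint up to sign. -/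
lemma sphInner_sphHarm_succ {L : ℕ} {m : ℤ} (h : -(L : ℤ) ≤ m) (h' : m < L) :
    sphInner (sphHarm L (m + 1)) (sphHarm L (m + 1)) = sphInner (sphHarm L m) (sphHarm L m) := by
  have e := sphInner_rotUp (contDiff_sphHarm L m) (contDiff_sphHarm L (m + 1))
  rw [sphInner_const_mul_left (rotUp_sphHarm L m),
    sphInner_const_mul_right (rotDown_sphHarm L (m + 1)), add_sub_cancel_right] at e
  simp only [map_neg, map_mul, Complex.conj_I, Complex.conj_ofReal] at e
  have h3 : (Complex.I * ladder L m) ≠ 0 := mul_ne_zero Complex.I_ne_zero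
    (by exact_mod_cast (ladder_pos h h').ne')
  refine mul_left_cancel₀ h3 ?_
  linear_combination -e

lemma sphHarm_north (L : ℕ) {m : ℤ} (h : m ≠ 0) :
    sphHarm L m (EuclideanSpace.single 2 (1 : ℝ)) = 0 := by
  simp [sphHarm, h]

lemma sphHarm_zero_north (L : ℕ) : sphHarm L 0 (EuclideanSpace.single 2 (1 : ℝ))
    = Real.sqrt ((2 * L + 1) / (4 * Real.pi)) := by
  have : (L.factorial : ℝ) ≠ 0 := by simp [Nat.factorial_ne_zero]
  simp [sphHarm, legendre_eval_one, this]

/-- The addition theorem on the diagonal: the sum is invariant under rotations, and it is computed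
at the north pole. -/
lemma sum_sphHarm_mul_conj (L : ℕ) (x : S2) :
    ∑ i ∈ Finset.range (2 * L + 1), sphHarm L (i - L) x * conj (sphHarm L (i - L) x)
      = (2 * L + 1) / (4 * Real.pi) := by
  have hY := contDiff_sphHarm L
  set S : E3 → ℂ := fun y => ∑ i ∈ Finset.range (2 * L + 1),
    sphHarm L (i - L) y * conj (sphHarm L (i - L) y) with hS
  have hSs : ContDiff ℝ ∞ S := ContDiff.sum fun i _ => (hY _).mul (contDiff_conj (hY _))
  have hrot : ∀ k y, rot k S y = ∑ i ∈ Finset.range (2 * L + 1),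
      (rot k (sphHarm L (i - L)) y * conj (sphHarm L (i - L) y) +
        sphHarm L (i - L) y * conj (rot k (sphHarm L (i - L)) y)) := fun k y => by
    rw [hS, rot_sum (fun i : ℕ => (hY ((i : ℤ) - L)).mul (contDiff_conj (hY _)))]
    exact Finset.sum_congr rfl fun i _ => by
      rw [rot_mul (hY _) (contDiff_conj (hY _)), rot_conj (hY _)]
  have hup : ∀ y : S2, rotUp S y = 0 := fun y => by
    -- By the ladder relations the sum telescopes.
    set T : ℕ → ℂ := fun i => Complex.I * ladder L (i - L - 1) * (sphHarm L (i - L) y *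
      conj (sphHarm L (i - L - 1) y)) with hT
    have h0 : T 0 = 0 := by simp [hT, sphHarm_eq_zero (L := L) (m := -(L : ℤ) - 1) (by omega)]
    have h1 : T (2 * L + 1) = 0 := by
      simp only [hT]
      rw [sphHarm_eq_zero (m := ((2 * L + 1 : ℕ) : ℤ) - L) (by omega)]
      simp
    have h2 := Finset.sum_range_sub' T (2 * L + 1)
    rw [h0, h1, sub_zero] at h2
    rw [← h2, rotUp, hrot, hrot, Finset.mul_sum, ← Finset.sum_add_distrib]
    refine Finset.sum_congr rfl fun i _ => ?_
    have e1 := rotUp_sphHarm L (i - L) y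
    have e2 := congrArg conj (rotDown_sphHarm L (i - L) y)
    simp only [rotUp, rotDown, map_sub, map_mul, map_neg, Complex.conj_I, Complex.conj_ofReal,
      hT, show ((i + 1 : ℕ) : ℤ) - L = i - L + 1 by push_cast; ring, add_sub_cancel_right] at e1 e2 ⊢
    linear_combination conj (sphHarm L (i - L) y) * e1 + sphHarm L (i - L) y * e2
  have hreal : ∀ z, conj (S z) = S z := fun z => by
    simp [hS, mul_comm]
  have hdown : ∀ y : S2, rotDown S y = 0 := fun y => by
    have h := rotUp_const_mul_conj hSs 1 y
    simp only [hreal, one_mul] at h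
    rw [hup] at h
    simpa using h.symm
  have h2 : ∀ y : S2, rot 2 S y = 0 := fun y => by
    rw [hrot]
    refine Finset.sum_eq_zero fun i _ => ?_
    rw [rot_two_sphHarm]
    simp
    ring
  have hc := eq_north_of_rot_eq_zero hSs (fun k y => by
    fin_cases k
    · simp [rot_zero_eq, hup, hdown]
    · simp [rot_one_eq, hup, hdown]
    · exact h2 y) x
  rw [show (∑ i ∈ Finset.range (2 * L + 1), sphHarm L (i - L) x * conj (sphHarm L (i - L) x)) = S x
    from rfl, hc, hS]
  simp only
  rw [Finset.sum_eq_single L]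
  · rw [sub_self, sphHarm_zero_north, Complex.conj_ofReal, ← Complex.ofReal_mul,
      Real.mul_self_sqrt (by positivity)]
    push_cast
    ring
  · intro i _ hi
    rw [sphHarm_north L (by omega)]
    simp
  · intro h
    exact absurd (Finset.mem_range.2 (by omega)) h

/-- The norms along the orders agree, and their sum is known from the addition theorem. -/
lemma sphInner_sphHarm_self {L : ℕ} {m : ℤ} (h : m.natAbs ≤ L) :
    sphInner (sphHarm L m) (sphHarm L m) = 1 := by
  have heq : ∀ i : ℕ, i ≤ 2 * L → sphInner (sphHarm L (i - L)) (sphHarm L (i - L))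
      = sphInner (sphHarm L (-L)) (sphHarm L (-L)) := fun i => by
    induction i with
    | zero => simp
    | succ i ih =>
      intro hi
      rw [← ih (by omega), ← sphInner_sphHarm_succ (m := i - L) (by omega) (by omega)]
      rw [show ((i + 1 : ℕ) : ℤ) - L = i - L + 1 by push_cast; ring]
  have hsum : ∑ i ∈ Finset.range (2 * L + 1), sphInner (sphHarm L (i - L)) (sphHarm L (i - L))
      = 2 * L + 1 := by
    simp only [sphInner]
    rw [← integral_finsetSum _ fun i _ => integrable_mul_conj (contDiff_sphHarm _ _)
      (contDiff_sphHarm _ _)]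
    simp only [sum_sphHarm_mul_conj, integral_const, dS_real_univ]
    have : (Real.pi : ℂ) ≠ 0 := by exact_mod_cast Real.pi_ne_zero
    simp
    field_simp
  rw [Finset.sum_congr rfl fun i hi => heq i (by rw [Finset.mem_range] at hi; omega)] at hsum
  simp only [Finset.sum_const, Finset.card_range, nsmul_eq_mul] at hsum
  have h1 := heq (m + L).toNat (by omega)
  rw [show (((m + L).toNat : ℕ) : ℤ) - L = m by omega] at h1
  rw [h1]
  have h3 : (2 * (L : ℂ) + 1) ≠ 0 := by exact_mod_cast Nat.succ_ne_zero (2 * L)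
  push_cast at hsum
  exact mul_left_cancel₀ h3 (hsum.trans (mul_one _).symm)

/-! ### Completeness of the spherical harmonics -/

/-- The restriction of a smooth function to the sphere. -/
def resC (f : E3 → ℂ) (hf : ContDiff ℝ ∞ f) : C(S2, ℂ) :=
  ⟨fun x => f x, continuous_res hf.continuous⟩

/-- The class in `L²` of a continuous function on the sphere. -/
abbrev toL2 : C(S2, ℂ) →L[ℂ] Lp ℂ 2 dS := ContinuousMap.toLp 2 dS ℂ

lemma inner_toL2_resC {f g : E3 → ℂ} (hf : ContDiff ℝ ∞ f) (hg : ContDiff ℝ ∞ g) :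
    inner ℂ (toL2 (resC f hf)) (toL2 (resC g hg)) = sphInner g f :=
  ContinuousMap.inner_toLp dS _ _

/-- The index set `{(L, m) : L ≥ 0, |m| ≤ L}` of all spherical harmonics. -/
abbrev HarmIdx := {p : ℕ × ℤ // p.2.natAbs ≤ p.1}

/-- The spherical harmonic `Y_{L,m}` as a continuous function on the sphere. -/
def harmC (L : ℕ) (m : ℤ) : C(S2, ℂ) := resC (sphHarm L m) (contDiff_sphHarm L m)

lemma orthonormal_harmC : Orthonormal ℂ (fun p : HarmIdx => toL2 (harmC p.1.1 p.1.2)) := by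
  classical
  rw [orthonormal_iff_ite]
  intro p q
  rw [harmC, harmC, inner_toL2_resC]
  split_ifs with h
  · rw [h, sphInner_sphHarm_self q.2]
  · exact sphInner_sphHarm_of_ne fun e => h (Subtype.ext e.symm)

/-- The span of the spherical harmonics in `C(S²)`. -/
def harmSpan : Submodule ℂ C(S2, ℂ) :=
  Submodule.span ℂ (Set.range fun p : HarmIdx => harmC p.1.1 p.1.2)

/-- The function `x₀ + i x₁` on the sphere. -/
def zetaC : C(S2, ℂ) := ⟨fun x => (x : E3) 0 + Complex.I * (x : E3) 1, by fun_prop⟩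

/-- The function `x₂` on the sphere. -/
def heightC : C(S2, ℂ) := ⟨fun x => (x : E3) 2, by fun_prop⟩

lemma star_heightC : star heightC = heightC := by
  ext x
  exact Complex.conj_ofReal _

lemma zetaC_mul_star : zetaC * star zetaC = 1 - heightC ^ 2 := by
  ext x
  have hx := sum_coord_sq x
  rw [Fin.sum_univ_three] at hx
  simp [zetaC, heightC]
  linear_combination hx - ((x : E3) 1 : ℂ) ^ 2 * Complex.I_sq

lemma harmC_natCast (L m : ℕ) : harmC L m = ((harmNorm L m : ℂ) * (-1) ^ m) •
    (zetaC ^ m * Polynomial.aeval heightC (legendreDeriv L m)) := by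
  ext x
  have : (Polynomial.aeval heightC (legendreDeriv L m)) x
      = (legendreDeriv L m).eval ((x : E3) 2 : ℂ) := by
    have := Polynomial.aeval_algHom_apply (ContinuousMap.evalAlgHom ℂ ℂ x) heightC (legendreDeriv L m)
    exact this.symm.trans (by simp [heightC, Polynomial.coe_aeval_eq_eval])
  change sphHarm L m x = _
  rw [sphHarm_natCast]
  simp [this, zetaC]
  ring

lemma harmC_neg (L : ℕ) (m : ℤ) : harmC L (-m) = ((-1 : ℂ) ^ m) • star (harmC L m) := by
  ext x
  exact sphHarm_neg L m x

lemma star_mem_harmSpan {f : C(S2, ℂ)} (hf : f ∈ harmSpan) : star f ∈ harmSpan := by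
  induction hf using Submodule.span_induction with
  | mem f hf =>
    obtain ⟨p, rfl⟩ := hf
    have h := harmC_neg p.1.1 p.1.2
    have : star (harmC p.1.1 p.1.2) = ((-1 : ℂ) ^ p.1.2) • harmC p.1.1 (-p.1.2) := by
      rw [h, smul_smul, ← mul_zpow]
      simp
    simp only [this]
    exact Submodule.smul_mem _ _ (Submodule.subset_span ⟨⟨(p.1.1, -p.1.2), by simpa using p.2⟩, rfl⟩)
  | zero => simp
  | add f g _ _ hf hg => rw [star_add]; exact add_mem hf hg
  | smul c f _ hf => rw [star_smul]; exact Submodule.smul_mem _ _ hf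

open Polynomial in
/-- The span contains `(x₀ + i x₁)^m q(x₂)` for every polynomial `q`, because the polynomials
`P_{m+i}^{(m)}` have degrees `i = 0, 1, 2, …`. -/
lemma zetaC_pow_mul_mem (m : ℕ) (q : ℂ[X]) : zetaC ^ m * aeval heightC q ∈ harmSpan := by
  let S : Polynomial.Sequence ℂ := ⟨fun i => legendreDeriv (m + i) m, fun i => by
    rw [degree_eq_natDegree (legendreDeriv_ne_zero (by omega)), natDegree_legendreDeriv]
    simp⟩
  have hS : Submodule.span ℂ (Set.range S) = ⊤ :=
    S.span fun i => isUnit_iff_ne_zero.2 (leadingCoeff_ne_zero.2 (S.ne_zero i))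
  have hq : q ∈ Submodule.span ℂ (Set.range S) := hS ▸ Submodule.mem_top
  induction hq using Submodule.span_induction with
  | mem f hf =>
    obtain ⟨i, rfl⟩ := hf
    have hN : ((harmNorm (m + i) m : ℂ) * (-1) ^ m) ≠ 0 := by
      refine mul_ne_zero ?_ (by simp)
      have : 0 < harmNorm (m + i) m := Real.sqrt_pos.2 (by positivity)
      exact_mod_cast this.ne'
    have h := harmC_natCast (m + i) m
    rw [← inv_smul_eq_iff₀ hN] at h
    change zetaC ^ m * aeval heightC (legendreDeriv (m + i) m) ∈ harmSpan
    rw [← h]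
    exact Submodule.smul_mem _ _ (Submodule.subset_span ⟨⟨(m + i, m), by simp⟩, rfl⟩)
  | zero => simp
  | add f g _ _ hf hg => rw [map_add, mul_add]; exact add_mem hf hg
  | smul c f _ hf => rw [map_smul, mul_smul_comm]; exact Submodule.smul_mem _ _ hf

open Polynomial in
lemma star_zetaC_pow_mul_mem (m : ℕ) (q : ℂ[X]) : star zetaC ^ m * aeval heightC q ∈ harmSpan := by
  have h := star_mem_harmSpan (zetaC_pow_mul_mem m (q.map (starRingEnd ℂ)))
  have e : ∀ q : ℂ[X], star (aeval heightC (q.map (starRingEnd ℂ))) = aeval heightC q := fun q => by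
    induction q using Polynomial.induction_on' with
    | add p q hp hq => rw [Polynomial.map_add, map_add, star_add, hp, hq, map_add]
    | monomial n a =>
      rw [map_monomial, aeval_monomial, aeval_monomial, star_mul', star_pow, star_heightC,
        ← algebraMap_star_comm]
      simp
  rwa [star_mul', star_pow, e] at h

open Polynomial in
/-- The span is stable under multiplication by the coordinate functions; for the factor
`x₀ - i x₁` this uses `|x₀ + i x₁|² = 1 - x₂²`. -/
lemma mul_mem_harmSpan {f : C(S2, ℂ)} (hf : f ∈ harmSpan) :
    heightC * f ∈ harmSpan ∧ zetaC * f ∈ harmSpan ∧ star zetaC * f ∈ harmSpan := by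
  have key : ∀ (m : ℕ) (q : ℂ[X]), heightC * (zetaC ^ m * aeval heightC q) ∈ harmSpan ∧
      zetaC * (zetaC ^ m * aeval heightC q) ∈ harmSpan ∧
      star zetaC * (zetaC ^ m * aeval heightC q) ∈ harmSpan := fun m q => by
    refine ⟨?_, ?_, ?_⟩
    · convert zetaC_pow_mul_mem m (X * q) using 1
      rw [map_mul, aeval_X]
      ring
    · convert zetaC_pow_mul_mem (m + 1) q using 1
      ring
    · rcases m with _ | m
      · convert star_zetaC_pow_mul_mem 1 q using 1
        ring
      · convert zetaC_pow_mul_mem m ((1 - X ^ 2) * q) using 1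
        rw [map_mul, map_sub, map_one, map_pow, aeval_X, ← zetaC_mul_star]
        ring
  have hnat : ∀ L m : ℕ, heightC * harmC L m ∈ harmSpan ∧ zetaC * harmC L m ∈ harmSpan ∧
      star zetaC * harmC L m ∈ harmSpan := fun L m => by
    rw [harmC_natCast, mul_smul_comm, mul_smul_comm, mul_smul_comm]
    obtain ⟨h1, h2, h3⟩ := key m (legendreDeriv L m)
    exact ⟨Submodule.smul_mem _ _ h1, Submodule.smul_mem _ _ h2, Submodule.smul_mem _ _ h3⟩
  induction hf using Submodule.span_induction with
  | mem f hf =>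
    obtain ⟨p, rfl⟩ := hf
    obtain ⟨n, hn | hn⟩ := p.1.2.eq_nat_or_neg
    · simp only [hn]
      exact hnat p.1.1 n
    · simp only [hn, harmC_neg, mul_smul_comm]
      obtain ⟨h1, h2, h3⟩ := hnat p.1.1 n
      refine ⟨Submodule.smul_mem _ _ ?_, Submodule.smul_mem _ _ ?_, Submodule.smul_mem _ _ ?_⟩
      · simpa [star_heightC] using star_mem_harmSpan h1
      · simpa using star_mem_harmSpan h3
      · simpa using star_mem_harmSpan h2
  | zero => simp
  | add f g _ _ hf hg =>
    simp only [mul_add]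
    exact ⟨add_mem hf.1 hg.1, add_mem hf.2.1 hg.2.1, add_mem hf.2.2 hg.2.2⟩
  | smul c f _ hf =>
    simp only [mul_smul_comm]
    exact ⟨Submodule.smul_mem _ _ hf.1, Submodule.smul_mem _ _ hf.2.1, Submodule.smul_mem _ _ hf.2.2⟩

/-- The spherical harmonics span a dense subspace of `C(S²)`: it contains the polynomial functions,
to which the Stone–Weierstrass theorem applies. -/
lemma harmSpan_topologicalClosure : harmSpan.topologicalClosure = ⊤ := by
  set A : StarSubalgebra ℂ C(S2, ℂ) := StarAlgebra.adjoin ℂ {zetaC, heightC} with hA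
  have hsep : A.SeparatesPoints := by
    intro x y hxy
    by_contra! h
    have h1 := h _ ⟨zetaC, StarAlgebra.subset_adjoin ℂ _ (by simp), rfl⟩
    have h2 := h _ ⟨heightC, StarAlgebra.subset_adjoin ℂ _ (by simp), rfl⟩
    have h3 := congrArg Complex.re h1
    have h4 := congrArg Complex.im h1
    have h5 := congrArg Complex.re h2
    simp [zetaC, heightC] at h3 h4 h5
    apply hxy
    ext j
    fin_cases j
    · exact h3
    · exact h4
    · exact h5
  have hle : ∀ f ∈ A, f ∈ harmSpan := by
    intro f hf
    have hf' : f ∈ Submodule.span ℂ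
        (Submonoid.closure (({zetaC, heightC} : Set C(S2, ℂ)) ∪ star {zetaC, heightC}) :
          Set C(S2, ℂ)) :=
      (StarAlgebra.adjoin_eq_span (R := ℂ) ({zetaC, heightC} : Set C(S2, ℂ))) ▸ hf
    refine Submodule.span_le.2 ?_ hf'
    intro g hg
    induction hg using Submonoid.closure_induction_left with
    | one => simpa using zetaC_pow_mul_mem 0 1
    | mul_left x hx y _ hy =>
      obtain ⟨h1, h2, h3⟩ := mul_mem_harmSpan hy
      rcases hx with (rfl | rfl) | hx
      · exact h2
      · exact h1
      · rw [Set.mem_star] at hx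
        rcases hx with hx | hx
        · rw [← star_star x, hx]; exact h3
        · rw [← star_star x, hx, star_heightC]; exact h1
  have hd := ContinuousMap.starSubalgebra_topologicalClosure_eq_top_of_separatesPoints A hsep
  rw [eq_top_iff]
  intro f _
  have hf : f ∈ A.topologicalClosure := hd ▸ trivial
  exact closure_mono hle hf

/-- The spherical harmonics as a Hilbert basis of `L²(S²)`. -/
def harmBasis : HilbertBasis HarmIdx ℂ (Lp ℂ 2 dS) :=
  HilbertBasis.mkOfOrthogonalEqBot orthonormal_harmC (by
    rw [Submodule.eq_bot_iff]
    intro f hf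
    have hY : ∀ p : HarmIdx, inner ℂ f (toL2 (harmC p.1.1 p.1.2)) = 0 := fun p =>
      (Submodule.mem_orthogonal' _ _).1 hf _ (Submodule.subset_span (Set.mem_range_self p))
    have hC : ∀ g : C(S2, ℂ), inner ℂ f (toL2 g) = 0 := by
      have hker : harmSpan.topologicalClosure ≤
          LinearMap.ker ((innerSL ℂ f).comp toL2).toLinearMap := by
        refine Submodule.topologicalClosure_minimal _ ?_ ((innerSL ℂ f).comp toL2).isClosed_ker
        rw [harmSpan, Submodule.span_le]
        rintro _ ⟨p, rfl⟩
        exact hY p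
      rw [harmSpan_topologicalClosure] at hker
      exact fun g => hker (Submodule.mem_top (x := g))
    have hdense := ContinuousMap.toLp_denseRange (p := 2) ℂ dS ℂ (by simp)
    have h0 : ∀ g : Lp ℂ 2 dS, inner ℂ f g = 0 := fun g =>
      hdense.induction_on g (isClosed_eq (by fun_prop) continuous_const) hC
    exact inner_self_eq_zero.1 (h0 f))

lemma harmBasis_apply (p : HarmIdx) : harmBasis p = toL2 (harmC p.1.1 p.1.2) := by
  simp [harmBasis]

/-! ### Orthonormal expansions -/

section Orthonormal

variable {ι E : Type*} [NormedAddCommGroup E] [InnerProductSpace ℂ E] {e : ι → E}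

lemma norm_sq_sum_of_orthonormal (he : Orthonormal ℂ e) (c : ι → ℂ) (F : Finset ι) :
    ‖∑ i ∈ F, c i • e i‖ ^ 2 = ∑ i ∈ F, ‖c i‖ ^ 2 := by
  have h := he.inner_sum c c F
  rw [inner_self_eq_norm_sq_to_K] at h
  simp only [Complex.conj_mul'] at h
  apply Complex.ofReal_injective
  simpa using h

lemma norm_sq_sub_sum_of_orthonormal (he : Orthonormal ℂ e) (v : E) (F : Finset ι) :
    ‖v - ∑ i ∈ F, inner ℂ (e i) v • e i‖ ^ 2 = ‖v‖ ^ 2 - ∑ i ∈ F, ‖inner ℂ (e i) v‖ ^ 2 := by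
  rw [@norm_sub_sq ℂ, norm_sq_sum_of_orthonormal he, inner_sum, map_sum]
  have : ∀ i ∈ F, RCLike.re (inner ℂ v (inner ℂ (e i) v • e i)) = ‖inner ℂ (e i) v‖ ^ 2 :=
    fun i _ => by
    rw [inner_smul_right, inner_mul_symm_re_eq_norm, norm_mul, norm_inner_symm v, sq]
  rw [Finset.sum_congr rfl this]
  ring

/-- Parseval's identity implies that the expansion converges. -/
lemma hasSum_of_parseval (he : Orthonormal ℂ e) {v : E}
    (h : HasSum (fun i => ‖inner ℂ (e i) v‖ ^ 2) (‖v‖ ^ 2)) :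
    HasSum (fun i => inner ℂ (e i) v • e i) v := by
  have h1 : Tendsto (fun F => ‖v - ∑ i ∈ F, inner ℂ (e i) v • e i‖ ^ 2) atTop (𝓝 0) := by
    simp only [norm_sq_sub_sum_of_orthonormal he]
    rw [HasSum, SummationFilter.unconditional_filter] at h
    exact (sub_self (‖v‖ ^ 2)) ▸ h.const_sub (‖v‖ ^ 2)
  have h2 := (Real.continuous_sqrt.tendsto 0).comp h1
  simp only [Function.comp_def, Real.sqrt_sq (norm_nonneg _), Real.sqrt_zero] at h2
  rw [HasSum, SummationFilter.unconditional_filter, tendsto_iff_norm_sub_tendsto_zero]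
  simpa only [norm_sub_rev] using h2

/-- The set of vectors that are the sums of their expansions is closed. -/
lemma hasSum_of_tendsto (he : Orthonormal ℂ e) {v : E} {w : ℕ → E} (hw : Tendsto w atTop (𝓝 v))
    (h : ∀ n, HasSum (fun i => inner ℂ (e i) (w n) • e i) (w n)) :
    HasSum (fun i => inner ℂ (e i) v • e i) v := by
  classical
  rw [HasSum, SummationFilter.unconditional_filter, Metric.tendsto_atTop]
  intro ε hε
  obtain ⟨n, hn⟩ := (Metric.tendsto_atTop.1 hw (ε / 2) (by positivity)).imp fun N h => h N le_rfl
  have h1 := h n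
  rw [HasSum, SummationFilter.unconditional_filter, Metric.tendsto_atTop] at h1
  obtain ⟨F₀, hF₀⟩ := h1 (ε / 2) (by positivity)
  refine ⟨F₀, fun F hF => ?_⟩
  have h2 := hF₀ F hF
  rw [dist_eq_norm, norm_sub_rev] at h2 ⊢
  have e1 : v - ∑ i ∈ F, inner ℂ (e i) v • e i
      = ((v - w n) - ∑ i ∈ F, inner ℂ (e i) (v - w n) • e i)
        + (w n - ∑ i ∈ F, inner ℂ (e i) (w n) • e i) := by
    simp only [inner_sub_right, sub_smul, Finset.sum_sub_distrib]
    abel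
  have h3 : ‖(v - w n) - ∑ i ∈ F, inner ℂ (e i) (v - w n) • e i‖ ≤ ‖v - w n‖ := by
    refine (sq_le_sq₀ (norm_nonneg _) (norm_nonneg _)).1 ?_
    rw [norm_sq_sub_sum_of_orthonormal he]
    exact sub_le_self _ (Finset.sum_nonneg fun i _ => sq_nonneg _)
  have h4 : ‖v - w n‖ < ε / 2 := by rw [← dist_eq_norm, dist_comm]; exact hn
  rw [e1]
  exact (norm_add_le _ _).trans_lt (by linarith)

variable [CompleteSpace E]

lemma summable_smul_of_orthonormal (he : Orthonormal ℂ e) {c : ι → ℂ}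
    (hc : Summable fun i => ‖c i‖ ^ 2) : Summable fun i => c i • e i := by
  have h := (he.orthogonalFamily.summable_iff_norm_sq_summable c).2 hc
  simpa using h

lemma hasSum_norm_sq_of_orthonormal (he : Orthonormal ℂ e) {c : ι → ℂ}
    (hc : Summable fun i => ‖c i‖ ^ 2) : HasSum (fun i => ‖c i‖ ^ 2) (‖∑' i, c i • e i‖ ^ 2) := by
  have h := ((summable_smul_of_orthonormal he hc).hasSum.norm).pow 2
  simp only [norm_sq_sum_of_orthonormal he] at h
  exact h

end Orthonormal

/-! ### The eigenfields of the Stokes operator -/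

lemma memLp_surfCurl {ψ : E3 → ℂ} (h : ContDiff ℝ ∞ ψ) : MemLp (fun x : S2 => surfCurl ψ x) 2 dS :=
  memLp_of_continuous (continuous_res (continuous_surfCurl h)) 2

/-- `Curl ψ` as an element of `L²`. -/
def curlL2 (ψ : E3 → ℂ) (h : ContDiff ℝ ∞ ψ) : L2 := (memLp_surfCurl h).toLp _

lemma coeFn_curlL2 {ψ : E3 → ℂ} (h : ContDiff ℝ ∞ ψ) :
    curlL2 ψ h =ᵐ[dS] fun x : S2 => surfCurl ψ x := MemLp.coeFn_toLp _

lemma Z_eq (p : Idx) : Z p = ((lam p ^ (-(1 / 2) : ℝ) : ℝ) : ℂ) •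
    curlL2 (sphHarm p.1.1 p.1.2) (contDiff_sphHarm _ _) := by
  rw [curlL2, ← MemLp.toLp_const_smul]
  rfl

lemma inner_curlL2 {φ ψ : E3 → ℂ} (hφ : ContDiff ℝ ∞ φ) (hψ : ContDiff ℝ ∞ ψ) :
    inner ℂ (curlL2 φ hφ) (curlL2 ψ hψ) = - sphInner (sphLap ψ) φ := by
  rw [← sphInner_rot_rot hψ hφ, L2.inner_def]
  simp only [sphInner]
  rw [← integral_finsetSum _ fun k _ => integrable_mul_conj (contDiff_rot hψ k) (contDiff_rot hφ k)]
  refine integral_congr_ae ?_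
  filter_upwards [coeFn_curlL2 hφ, coeFn_curlL2 hψ] with x h1 h2
  rw [h1, h2, PiLp.inner_apply]
  simp [surfCurl_apply]

lemma lam_pos (p : Idx) : 0 < lam p := by
  have : (1 : ℝ) ≤ p.1.1 := by exact_mod_cast p.2.1
  unfold lam
  positivity

lemma two_le_lam (p : Idx) : 2 ≤ lam p := by
  have : (1 : ℝ) ≤ p.1.1 := by exact_mod_cast p.2.1
  unfold lam
  nlinarith

lemma natAbs_le (p : Idx) : p.1.2.natAbs ≤ p.1.1 := by
  have := p.2.2
  omega

lemma sphInner_sphLap_sphHarm {ψ : E3 → ℂ} (h : ContDiff ℝ ∞ ψ) (p : Idx) :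
    sphInner (sphLap ψ) (sphHarm p.1.1 p.1.2) = -(lam p : ℂ) * sphInner ψ (sphHarm p.1.1 p.1.2) := by
  rw [sphInner_sphLap h (contDiff_sphHarm _ _), sphInner_const_mul_right (sphLap_sphHarm _ _), lam]
  simp

lemma orthonormal_Z : Orthonormal ℂ Z := by
  classical
  rw [orthonormal_iff_ite]
  intro p q
  rw [Z_eq, Z_eq, inner_smul_left, inner_smul_right, inner_curlL2 (contDiff_sphHarm _ _),
    sphInner_sphLap_sphHarm (contDiff_sphHarm _ _)]
  split_ifs with h
  · subst h
    rw [sphInner_sphHarm_self (natAbs_le p), Complex.conj_ofReal]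
    have : lam p ^ (-(1 / 2) : ℝ) * (lam p ^ (-(1 / 2) : ℝ) * lam p) = 1 := by
      rw [← mul_assoc, ← Real.rpow_add (lam_pos p)]
      norm_num
      rw [Real.rpow_neg_one, inv_mul_cancel₀ (lam_pos p).ne']
    rw [mul_one, neg_neg]
    exact_mod_cast this
  · rw [sphInner_sphHarm_of_ne fun e => h (Subtype.ext e.symm)]
    simp

lemma coeff_curlL2_eq_sphLap {ψ : E3 → ℂ} (h : ContDiff ℝ ∞ ψ) (p : Idx) : coeff (curlL2 ψ h) p =
    -((lam p ^ (-(1 / 2) : ℝ) : ℝ) : ℂ) * sphInner (sphLap ψ) (sphHarm p.1.1 p.1.2) := by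
  rw [coeff, Z_eq, inner_smul_left, inner_curlL2, Complex.conj_ofReal]
  ring

lemma coeff_curlL2 {ψ : E3 → ℂ} (h : ContDiff ℝ ∞ ψ) (p : Idx) : coeff (curlL2 ψ h) p =
    ((lam p ^ (1 / 2 : ℝ) : ℝ) : ℂ) * sphInner ψ (sphHarm p.1.1 p.1.2) := by
  have e : lam p ^ (-(1 / 2) : ℝ) * lam p = lam p ^ (1 / 2 : ℝ) := by
    nth_rewrite 2 [← Real.rpow_one (lam p)]
    rw [← Real.rpow_add (lam_pos p)]
    norm_num
  rw [coeff_curlL2_eq_sphLap, sphInner_sphLap_sphHarm h, ← e]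
  push_cast
  ring

/-- Parseval's identity for `Curl ψ`, from the completeness of the spherical harmonics. -/
lemma parseval_curlL2 {ψ : E3 → ℂ} (h : ContDiff ℝ ∞ ψ) :
    HasSum (fun p => ‖coeff (curlL2 ψ h) p‖ ^ 2) (‖curlL2 ψ h‖ ^ 2) := by
  have h1 := harmBasis.hasSum_inner_mul_inner (toL2 (resC ψ h))
    (toL2 (resC (sphLap ψ) (contDiff_sphLap h)))
  simp only [harmBasis_apply, harmC, inner_toL2_resC] at h1
  have hi : Function.Injective (fun p : Idx => (⟨p.1, natAbs_le p⟩ : HarmIdx)) := fun p q e =>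
    Subtype.ext (congrArg (fun r : HarmIdx => r.1) e)
  have h2 : HasSum (fun p : Idx => sphInner (sphHarm p.1.1 p.1.2) ψ *
      sphInner (sphLap ψ) (sphHarm p.1.1 p.1.2)) (sphInner (sphLap ψ) ψ) := by
    refine (hi.hasSum_iff (f := fun p : HarmIdx => sphInner (sphHarm p.1.1 p.1.2) ψ *
      sphInner (sphLap ψ) (sphHarm p.1.1 p.1.2)) fun q hq => ?_).2 h1
    -- The constant harmonic, which has no eigenfield, does not contribute: its eigenvalue is zero.
    have hq0 : q.1.1 = 0 := by
      by_contra h0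
      have h3 := q.2
      exact hq ⟨⟨q.1, by omega⟩, rfl⟩
    rw [sphInner_sphLap h (contDiff_sphHarm _ _), sphInner_const_mul_right (sphLap_sphHarm _ _), hq0]
    simp
  have h3 : ∀ p : Idx, ((‖coeff (curlL2 ψ h) p‖ ^ 2 : ℝ) : ℂ) = -(sphInner (sphHarm p.1.1 p.1.2) ψ *
      sphInner (sphLap ψ) (sphHarm p.1.1 p.1.2)) := fun p => by
    rw [Complex.ofReal_pow, ← Complex.mul_conj', coeff_curlL2]
    have e : lam p ^ (1 / 2 : ℝ) * lam p ^ (1 / 2 : ℝ) = lam p := by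
      rw [← Real.rpow_add (lam_pos p)]
      norm_num
    have e' : ((lam p ^ (1 / 2 : ℝ) : ℝ) : ℂ) * ((lam p ^ (1 / 2 : ℝ) : ℝ) : ℂ) = lam p := by
      exact_mod_cast e
    rw [sphInner_sphLap_sphHarm h, map_mul, Complex.conj_ofReal, sphInner_conj]
    linear_combination (sphInner ψ (sphHarm p.1.1 p.1.2) * sphInner (sphHarm p.1.1 p.1.2) ψ) * e'
  have h4 : ((‖curlL2 ψ h‖ ^ 2 : ℝ) : ℂ) = - sphInner (sphLap ψ) ψ := by
    rw [← inner_curlL2 h h, inner_self_eq_norm_sq_to_K]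
    simp
  have h5 := h2.neg
  rw [← h4] at h5
  simp only [← h3] at h5
  exact_mod_cast h5

lemma tendsto_toLp_of_eLpNorm {F : Type*} [NormedAddCommGroup F] {v : Lp F 2 dS} {f : ℕ → S2 → F}
    (hf : ∀ n, MemLp (f n) 2 dS)
    (h : Tendsto (fun n => eLpNorm (fun x => v x - f n x) 2 dS) atTop (𝓝 0)) :
    Tendsto (fun n => (hf n).toLp (f n)) atTop (𝓝 v) := by
  rw [Lp.tendsto_Lp_iff_tendsto_eLpNorm']
  refine h.congr fun n => ?_
  rw [eLpNorm_sub_comm]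
  refine eLpNorm_congr_ae ?_
  filter_upwards [(hf n).coeFn_toLp] with x hx
  simp [hx]

/-- A field of `H` is the sum of its expansion in the eigenfields. -/
lemma hasSum_coeff {v : L2} (hv : v ∈ H) : HasSum (fun p => coeff v p • Z p) v := by
  obtain ⟨ψ, hψ, h⟩ := hv
  exact hasSum_of_tendsto orthonormal_Z (tendsto_toLp_of_eLpNorm (fun n => memLp_surfCurl (hψ n)) h)
    fun n => hasSum_of_parseval orthonormal_Z (parseval_curlL2 (hψ n))

lemma norm_sq_rpow_mul (s : ℝ) (c : ℂ) (p : Idx) :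
    ‖((lam p ^ s : ℝ) : ℂ) * c‖ ^ 2 = lam p ^ (2 * s) * ‖c‖ ^ 2 := by
  rw [norm_mul, mul_pow, Complex.norm_real, Real.norm_eq_abs, sq_abs, ← Real.rpow_natCast,
    ← Real.rpow_mul (lam_pos p).le]
  norm_num [mul_comm]

lemma norm_sq_stokesPow {s : ℝ} {v : L2} (hv : v ∈ domPow s) :
    HasSum (fun p => lam p ^ (2 * s) * ‖coeff v p‖ ^ 2) (‖stokesPow s v‖ ^ 2) := by
  have h := hasSum_norm_sq_of_orthonormal orthonormal_Z
    (c := fun p => ((lam p ^ s : ℝ) : ℂ) * coeff v p) (by simpa only [norm_sq_rpow_mul] using hv.2)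
  simp only [norm_sq_rpow_mul] at h
  exact h

lemma norm_rot_le (ψ : E3 → ℂ) (k : Fin 3) (x : S2) : ‖rot k ψ x‖ ≤ 2 * ‖surfGrad ψ x‖ := by
  have hx : ∀ j, ‖((x : E3) j : ℂ)‖ ≤ 1 := fun j => by
    rw [Complex.norm_real]
    exact (PiLp.norm_apply_le (x : E3) j).trans (mem_sphere_zero_iff_norm.1 x.2).le
  have hg : ∀ j, ‖surfGrad ψ x j‖ ≤ ‖surfGrad ψ x‖ := fun j => PiLp.norm_apply_le _ j
  have hp : ∀ i j, ‖((x : E3) i : ℂ) * surfGrad ψ x j‖ ≤ ‖surfGrad ψ x‖ := fun i j => by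
    rw [norm_mul]
    exact (mul_le_mul (hx i) (hg j) (norm_nonneg _) zero_le_one).trans (one_mul _).le
  rw [← surfCurl_apply]
  have e : surfCurl ψ x k = -(((x : E3) (k + 1) : ℂ) * surfGrad ψ x (k + 2)
      - ((x : E3) (k + 2) : ℂ) * surfGrad ψ x (k + 1)) := by
    fin_cases k <;> simp [surfCurl, crossC, cross_apply]
  rw [e, norm_neg]
  exact (norm_sub_le _ _).trans (by linarith [hp (k + 1) (k + 2), hp (k + 2) (k + 1)])

lemma continuous_surfGrad {ψ : E3 → ℂ} (h : ContDiff ℝ ∞ ψ) :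
    Continuous (fun x : S2 => surfGrad ψ x) := by
  refine (PiLp.continuous_toLp 2 _).comp (g := fun f => WithLp.toLp 2 f)
    (f := fun x : S2 => fun j => surfGrad ψ x j) (continuous_pi fun j => ?_)
  simp only [surfGrad_apply]
  have hc := fun k => continuous_res (contDiff_rot h k).continuous
  have hx := fun j => continuous_res (contDiff_coord j).continuous
  exact ((hx _).mul (hc _)).sub ((hx _).mul (hc _))

/-- The surface gradient of a smooth function as an element of `L²`. -/
def gradL2 (ψ : E3 → ℂ) (h : ContDiff ℝ ∞ ψ) : L2 :=
  (memLp_of_continuous (continuous_surfGrad h) 2).toLp _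

lemma coeFn_gradL2 {ψ : E3 → ℂ} (h : ContDiff ℝ ∞ ψ) :
    gradL2 ψ h =ᵐ[dS] fun x : S2 => surfGrad ψ x := MemLp.coeFn_toLp _

lemma norm_toL2_sphLap_le {ψ : E3 → ℂ} (h : ContDiff ℝ ∞ ψ) :
    ‖toL2 (resC (sphLap ψ) (contDiff_sphLap h))‖
      ≤ 2 * ∑ k, ‖gradL2 (rot k ψ) (contDiff_rot h k)‖ := by
  have e : resC (sphLap ψ) (contDiff_sphLap h)
      = ∑ k, resC (rot k (rot k ψ)) (contDiff_rot (contDiff_rot h k) k) := by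
    ext x
    simp [resC, sphLap]
  rw [e, map_sum, Finset.mul_sum]
  refine (norm_sum_le _ _).trans (Finset.sum_le_sum fun k _ => ?_)
  refine Lp.norm_le_mul_norm_of_ae_le_mul ?_
  filter_upwards [coeFn_gradL2 (contDiff_rot h k), ContinuousMap.coeFn_toLp (p := 2) (𝕜 := ℂ) dS
    (resC (rot k (rot k ψ)) (contDiff_rot (contDiff_rot h k) k))] with x h1 h2
  rw [h1, h2]
  exact norm_rot_le _ k x

/-- The data witnessing that `v` belongs to `V`: smooth stream functions `ψ n` with `Curl (ψ n) → v`
in `L²` and convergence of the gradients. -/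
lemma exists_approx_of_mem_V {v : L2} (hv : v ∈ V) : ∃ (G : Fin 3 → L2) (ψ : ℕ → E3 → ℂ)
    (hψ : ∀ n, ContDiff ℝ ∞ (ψ n)), IsWeakJac v G ∧
    Tendsto (fun n => curlL2 (ψ n) (hψ n)) atTop (𝓝 v) ∧
    ∀ i, Tendsto (fun n => gradL2 (rot i (ψ n)) (contDiff_rot (hψ n) i)) atTop (𝓝 (G i)) := by
  obtain ⟨G, hG, ψ, hψ, h1, h2⟩ := hv
  refine ⟨G, ψ, hψ, hG, tendsto_toLp_of_eLpNorm _ h1, fun i => tendsto_toLp_of_eLpNorm _ ?_⟩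
  have e : ∀ n, (fun y => surfCurl (ψ n) y i) = rot i (ψ n) := fun n =>
    funext fun y => surfCurl_apply _ _ _
  simpa only [e] using h2 i

lemma mem_H_of_mem_V {v : L2} (hv : v ∈ V) : v ∈ H := by
  obtain ⟨G, hG, ψ, hψ, h1, h2⟩ := hv
  exact ⟨ψ, hψ, h1⟩

lemma continuous_coeff (p : Idx) : Continuous fun v => coeff v p := by
  unfold coeff
  fun_prop

/-- `V ⊆ D(A^{1/2})`: the numbers `λ^{1/2} (Curl ψ, Z_{L,m})` are up to sign the coefficients of the
Laplacian of `ψ`, which is controlled by the gradients of the components of `Curl ψ`, so Bessel's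
inequality bounds the sum in the approximation of a field of `V`. -/
lemma mem_domPow_half {v : L2} (hv : v ∈ V) : v ∈ domPow (1 / 2) := by
  obtain ⟨G, ψ, hψ, hG, h1, h2⟩ := exists_approx_of_mem_V hv
  refine ⟨mem_H_of_mem_V hv, summable_of_sum_le (c := (2 * ∑ k, ‖G k‖) ^ 2)
    (fun p => mul_nonneg (Real.rpow_nonneg (lam_pos p).le _) (sq_nonneg _)) fun F => ?_⟩
  have hl : Tendsto (fun n => ∑ p ∈ F, lam p ^ (2 * (1 / 2) : ℝ) *
      ‖coeff (curlL2 (ψ n) (hψ n)) p‖ ^ 2) atTop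
      (𝓝 (∑ p ∈ F, lam p ^ (2 * (1 / 2) : ℝ) * ‖coeff v p‖ ^ 2)) :=
    tendsto_finsetSum _ fun p _ => ((((continuous_coeff p).tendsto v).comp h1).norm.pow 2).const_mul _
  have hr : Tendsto (fun n => (2 * ∑ k, ‖gradL2 (rot k (ψ n)) (contDiff_rot (hψ n) k)‖) ^ 2) atTop
      (𝓝 ((2 * ∑ k, ‖G k‖) ^ 2)) :=
    ((tendsto_finsetSum _ fun k _ => (h2 k).norm).const_mul 2).pow 2
  refine le_of_tendsto_of_tendsto' hl hr fun n => ?_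
  have hb := orthonormal_harmC.sum_inner_products_le
    (toL2 (resC (sphLap (ψ n)) (contDiff_sphLap (hψ n))))
    (s := F.map ⟨fun p : Idx => (⟨p.1, natAbs_le p⟩ : HarmIdx), fun p q e =>
      Subtype.ext (congrArg (fun r : HarmIdx => r.1) e)⟩)
  rw [Finset.sum_map] at hb
  simp only [harmC, inner_toL2_resC] at hb
  calc _ = ∑ p ∈ F, ‖sphInner (sphLap (ψ n)) (sphHarm p.1.1 p.1.2)‖ ^ 2 := by
        refine Finset.sum_congr rfl fun p _ => ?_
        rw [coeff_curlL2_eq_sphLap, norm_mul, norm_neg, Complex.norm_real, mul_pow, ← mul_assoc,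
          Real.norm_eq_abs, sq_abs, ← Real.rpow_natCast, ← Real.rpow_mul (lam_pos p).le,
          ← Real.rpow_add (lam_pos p)]
        norm_num
    _ ≤ _ := hb.trans (pow_le_pow_left₀ (norm_nonneg _) (norm_toL2_sphLap_le (hψ n)) 2)

lemma mem_domPow_of_le {s t : ℝ} (hst : s ≤ t) {v : L2} (hv : v ∈ domPow t) : v ∈ domPow s := by
  refine ⟨hv.1, Summable.of_nonneg_of_le
    (fun p => mul_nonneg (Real.rpow_nonneg (lam_pos p).le _) (sq_nonneg _)) (fun p => ?_) hv.2⟩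
  have := two_le_lam p
  gcongr
  linarith

lemma norm_stokesPow_le {s t : ℝ} (hst : s ≤ t) {v : L2} (hv : v ∈ domPow t) :
    ‖stokesPow s v‖ ≤ ‖stokesPow t v‖ := by
  refine (sq_le_sq₀ (norm_nonneg _) (norm_nonneg _)).1 ?_
  refine hasSum_le (fun p => ?_) (norm_sq_stokesPow (mem_domPow_of_le hst hv)) (norm_sq_stokesPow hv)
  have := two_le_lam p
  gcongr
  linarith

/-! ### A product estimate for dyadically decomposed expansions -/

/-- A family of continuous functions indexed by the eigenfields that obeys the bounds of an
orthonormal system on the sphere: the members with `L ≤ N` satisfy a pointwise square bound of order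
`N²` (which amounts to a Bernstein inequality), and the whole family satisfies Bessel's inequality. -/
structure BernsteinSystem (e : Idx → C(S2, ℂ)) (K : ℝ) : Prop where
  nonneg : 0 ≤ K
  pointwise : ∀ (N : ℕ) (F : Finset Idx), (∀ p ∈ F, p.1.1 ≤ N) → ∀ x,
    ∑ p ∈ F, ‖e p x‖ ^ 2 ≤ K * (N : ℝ) ^ 2
  bessel : ∀ (F : Finset Idx) (c : Idx → ℂ),
    ‖toL2 (∑ p ∈ F, c p • e p)‖ ^ 2 ≤ K * ∑ p ∈ F, ‖c p‖ ^ 2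

lemma BernsteinSystem.norm_le {e : Idx → C(S2, ℂ)} {K : ℝ} (he : BernsteinSystem e K) {N : ℕ}
    {F : Finset Idx} (hF : ∀ p ∈ F, p.1.1 ≤ N) (c : Idx → ℂ) :
    ‖∑ p ∈ F, c p • e p‖ ≤ Real.sqrt K * N * Real.sqrt (∑ p ∈ F, ‖c p‖ ^ 2) := by
  have h0 : 0 ≤ Real.sqrt K * N * Real.sqrt (∑ p ∈ F, ‖c p‖ ^ 2) := by positivity
  refine (ContinuousMap.norm_le _ h0).2 fun x => ?_
  rw [ContinuousMap.sum_apply]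
  have h1 : ‖∑ p ∈ F, (c p • e p) x‖ ≤ ∑ p ∈ F, ‖c p‖ * ‖e p x‖ :=
    (norm_sum_le _ _).trans (Finset.sum_le_sum fun p _ => by simp)
  have h2 := Finset.sum_mul_sq_le_sq_mul_sq F (fun p => ‖c p‖) (fun p => ‖e p x‖)
  refine h1.trans ((sq_le_sq₀ (Finset.sum_nonneg fun p _ => by positivity) h0).1 ?_)
  rw [mul_pow, mul_pow, Real.sq_sqrt he.nonneg, Real.sq_sqrt (by positivity)]
  refine h2.trans ?_
  rw [mul_comm]
  exact mul_le_mul_of_nonneg_right (he.pointwise N F hF x) (by positivity)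

lemma norm_toL2_mul_le (g h : C(S2, ℂ)) : ‖toL2 (g * h)‖ ≤ ‖g‖ * ‖toL2 h‖ := by
  refine Lp.norm_le_mul_norm_of_ae_le_mul ?_
  filter_upwards [ContinuousMap.coeFn_toLp (p := 2) (𝕜 := ℂ) dS (g * h),
    ContinuousMap.coeFn_toLp (p := 2) (𝕜 := ℂ) dS h] with x h1 h2
  rw [h1, h2, ContinuousMap.mul_apply, norm_mul]
  exact mul_le_mul_of_nonneg_right (g.norm_coe_le_norm x) (norm_nonneg _)

/-- A row sum of the kernel `θ^|j-k|`; the sum of the two truncated differences is `|j - k|`. -/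
lemma sum_pow_dist_le {θ : ℝ} (h0 : 0 ≤ θ) (h1 : θ < 1) (n j : ℕ) :
    ∑ k ∈ Finset.range n, θ ^ ((j - k) + (k - j)) ≤ 2 * (1 - θ)⁻¹ := by
  have hs := summable_geometric_of_lt_one h0 h1
  have key : ∀ (A : Finset ℕ) (φ : ℕ → ℕ), Set.InjOn φ A → ∑ k ∈ A, θ ^ φ k ≤ (1 - θ)⁻¹ :=
    fun A φ hφ => by
    rw [← Finset.sum_image (f := fun i => θ ^ i) hφ, ← tsum_geometric_of_lt_one h0 h1]
    exact hs.sum_le_tsum _ fun i _ => pow_nonneg h0 i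
  rw [← Finset.sum_filter_add_sum_filter_not (Finset.range n) (fun k => k ≤ j), two_mul]
  refine add_le_add (key _ _ fun a ha b hb hab => ?_) (key _ _ fun a ha b hb hab => ?_) <;>
  · simp only [Finset.coe_filter, Set.mem_ofPred_eq] at ha hb hab
    omega

/-- Schur's test for the kernel `θ^|j-k|`. -/
lemma schur_le {θ : ℝ} (h0 : 0 ≤ θ) (h1 : θ < 1) (n : ℕ) (α β : ℕ → ℝ) :
    (∑ j ∈ Finset.range n, ∑ k ∈ Finset.range n, θ ^ ((j - k) + (k - j)) * (α j * β k)) ^ 2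
      ≤ (2 * (1 - θ)⁻¹) ^ 2 * ((∑ j ∈ Finset.range n, α j ^ 2) * ∑ k ∈ Finset.range n, β k ^ 2) := by
  have hw : ∀ j k : ℕ, 0 ≤ θ ^ ((j - k) + (k - j)) := fun j k => pow_nonneg h0 _
  have hM : 0 ≤ 2 * (1 - θ)⁻¹ := by
    have : 0 < 1 - θ := by linarith
    positivity
  rw [← Finset.sum_product']
  refine (Finset.sum_sq_le_sum_mul_sum_of_sq_le_mul _
    (f := fun q : ℕ × ℕ => θ ^ ((q.1 - q.2) + (q.2 - q.1)) * α q.1 ^ 2)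
    (g := fun q : ℕ × ℕ => θ ^ ((q.1 - q.2) + (q.2 - q.1)) * β q.2 ^ 2)
    (fun q _ => mul_nonneg (hw _ _) (sq_nonneg _)) (fun q _ => mul_nonneg (hw _ _) (sq_nonneg _))
    (fun q _ => le_of_eq (by ring))).trans ?_
  rw [Finset.sum_product, Finset.sum_product_right]
  have e1 : ∑ j ∈ Finset.range n, ∑ k ∈ Finset.range n, θ ^ ((j - k) + (k - j)) * α j ^ 2
      ≤ 2 * (1 - θ)⁻¹ * ∑ j ∈ Finset.range n, α j ^ 2 := by
    rw [Finset.mul_sum]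
    refine Finset.sum_le_sum fun j _ => ?_
    rw [← Finset.sum_mul]
    exact mul_le_mul_of_nonneg_right (sum_pow_dist_le h0 h1 n j) (sq_nonneg _)
  have e2 : ∑ k ∈ Finset.range n, ∑ j ∈ Finset.range n, θ ^ ((j - k) + (k - j)) * β k ^ 2
      ≤ 2 * (1 - θ)⁻¹ * ∑ k ∈ Finset.range n, β k ^ 2 := by
    rw [Finset.mul_sum]
    refine Finset.sum_le_sum fun k _ => ?_
    rw [← Finset.sum_mul]
    refine mul_le_mul_of_nonneg_right ?_ (sq_nonneg _)
    simpa only [add_comm] using sum_pow_dist_le h0 h1 n k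
  refine (mul_le_mul e1 e2 (Finset.sum_nonneg fun k _ => Finset.sum_nonneg fun j _ =>
    mul_nonneg (hw _ _) (sq_nonneg _)) (by positivity)).trans (le_of_eq ?_)
  ring

/-- The members of `F` with `2^j ≤ L < 2^(j+1)`. -/
def dyadicBlock (F : Finset Idx) (j : ℕ) : Finset Idx := F.filter fun p => Nat.log 2 p.1.1 = j

lemma sum_dyadicBlock {M : Type*} [AddCommMonoid M] (F : Finset Idx) {n : ℕ}
    (hn : ∀ p ∈ F, Nat.log 2 p.1.1 < n) (f : Idx → M) :
    ∑ p ∈ F, f p = ∑ j ∈ Finset.range n, ∑ p ∈ dyadicBlock F j, f p :=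
  (Finset.sum_fiberwise_of_maps_to (fun p hp => Finset.mem_range.2 (hn p hp)) f).symm

lemma four_pow_le_lam {F : Finset Idx} {j : ℕ} {p : Idx} (hp : p ∈ dyadicBlock F j) :
    (4 : ℝ) ^ j ≤ lam p := by
  have h1 : Nat.log 2 p.1.1 = j := (Finset.mem_filter.1 hp).2
  have h2 : 2 ^ j ≤ p.1.1 := h1 ▸ Nat.pow_log_le_self 2 (by have := p.2.1; omega)
  have h3 : (2 : ℝ) ^ j ≤ p.1.1 := by exact_mod_cast h2
  have h4 : (4 : ℝ) ^ j = 2 ^ j * 2 ^ j := by rw [← mul_pow]; norm_num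
  have h5 : (0 : ℝ) ≤ 2 ^ j := by positivity
  rw [h4, lam]
  nlinarith

/-- On a dyadic block, the weights `λ^r` are at least `2^(2jr)`. -/
lemma sqrt_sum_dyadicBlock_le {r : ℝ} (hr : 0 ≤ r) (F : Finset Idx) (j : ℕ) (c : Idx → ℂ) :
    Real.sqrt (∑ p ∈ dyadicBlock F j, ‖c p‖ ^ 2) ≤
      (((2 : ℝ) ^ r)⁻¹) ^ j * Real.sqrt (∑ p ∈ dyadicBlock F j, lam p ^ r * ‖c p‖ ^ 2) := by
  have h2 : (0 : ℝ) < 2 ^ r := by positivity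
  refine Real.sqrt_le_left (by positivity) |>.2 ?_
  rw [mul_pow, Real.sq_sqrt (Finset.sum_nonneg fun p _ =>
    mul_nonneg (Real.rpow_nonneg (lam_pos p).le _) (sq_nonneg _)), Finset.mul_sum]
  refine Finset.sum_le_sum fun p hp => ?_
  rw [← mul_assoc]
  refine le_mul_of_one_le_left (sq_nonneg _) ?_
  have h3 : ((4 : ℝ) ^ j) ^ r ≤ lam p ^ r := by
    have := four_pow_le_lam hp
    gcongr
  have h4 : ((4 : ℝ) ^ j) ^ r = (((2 : ℝ) ^ r) ^ j) ^ 2 := by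
    rw [← Real.rpow_natCast, ← Real.rpow_mul (by norm_num), mul_comm, ← pow_mul, ← Real.rpow_natCast,
      ← Real.rpow_mul (by norm_num), show (4 : ℝ) = 2 ^ (2 : ℝ) by norm_num,
      ← Real.rpow_mul (by norm_num)]
    congr 1
    push_cast
    ring
  rw [h4] at h3
  rw [inv_pow, inv_pow, inv_mul_eq_div, one_le_div (by positivity)]
  exact h3

/-- The ratio of the geometric decay away from the diagonal in the product estimate. -/
def decayRatio (s : ℝ) : ℝ := max ((2 : ℝ) ^ s)⁻¹ ((2 : ℝ) ^ (1 - s))⁻¹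

lemma decayRatio_nonneg (s : ℝ) : 0 ≤ decayRatio s := le_max_of_le_left (by positivity)

lemma decayRatio_lt_one {s : ℝ} (h0 : 0 < s) (h1 : s < 1) : decayRatio s < 1 :=
  max_lt (inv_lt_one_of_one_lt₀ (Real.one_lt_rpow (by norm_num) h0))
    (inv_lt_one_of_one_lt₀ (Real.one_lt_rpow (by norm_num) (by linarith)))

/-- The product of two dyadic blocks: the factor of lower frequency is bounded uniformly by the
Bernstein inequality, the other one in `L²` by Bessel's inequality. -/
lemma norm_toL2_block_mul_le {e f : Idx → C(S2, ℂ)} {K K' : ℝ} (he : BernsteinSystem e K)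
    (hf : BernsteinSystem f K') {s : ℝ} (hs0 : 0 < s) (hs1 : s < 1) (F G : Finset Idx)
    (c d : Idx → ℂ) (j k : ℕ) :
    ‖toL2 ((∑ p ∈ dyadicBlock F j, c p • e p) * ∑ p ∈ dyadicBlock G k, d p • f p)‖ ≤
      2 * Real.sqrt K * Real.sqrt K' * (decayRatio s ^ ((j - k) + (k - j)) *
        (Real.sqrt (∑ p ∈ dyadicBlock F j, lam p ^ s * ‖c p‖ ^ 2) *
          Real.sqrt (∑ p ∈ dyadicBlock G k, lam p ^ (1 - s) * ‖d p‖ ^ 2))) := by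
  set a : ℝ := 2 ^ s with ha
  have ha0 : 0 < a := by positivity
  have hab : a * (2 : ℝ) ^ (1 - s) = 2 := by
    rw [ha, ← Real.rpow_add (by norm_num)]
    norm_num
  have hb0 : (0 : ℝ) < 2 ^ (1 - s) := by positivity
  set b : ℝ := 2 ^ (1 - s) with hb
  set α := Real.sqrt (∑ p ∈ dyadicBlock F j, lam p ^ s * ‖c p‖ ^ 2)
  set β := Real.sqrt (∑ p ∈ dyadicBlock G k, lam p ^ (1 - s) * ‖d p‖ ^ 2)
  have hα : Real.sqrt (∑ p ∈ dyadicBlock F j, ‖c p‖ ^ 2) ≤ (a⁻¹) ^ j * α :=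
    sqrt_sum_dyadicBlock_le hs0.le F j c
  have hβ : Real.sqrt (∑ p ∈ dyadicBlock G k, ‖d p‖ ^ 2) ≤ (b⁻¹) ^ k * β :=
    sqrt_sum_dyadicBlock_le (by linarith) G k d
  have hα0 : 0 ≤ α := Real.sqrt_nonneg _
  have hβ0 : 0 ≤ β := Real.sqrt_nonneg _
  have hfreq : ∀ (F : Finset Idx) (j : ℕ), ∀ p ∈ dyadicBlock F j, p.1.1 ≤ 2 ^ (j + 1) :=
    fun F j p hp => by
    have h1 : Nat.log 2 p.1.1 = j := (Finset.mem_filter.1 hp).2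
    exact h1 ▸ (Nat.lt_pow_succ_log_self (by norm_num) _).le
  have hsup : ∀ {e : Idx → C(S2, ℂ)} {K : ℝ}, BernsteinSystem e K → ∀ (F : Finset Idx) (j : ℕ)
      (c : Idx → ℂ), ‖∑ p ∈ dyadicBlock F j, c p • e p‖ ≤
        2 * Real.sqrt K * 2 ^ j * Real.sqrt (∑ p ∈ dyadicBlock F j, ‖c p‖ ^ 2) :=
    fun he F j c => by
    refine (he.norm_le (hfreq F j) c).trans (le_of_eq ?_)
    push_cast
    ring
  have hL2 : ∀ {e : Idx → C(S2, ℂ)} {K : ℝ}, BernsteinSystem e K → ∀ (F : Finset Idx)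
      (c : Idx → ℂ), ‖toL2 (∑ p ∈ F, c p • e p)‖ ≤
        Real.sqrt K * Real.sqrt (∑ p ∈ F, ‖c p‖ ^ 2) := fun he F c => by
    rw [← Real.sqrt_mul he.nonneg]
    exact Real.le_sqrt_of_sq_le (he.bessel F c)
  rcases le_total j k with hjk | hkj
  · obtain ⟨i, rfl⟩ := Nat.exists_eq_add_of_le hjk
    calc _ ≤ (2 * Real.sqrt K * 2 ^ j * ((a⁻¹) ^ j * α)) *
          (Real.sqrt K' * ((b⁻¹) ^ (j + i) * β)) := by
          refine (norm_toL2_mul_le _ _).trans (mul_le_mul ((hsup he F j c).trans ?_)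
            ((hL2 hf _ d).trans ?_) (norm_nonneg _) (by positivity)) <;> gcongr
      _ = 2 * Real.sqrt K * Real.sqrt K' * ((b⁻¹) ^ i * (α * β)) * (2 * a⁻¹ * b⁻¹) ^ j := by
          rw [mul_pow, mul_pow, pow_add]
          ring
      _ = 2 * Real.sqrt K * Real.sqrt K' * ((b⁻¹) ^ i * (α * β)) := by
          have : 2 * a⁻¹ * b⁻¹ = 1 := by rw [← hab]; field_simp
          rw [this, one_pow, mul_one]
      _ ≤ _ := by
          rw [show j - (j + i) + (j + i - j) = i by omega]
          have : b⁻¹ ≤ decayRatio s := le_max_right _ _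
          gcongr
  · obtain ⟨i, rfl⟩ := Nat.exists_eq_add_of_le hkj
    calc _ ≤ (2 * Real.sqrt K' * 2 ^ k * ((b⁻¹) ^ k * β)) *
          (Real.sqrt K * ((a⁻¹) ^ (k + i) * α)) := by
          rw [mul_comm (∑ p ∈ dyadicBlock F (k + i), c p • e p)]
          refine (norm_toL2_mul_le _ _).trans (mul_le_mul ((hsup hf G k d).trans ?_)
            ((hL2 he _ c).trans ?_) (norm_nonneg _) (by positivity)) <;> gcongr
      _ = 2 * Real.sqrt K * Real.sqrt K' * ((a⁻¹) ^ i * (α * β)) * (2 * a⁻¹ * b⁻¹) ^ k := by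
          rw [mul_pow, mul_pow, pow_add]
          ring
      _ = 2 * Real.sqrt K * Real.sqrt K' * ((a⁻¹) ^ i * (α * β)) := by
          have : 2 * a⁻¹ * b⁻¹ = 1 := by rw [← hab]; field_simp
          rw [this, one_pow, mul_one]
      _ ≤ _ := by
          rw [show k + i - k + (k - (k + i)) = i by omega]
          have : a⁻¹ ≤ decayRatio s := le_max_left _ _
          gcongr

/-- The constant of the product estimate. -/
def productConst (K K' s : ℝ) : ℝ :=
  2 * Real.sqrt K * Real.sqrt K' * (2 * (1 - decayRatio s)⁻¹)

lemma productConst_nonneg (K K' : ℝ) {s : ℝ} (hs0 : 0 < s) (hs1 : s < 1) :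
    0 ≤ productConst K K' s := by
  have := decayRatio_lt_one hs0 hs1
  have : 0 < 1 - decayRatio s := by linarith
  unfold productConst
  positivity

/-- The product estimate `H^s × H^(1-s) → L²` for finite expansions. -/
lemma norm_toL2_mul_sum_le {e f : Idx → C(S2, ℂ)} {K K' : ℝ} (he : BernsteinSystem e K)
    (hf : BernsteinSystem f K') {s : ℝ} (hs0 : 0 < s) (hs1 : s < 1) (F G : Finset Idx)
    (c d : Idx → ℂ) :
    ‖toL2 ((∑ p ∈ F, c p • e p) * ∑ p ∈ G, d p • f p)‖ ≤ productConst K K' s *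
      (Real.sqrt (∑ p ∈ F, lam p ^ s * ‖c p‖ ^ 2) *
        Real.sqrt (∑ p ∈ G, lam p ^ (1 - s) * ‖d p‖ ^ 2)) := by
  have hnn : ∀ (r : ℝ) (p : Idx) (c : Idx → ℂ), 0 ≤ lam p ^ r * ‖c p‖ ^ 2 := fun r p c =>
    mul_nonneg (Real.rpow_nonneg (lam_pos p).le _) (sq_nonneg _)
  obtain ⟨n, hn⟩ : ∃ n, ∀ p ∈ F ∪ G, Nat.log 2 p.1.1 < n :=
    ⟨(F ∪ G).sup (fun p => Nat.log 2 p.1.1) + 1, fun p hp =>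
      Nat.lt_succ_of_le (Finset.le_sup (f := fun p : Idx => Nat.log 2 p.1.1) hp)⟩
  have hF : ∀ p ∈ F, Nat.log 2 p.1.1 < n := fun p hp => hn p (Finset.mem_union_left _ hp)
  have hG : ∀ p ∈ G, Nat.log 2 p.1.1 < n := fun p hp => hn p (Finset.mem_union_right _ hp)
  set α : ℕ → ℝ := fun j => Real.sqrt (∑ p ∈ dyadicBlock F j, lam p ^ s * ‖c p‖ ^ 2) with hα
  set β : ℕ → ℝ := fun k => Real.sqrt (∑ p ∈ dyadicBlock G k, lam p ^ (1 - s) * ‖d p‖ ^ 2) with hβ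
  have hα2 : ∑ j ∈ Finset.range n, α j ^ 2 = ∑ p ∈ F, lam p ^ s * ‖c p‖ ^ 2 := by
    rw [sum_dyadicBlock F hF]
    exact Finset.sum_congr rfl fun j _ => Real.sq_sqrt (Finset.sum_nonneg fun p _ => hnn _ _ _)
  have hβ2 : ∑ k ∈ Finset.range n, β k ^ 2 = ∑ p ∈ G, lam p ^ (1 - s) * ‖d p‖ ^ 2 := by
    rw [sum_dyadicBlock G hG]
    exact Finset.sum_congr rfl fun j _ => Real.sq_sqrt (Finset.sum_nonneg fun p _ => hnn _ _ _)
  have h1 : ‖toL2 ((∑ p ∈ F, c p • e p) * ∑ p ∈ G, d p • f p)‖ ≤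
      2 * Real.sqrt K * Real.sqrt K' * ∑ j ∈ Finset.range n, ∑ k ∈ Finset.range n,
        decayRatio s ^ ((j - k) + (k - j)) * (α j * β k) := by
    rw [sum_dyadicBlock F hF, sum_dyadicBlock G hG, Finset.sum_mul_sum, map_sum, Finset.mul_sum]
    refine (norm_sum_le _ _).trans (Finset.sum_le_sum fun j _ => ?_)
    rw [map_sum, Finset.mul_sum]
    exact (norm_sum_le _ _).trans (Finset.sum_le_sum fun k _ =>
      norm_toL2_block_mul_le he hf hs0 hs1 F G c d j k)
  have h2 := schur_le (decayRatio_nonneg s) (decayRatio_lt_one hs0 hs1) n α β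
  rw [hα2, hβ2] at h2
  have hpos : 0 < 1 - decayRatio s := by linarith [decayRatio_lt_one hs0 hs1]
  have h3 := Real.le_sqrt_of_sq_le h2
  rw [Real.sqrt_mul (sq_nonneg _), Real.sqrt_sq (by positivity),
    Real.sqrt_mul (Finset.sum_nonneg fun p _ => hnn _ _ _)] at h3
  refine h1.trans ((mul_le_mul_of_nonneg_left h3 (by positivity)).trans (le_of_eq ?_))
  rw [productConst]
  ring

/-- The product estimate for functions of `L²` with convergent expansions, by Fatou's lemma along a
subsequence of partial sums that converges almost everywhere. -/
lemma eLpNorm_mul_le_of_hasSum {e f : Idx → C(S2, ℂ)} {K K' : ℝ} (he : BernsteinSystem e K)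
    (hf : BernsteinSystem f K') {s : ℝ} (hs0 : 0 < s) (hs1 : s < 1) {c d : Idx → ℂ}
    {g h : Lp ℂ 2 dS} (hg : HasSum (fun p => c p • toL2 (e p)) g)
    (hh : HasSum (fun p => d p • toL2 (f p)) h) {A B : ℝ}
    (hA : ∀ F : Finset Idx, ∑ p ∈ F, lam p ^ s * ‖c p‖ ^ 2 ≤ A ^ 2) (hA0 : 0 ≤ A)
    (hB : ∀ F : Finset Idx, ∑ p ∈ F, lam p ^ (1 - s) * ‖d p‖ ^ 2 ≤ B ^ 2) (hB0 : 0 ≤ B) :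
    eLpNorm (fun x => g x * h x) 2 dS ≤ ENNReal.ofReal (productConst K K' s * (A * B)) := by
  rw [HasSum, SummationFilter.unconditional_filter] at hg hh
  obtain ⟨F, hF⟩ := exists_seq_tendsto (atTop : Filter (Finset Idx))
  have hconv : ∀ (e : Idx → C(S2, ℂ)) (c : Idx → ℂ) (F : Finset Idx),
      ∑ p ∈ F, c p • toL2 (e p) = toL2 (∑ p ∈ F, c p • e p) := fun e c F => by
    simp only [map_sum, map_smul]
  simp only [hconv] at hg hh
  obtain ⟨σ, hσ, h1⟩ := (tendstoInMeasure_of_tendsto_Lp (hg.comp hF)).exists_seq_tendsto_ae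
  obtain ⟨τ, hτ, h2⟩ := (tendstoInMeasure_of_tendsto_Lp
    ((hh.comp hF).comp hσ.tendsto_atTop)).exists_seq_tendsto_ae
  set u : ℕ → C(S2, ℂ) := fun n => (∑ p ∈ F (σ (τ n)), c p • e p) * ∑ p ∈ F (σ (τ n)), d p • f p
  have hlim : ∀ᵐ x ∂dS, Tendsto (fun n => toL2 (u n) x) atTop (𝓝 (g x * h x)) := by
    have h3 := ae_all_iff.2 fun n => ContinuousMap.coeFn_toLp (p := 2) (𝕜 := ℂ) dS (u n)
    have h4 := ae_all_iff.2 fun n => ContinuousMap.coeFn_toLp (p := 2) (𝕜 := ℂ) dS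
      (∑ p ∈ F (σ (τ n)), c p • e p)
    have h5 := ae_all_iff.2 fun n => ContinuousMap.coeFn_toLp (p := 2) (𝕜 := ℂ) dS
      (∑ p ∈ F (σ (τ n)), d p • f p)
    filter_upwards [h1, h2, h3, h4, h5] with x h1 h2 h3 h4 h5
    refine ((h1.comp hτ.tendsto_atTop).mul h2).congr fun n => ?_
    simp only [Function.comp_apply]
    rw [h3, h4, h5]
    rfl
  refine (Lp.eLpNorm_lim_le_liminf_eLpNorm (fun n => (Lp.aestronglyMeasurable _)) _ hlim).trans ?_
  refine liminf_le_of_le (by isBoundedDefault) fun b hb => ?_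
  obtain ⟨n, hn⟩ := hb.exists
  refine hn.trans ?_
  rw [← Lp.enorm_def, ← ofReal_norm]
  refine ENNReal.ofReal_le_ofReal ((norm_toL2_mul_sum_le he hf hs0 hs1 _ _ c d).trans ?_)
  refine mul_le_mul_of_nonneg_left ?_ (productConst_nonneg K K' hs0 hs1)
  exact mul_le_mul (Real.sqrt_le_left hA0 |>.2 (hA _)) (Real.sqrt_le_left hB0 |>.2 (hB _))
    (Real.sqrt_nonneg _) hA0

/-! ### The eigenfields and their gradients as Bernstein systems -/

/-- The family satisfies the Bernstein bounds with some constant. -/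
def IsBernstein (e : Idx → C(S2, ℂ)) : Prop := ∃ K, BernsteinSystem e K

lemma IsBernstein.add {e f : Idx → C(S2, ℂ)} (he : IsBernstein e) (hf : IsBernstein f) :
    IsBernstein fun p => e p + f p := by
  obtain ⟨K, he⟩ := he
  obtain ⟨K', hf⟩ := hf
  have sq_add : ∀ a b : ℝ, (a + b) ^ 2 ≤ 2 * a ^ 2 + 2 * b ^ 2 := fun a b => by
    nlinarith [sq_nonneg (a - b)]
  refine ⟨2 * K + 2 * K', by linarith [he.nonneg, hf.nonneg], fun N F hF x => ?_, fun F c => ?_⟩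
  · have h1 := he.pointwise N F hF x
    have h2 := hf.pointwise N F hF x
    calc ∑ p ∈ F, ‖(e p + f p) x‖ ^ 2 ≤ ∑ p ∈ F, (2 * ‖e p x‖ ^ 2 + 2 * ‖f p x‖ ^ 2) :=
          Finset.sum_le_sum fun p _ =>
            (pow_le_pow_left₀ (norm_nonneg _) (norm_add_le _ _) 2).trans (sq_add _ _)
      _ = 2 * ∑ p ∈ F, ‖e p x‖ ^ 2 + 2 * ∑ p ∈ F, ‖f p x‖ ^ 2 := by
          rw [Finset.sum_add_distrib, Finset.mul_sum, Finset.mul_sum]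
      _ ≤ _ := by linarith
  · have h1 := he.bessel F c
    have h2 := hf.bessel F c
    have e1 : toL2 (∑ p ∈ F, c p • (e p + f p))
        = toL2 (∑ p ∈ F, c p • e p) + toL2 (∑ p ∈ F, c p • f p) := by
      rw [← map_add, ← Finset.sum_add_distrib]
      exact congrArg toL2 (Finset.sum_congr rfl fun p _ => by ext x; simp [mul_add])
    rw [e1]
    refine (pow_le_pow_left₀ (norm_nonneg _) (norm_add_le _ _) 2).trans ((sq_add _ _).trans ?_)
    linarith

lemma IsBernstein.mul {e : Idx → C(S2, ℂ)} (he : IsBernstein e) (φ : C(S2, ℂ)) :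
    IsBernstein fun p => φ * e p := by
  obtain ⟨K, he⟩ := he
  refine ⟨‖φ‖ ^ 2 * K, mul_nonneg (sq_nonneg _) he.nonneg, fun N F hF x => ?_, fun F c => ?_⟩
  · calc ∑ p ∈ F, ‖(φ * e p) x‖ ^ 2 ≤ ∑ p ∈ F, ‖φ‖ ^ 2 * ‖e p x‖ ^ 2 := by
          refine Finset.sum_le_sum fun p _ => ?_
          rw [ContinuousMap.mul_apply, norm_mul, mul_pow]
          have := φ.norm_coe_le_norm x
          gcongr
      _ ≤ _ := by
          rw [← Finset.mul_sum, mul_assoc]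
          exact mul_le_mul_of_nonneg_left (he.pointwise N F hF x) (sq_nonneg _)
  · have e1 : ∑ p ∈ F, c p • (φ * e p) = φ * ∑ p ∈ F, c p • e p := by
      simp only [Finset.mul_sum, mul_smul_comm]
    rw [e1, mul_assoc]
    refine (pow_le_pow_left₀ (norm_nonneg _) (norm_toL2_mul_le _ _) 2).trans ?_
    rw [mul_pow]
    exact mul_le_mul_of_nonneg_left (he.bessel F c) (sq_nonneg _)

lemma IsBernstein.smul {e : Idx → C(S2, ℂ)} (he : IsBernstein e) (a : ℂ) :
    IsBernstein fun p => a • e p := by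
  have h := he.mul (algebraMap ℂ C(S2, ℂ) a)
  simpa only [← Algebra.smul_def] using h

lemma IsBernstein.sum {ι : Type*} [Fintype ι] {e : ι → Idx → C(S2, ℂ)}
    (he : ∀ i, IsBernstein (e i)) : IsBernstein fun p => ∑ i, e i p := by
  classical
  have : ∀ s : Finset ι, IsBernstein fun p => ∑ i ∈ s, e i p := fun s => by
    induction s using Finset.induction_on with
    | empty =>
      refine ⟨0, le_rfl, fun N F hF x => ?_, fun F c => ?_⟩ <;> simp
    | insert i s hi ih =>
      simp only [Finset.sum_insert hi]
      exact (he i).add ih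
  exact this Finset.univ

lemma norm_sq_sum_le_of_orthogonal {ι E : Type*} [NormedAddCommGroup E] [InnerProductSpace ℂ E]
    {v : ι → E} (h : ∀ i j, i ≠ j → inner ℂ (v i) (v j) = 0) (hv : ∀ i, ‖v i‖ ≤ 1) (F : Finset ι)
    (c : ι → ℂ) : ‖∑ i ∈ F, c i • v i‖ ^ 2 ≤ ∑ i ∈ F, ‖c i‖ ^ 2 := by
  classical
  induction F using Finset.induction_on with
  | empty => simp
  | insert a F ha ih =>
    rw [Finset.sum_insert ha, Finset.sum_insert ha]
    have h0 : inner ℂ (c a • v a) (∑ i ∈ F, c i • v i) = 0 := by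
      rw [inner_sum]
      refine Finset.sum_eq_zero fun i hi => ?_
      rw [inner_smul_left, inner_smul_right, h a i (fun e => ha (e ▸ hi))]
      simp
    rw [@norm_add_sq ℂ, h0, norm_smul]
    have h1 : (‖c a‖ * ‖v a‖) ^ 2 ≤ ‖c a‖ ^ 2 := by
      rw [mul_pow]
      exact mul_le_of_le_one_right (sq_nonneg _) (pow_le_one₀ (norm_nonneg _) (hv a))
    simp
    linarith

/-- The addition theorem as a bound for sums over arbitrary finite sets of orders. -/
lemma sum_norm_sphHarm_sq_le (L : ℕ) (T : Finset ℤ) (x : S2) :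
    ∑ m ∈ T, ‖sphHarm L m x‖ ^ 2 ≤ 2 * L + 1 := by
  have h1 : ∑ i ∈ Finset.range (2 * L + 1), ‖sphHarm L (i - L) x‖ ^ 2 ≤ 2 * L + 1 := by
    have h := sum_sphHarm_mul_conj L x
    simp only [Complex.mul_conj'] at h
    have h' : ∑ i ∈ Finset.range (2 * L + 1), ‖sphHarm L (i - L) x‖ ^ 2
        = (2 * L + 1) / (4 * Real.pi) := by exact_mod_cast h
    rw [h']
    exact div_le_self (by positivity) (by linarith [Real.pi_gt_three])
  refine le_trans ?_ h1
  have h2 : ∑ m ∈ T, ‖sphHarm L m x‖ ^ 2 = ∑ m ∈ T.filter (fun m => m.natAbs ≤ L),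
      ‖sphHarm L m x‖ ^ 2 := by
    refine (Finset.sum_filter_of_ne fun m _ hm => ?_).symm
    by_contra hL
    exact hm (by rw [sphHarm_eq_zero (not_le.1 hL)]; simp)
  rw [h2, ← Finset.sum_image (s := Finset.range (2 * L + 1)) (g := fun i : ℕ => (i : ℤ) - L)
    (f := fun m => ‖sphHarm L m x‖ ^ 2) (fun a _ b _ hab => by simpa using hab)]
  refine Finset.sum_le_sum_of_subset_of_nonneg (fun m hm => ?_) fun _ _ _ => sq_nonneg _
  have hm' := (Finset.mem_filter.1 hm).2
  exact Finset.mem_image.2 ⟨(m + L).toNat, Finset.mem_range.2 (by omega), by omega⟩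

lemma norm_toL2_harmC_le (L : ℕ) (m : ℤ) : ‖toL2 (harmC L m)‖ ≤ 1 := by
  have h : inner ℂ (toL2 (harmC L m)) (toL2 (harmC L m)) = sphInner (sphHarm L m) (sphHarm L m) :=
    inner_toL2_resC _ _
  rcases le_or_gt m.natAbs L with hm | hm
  · rw [sphInner_sphHarm_self hm, inner_self_eq_norm_sq_to_K] at h
    have h' : ‖toL2 (harmC L m)‖ ^ 2 = 1 := by
      apply Complex.ofReal_injective
      simpa using h
    nlinarith [norm_nonneg (toL2 (harmC L m))]
  · have : harmC L m = 0 := by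
      ext x
      exact sphHarm_eq_zero hm x
    rw [this]
    simp

/-- A family obtained from the spherical harmonics by a shift of the order and bounded factors is a
Bernstein system; orders out of range give zero. -/
lemma isBernstein_of_shift {e : Idx → C(S2, ℂ)} (a : ℤ) (κ : Idx → ℂ) (hκ : ∀ p, ‖κ p‖ ≤ 1)
    (he : ∀ p, e p = κ p • harmC p.1.1 (p.1.2 + a)) : IsBernstein e := by
  refine ⟨3, by norm_num, fun N F hF x => ?_, fun F c => ?_⟩
  · have h1 : ∀ p ∈ F, p.1.1 ∈ Finset.Icc 1 N := fun p hp => Finset.mem_Icc.2 ⟨p.2.1, hF p hp⟩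
    rw [← Finset.sum_fiberwise_of_maps_to h1]
    have h2 : ∀ L ∈ Finset.Icc 1 N, ∑ p ∈ F.filter (fun p => p.1.1 = L), ‖e p x‖ ^ 2 ≤ 3 * N :=
      fun L hL => by
      have h3 := sum_norm_sphHarm_sq_le L
        ((F.filter (fun p => p.1.1 = L)).image fun p => p.1.2 + a) x
      rw [Finset.sum_image (fun p hp q hq hpq => by
        have hp' := (Finset.mem_filter.1 hp).2
        have hq' := (Finset.mem_filter.1 hq).2
        exact Subtype.ext (Prod.ext (hp'.trans hq'.symm) (by simpa using hpq)))] at h3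
      have hL' := Finset.mem_Icc.1 hL
      have h4 : (2 * L + 1 : ℝ) ≤ 3 * N := by
        have h5 : (1 : ℝ) ≤ L := by exact_mod_cast hL'.1
        have h6 : (L : ℝ) ≤ N := by exact_mod_cast hL'.2
        linarith
      refine (Finset.sum_le_sum fun p hp => ?_).trans (h3.trans h4)
      rw [he, ← (Finset.mem_filter.1 hp).2, ContinuousMap.smul_apply, norm_smul, mul_pow]
      exact mul_le_of_le_one_left (sq_nonneg _) (pow_le_one₀ (norm_nonneg _) (hκ p))
    refine (Finset.sum_le_sum h2).trans (le_of_eq ?_)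
    simp
    ring
  · have h1 := norm_sq_sum_le_of_orthogonal (v := fun p : Idx => toL2 (harmC p.1.1 (p.1.2 + a)))
      (fun p q hpq => by
        rw [harmC, harmC, inner_toL2_resC]
        refine sphInner_sphHarm_of_ne (p := (q.1.1, q.1.2 + a)) (q := (p.1.1, p.1.2 + a))
          fun h => hpq (Subtype.ext (Prod.ext ?_ ?_))
        · exact (congrArg Prod.fst h).symm
        · simpa using (congrArg Prod.snd h).symm)
      (fun p => norm_toL2_harmC_le _ _) F (fun p => c p * κ p)
    have h2 : toL2 (∑ p ∈ F, c p • e p) = ∑ p ∈ F, (c p * κ p) • toL2 (harmC p.1.1 (p.1.2 + a)) := by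
      simp only [he, smul_smul, map_sum, map_smul]
    rw [h2]
    refine h1.trans ((Finset.sum_le_sum fun p _ => ?_).trans
      (le_mul_of_one_le_left (Finset.sum_nonneg fun p _ => sq_nonneg _) (by norm_num)))
    rw [norm_mul, mul_pow]
    exact mul_le_of_le_one_right (sq_nonneg _) (pow_le_one₀ (norm_nonneg _) (hκ p))

/-- The three ladder operators: raising, lowering, and the derivative about the third axis. -/
def ladderOp (σ : Fin 3) (ψ : E3 → ℂ) : E3 → ℂ := ![rotUp ψ, rotDown ψ, rot 2 ψ] σ

/-- The shift of the order by a ladder operator. -/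
def ladderShift : Fin 3 → ℤ := ![1, -1, 0]

lemma contDiff_ladderOp {ψ : E3 → ℂ} (h : ContDiff ℝ ∞ ψ) (σ : Fin 3) :
    ContDiff ℝ ∞ (ladderOp σ ψ) := by
  fin_cases σ
  · exact contDiff_rotUp h
  · exact contDiff_rotDown h
  · exact contDiff_rot h 2

lemma ladderOp_congr {f g : E3 → ℂ} (hf : ContDiff ℝ ∞ f) (hg : ContDiff ℝ ∞ g)
    (h : ∀ x : S2, f x = g x) (σ : Fin 3) (x : S2) : ladderOp σ f x = ladderOp σ g x := by
  fin_cases σ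
  · exact rotUp_congr hf hg h x
  · exact rotDown_congr hf hg h x
  · exact rot_congr hf hg h 2 x

lemma ladderOp_const_mul {f : E3 → ℂ} (hf : ContDiff ℝ ∞ f) (c : ℂ) (σ : Fin 3) (y : E3) :
    ladderOp σ (fun z => c * f z) y = c * ladderOp σ f y := by
  fin_cases σ
  · simp [ladderOp, rotUp, rot_const_mul hf]; ring
  · simp [ladderOp, rotDown, rot_const_mul hf]; ring
  · simp [ladderOp, rot_const_mul hf]

/-- The rotations in terms of the ladder operators. -/
lemma exists_rot_eq_sum_ladderOp (k : Fin 3) :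
    ∃ a : Fin 3 → ℂ, ∀ ψ y, rot k ψ y = ∑ σ, a σ * ladderOp σ ψ y := by
  fin_cases k
  · exact ⟨![1 / 2, 1 / 2, 0], fun ψ y => by
      simp [Fin.sum_univ_three, ladderOp, rot_zero_eq ψ y]; ring⟩
  · exact ⟨![-Complex.I / 2, Complex.I / 2, 0], fun ψ y => by
      simp [Fin.sum_univ_three, ladderOp, rot_one_eq ψ y]; ring⟩
  · exact ⟨![0, 0, 1], fun ψ y => by simp [Fin.sum_univ_three, ladderOp]⟩

lemma ladder_le (L : ℕ) (m : ℤ) : ladder L m ≤ Real.sqrt (L * (L + 1)) := by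
  refine Real.sqrt_le_sqrt ?_
  have : (0 : ℤ) ≤ m * (m + 1) := by
    rcases le_or_gt 0 m with h | h
    · positivity
    · nlinarith
  have : (0 : ℝ) ≤ m * (m + 1) := by exact_mod_cast this
  linarith

/-- A ladder operator maps spherical harmonics to multiples of spherical harmonics of the same
degree, with a factor of size at most `√(L(L+1))`. -/
lemma exists_ladderOp_sphHarm (σ : Fin 3) (L : ℕ) (m : ℤ) : ∃ κ : ℂ,
    ‖κ‖ ≤ Real.sqrt (L * (L + 1)) ∧
    ∀ x : S2, ladderOp σ (sphHarm L m) x = κ * sphHarm L (m + ladderShift σ) x := by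
  have hl : ∀ m, ‖-(Complex.I * ladder L m)‖ ≤ Real.sqrt (L * (L + 1)) := fun m => by
    rw [norm_neg, norm_mul, Complex.norm_I, one_mul, Complex.norm_real, Real.norm_eq_abs,
      abs_of_nonneg (show 0 ≤ ladder L m from Real.sqrt_nonneg _)]
    exact ladder_le L m
  fin_cases σ
  · exact ⟨_, hl m, rotUp_sphHarm L m⟩
  · exact ⟨_, hl (m - 1), rotDown_sphHarm L m⟩
  · rcases le_or_gt m.natAbs L with h | h
    · refine ⟨-(Complex.I * m), ?_, fun x => ?_⟩
      · rw [norm_neg, norm_mul, Complex.norm_I, one_mul, Complex.norm_intCast]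
        refine Real.le_sqrt_of_sq_le ?_
        have h1 : |(m : ℝ)| ≤ L := by
          rw [← Int.cast_abs, ← Int.natCast_natAbs]
          exact_mod_cast h
        nlinarith [abs_nonneg (m : ℝ)]
      · simpa [ladderShift, ladderOp] using rot_two_sphHarm L m x
    · refine ⟨0, by rw [norm_zero]; exact Real.sqrt_nonneg _, fun x => ?_⟩
      have := rot_two_sphHarm L m x
      rw [sphHarm_eq_zero h, mul_zero] at this
      simpa [ladderOp] using this

lemma sqrt_lam (p : Idx) : Real.sqrt (p.1.1 * (p.1.1 + 1)) = lam p ^ (1 / 2 : ℝ) := by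
  rw [Real.sqrt_eq_rpow, lam]

lemma lam_rpow_neg_half_mul (p : Idx) : lam p ^ (-(1 / 2) : ℝ) * lam p ^ (1 / 2 : ℝ) = 1 := by
  rw [← Real.rpow_add (lam_pos p)]
  norm_num

lemma isBernstein_ladderOp (σ : Fin 3) : IsBernstein fun p =>
    ((lam p ^ (-(1 / 2) : ℝ) : ℝ) : ℂ) •
      resC (ladderOp σ (sphHarm p.1.1 p.1.2)) (contDiff_ladderOp (contDiff_sphHarm _ _) σ) := by
  choose κ hκ h using fun p : Idx => exists_ladderOp_sphHarm σ p.1.1 p.1.2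
  refine isBernstein_of_shift (ladderShift σ) (fun p => ((lam p ^ (-(1 / 2) : ℝ) : ℝ) : ℂ) * κ p)
    (fun p => ?_) fun p => ?_
  · rw [norm_mul, Complex.norm_real, Real.norm_eq_abs,
      abs_of_nonneg (Real.rpow_nonneg (lam_pos p).le _)]
    refine (mul_le_mul_of_nonneg_left (hκ p)
      (Real.rpow_nonneg (lam_pos p).le _)).trans (le_of_eq ?_)
    rw [sqrt_lam, lam_rpow_neg_half_mul]
  · ext x
    rw [mul_smul]
    exact congrArg (fun z => _ * z) (h p x)

lemma isBernstein_ladderOp_ladderOp (σ τ : Fin 3) : IsBernstein fun p =>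
    (((lam p)⁻¹ : ℝ) : ℂ) • resC (ladderOp τ (ladderOp σ (sphHarm p.1.1 p.1.2)))
      (contDiff_ladderOp (contDiff_ladderOp (contDiff_sphHarm _ _) σ) τ) := by
  choose κ hκ h using fun p : Idx => exists_ladderOp_sphHarm σ p.1.1 p.1.2
  choose κ' hκ' h' using fun p : Idx => exists_ladderOp_sphHarm τ p.1.1 (p.1.2 + ladderShift σ)
  refine isBernstein_of_shift (ladderShift σ + ladderShift τ)
    (fun p => (((lam p)⁻¹ : ℝ) : ℂ) * (κ p * κ' p)) (fun p => ?_) fun p => ?_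
  · rw [norm_mul, Complex.norm_real, Real.norm_eq_abs, abs_of_nonneg (inv_nonneg.2 (lam_pos p).le),
      norm_mul, inv_mul_le_one₀ (lam_pos p)]
    refine (mul_le_mul (hκ p) (hκ' p) (norm_nonneg _) (Real.sqrt_nonneg _)).trans (le_of_eq ?_)
    exact Real.mul_self_sqrt (lam_pos p).le
  · ext x
    have hY := contDiff_sphHarm p.1.1
    have e : ladderOp τ (ladderOp σ (sphHarm p.1.1 p.1.2)) x
        = κ p * κ' p * sphHarm p.1.1 (p.1.2 + (ladderShift σ + ladderShift τ)) x := by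
      rw [ladderOp_congr (contDiff_ladderOp (hY _) σ) (contDiff_const.mul (hY _)) (h p),
        ladderOp_const_mul (hY _), h' p, mul_assoc, add_assoc]
    rw [mul_smul]
    exact congrArg (fun z => _ * z) e

lemma isBernstein_rot (k : Fin 3) : IsBernstein fun p => ((lam p ^ (-(1 / 2) : ℝ) : ℝ) : ℂ) •
    resC (rot k (sphHarm p.1.1 p.1.2)) (contDiff_rot (contDiff_sphHarm _ _) k) := by
  obtain ⟨a, ha⟩ := exists_rot_eq_sum_ladderOp k
  convert IsBernstein.sum fun σ => (isBernstein_ladderOp σ).smul (a σ) using 2 with p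
  ext x
  simp [resC, ha, Finset.mul_sum]
  exact Finset.sum_congr rfl fun σ _ => by ring

lemma isBernstein_rot_rot (k l : Fin 3) : IsBernstein fun p => (((lam p)⁻¹ : ℝ) : ℂ) •
    resC (rot l (rot k (sphHarm p.1.1 p.1.2)))
      (contDiff_rot (contDiff_rot (contDiff_sphHarm _ _) k) l) := by
  obtain ⟨a, ha⟩ := exists_rot_eq_sum_ladderOp k
  obtain ⟨b, hb⟩ := exists_rot_eq_sum_ladderOp l
  convert IsBernstein.sum fun σ => IsBernstein.sum fun τ =>
    (isBernstein_ladderOp_ladderOp σ τ).smul (a σ * b τ) using 2 with p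
  ext x
  have hY := contDiff_sphHarm p.1.1 p.1.2
  have e : rot l (rot k (sphHarm p.1.1 p.1.2)) x = ∑ σ, ∑ τ, a σ * b τ *
      ladderOp τ (ladderOp σ (sphHarm p.1.1 p.1.2)) x := by
    have e1 : rot k (sphHarm p.1.1 p.1.2) = fun y => ∑ σ, a σ * ladderOp σ (sphHarm p.1.1 p.1.2) y :=
      funext fun y => ha _ y
    rw [e1, rot_sum fun σ => contDiff_const.mul (contDiff_ladderOp hY σ)]
    refine Finset.sum_congr rfl fun σ _ => ?_
    rw [rot_const_mul (contDiff_ladderOp hY σ), hb, Finset.mul_sum]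
    exact Finset.sum_congr rfl fun τ _ => by ring
  simp [resC, e, Finset.mul_sum]
  exact Finset.sum_congr rfl fun σ _ => Finset.sum_congr rfl fun τ _ => by ring

/-- The `i`-th Cartesian component of the eigenfield. -/
def zComp (i : Fin 3) (p : Idx) : C(S2, ℂ) := ((lam p ^ (-(1 / 2) : ℝ) : ℝ) : ℂ) •
  resC (rot i (sphHarm p.1.1 p.1.2)) (contDiff_rot (contDiff_sphHarm _ _) i)

lemma zComp_apply (i : Fin 3) (p : Idx) (x : S2) : zComp i p x = zField p x i := by
  simp [zComp, zField, resC, surfCurl_apply]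

lemma isBernstein_zComp (i : Fin 3) : IsBernstein (zComp i) := isBernstein_rot i

/-- The `j`-th component of the surface gradient of the `i`-th component of the eigenfield. -/
def zGrad (i j : Fin 3) (p : Idx) : C(S2, ℂ) := ((lam p ^ (-(1 / 2) : ℝ) : ℝ) : ℂ) •
  ⟨fun x : S2 => surfGrad (rot i (sphHarm p.1.1 p.1.2)) x j, by
    exact (EuclideanSpace.proj j : C3 →L[ℂ] ℂ).continuous.comp
      (continuous_surfGrad (contDiff_rot (contDiff_sphHarm p.1.1 p.1.2) i))⟩

/-- The gradients of the eigenfields, divided by `λ^(1/2)`, form a Bernstein system. -/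
lemma isBernstein_zGrad (i j : Fin 3) :
    IsBernstein fun p => ((lam p ^ (-(1 / 2) : ℝ) : ℝ) : ℂ) • zGrad i j p := by
  have h1 := (isBernstein_rot_rot i (j + 2)).mul (resC _ (contDiff_coord (j + 1)))
  have h2 := ((isBernstein_rot_rot i (j + 1)).mul (resC _ (contDiff_coord (j + 2)))).smul (-1)
  convert h1.add h2 using 2 with p
  ext x
  have e : lam p ^ (-(1 / 2) : ℝ) * lam p ^ (-(1 / 2) : ℝ) = (lam p)⁻¹ := by
    rw [← Real.rpow_add (lam_pos p), ← Real.rpow_neg_one]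
    norm_num
  have e' : ((lam p ^ (-(1 / 2) : ℝ) : ℝ) : ℂ) * ((lam p ^ (-(1 / 2) : ℝ) : ℝ) : ℂ)
      = (((lam p)⁻¹ : ℝ) : ℂ) := by exact_mod_cast e
  rw [zGrad, smul_smul, e']
  simp [resC, surfGrad_apply]
  ring

/-! ### Components of fields and integrals of products -/

/-- The `i`-th Cartesian component of a field. -/
def comp (i : Fin 3) : L2 →L[ℂ] Lp ℂ 2 dS :=
  ContinuousLinearMap.compLpL 2 dS (EuclideanSpace.proj i : C3 →L[ℂ] ℂ)

lemma coeFn_comp (i : Fin 3) (v : L2) : comp i v =ᵐ[dS] fun x => v x i :=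
  ContinuousLinearMap.coeFn_compLpL _ v

lemma norm_comp_le (i : Fin 3) (v : L2) : ‖comp i v‖ ≤ ‖v‖ := by
  refine Lp.norm_le_norm_of_ae_le ?_
  filter_upwards [coeFn_comp i v] with x hx
  rw [hx]
  exact PiLp.norm_apply_le _ i

lemma comp_eq_toL2 {i : Fin 3} {v : L2} {f : C(S2, ℂ)} (h : ∀ᵐ x ∂dS, v x i = f x) :
    comp i v = toL2 f := by
  refine Lp.ext ?_
  filter_upwards [coeFn_comp i v, ContinuousMap.coeFn_toLp (p := 2) (𝕜 := ℂ) dS f, h]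
    with x h1 h2 h3
  rw [h1, h2, h3]

lemma comp_Z (i : Fin 3) (p : Idx) : comp i (Z p) = toL2 (zComp i p) := by
  refine comp_eq_toL2 ?_
  filter_upwards [(memLp_zField p).coeFn_toLp] with x hx
  rw [Z, hx, zComp_apply]

lemma comp_curlL2 (i : Fin 3) {ψ : E3 → ℂ} (h : ContDiff ℝ ∞ ψ) :
    comp i (curlL2 ψ h) = toL2 (resC (rot i ψ) (contDiff_rot h i)) := by
  refine comp_eq_toL2 ?_
  filter_upwards [coeFn_curlL2 h] with x hx
  rw [hx, surfCurl_apply]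
  rfl

/-- The `j`-th component of the surface gradient of a smooth function. -/
def gradC (j : Fin 3) (ψ : E3 → ℂ) (h : ContDiff ℝ ∞ ψ) : C(S2, ℂ) :=
  ⟨fun x : S2 => surfGrad ψ x j,
    (EuclideanSpace.proj j : C3 →L[ℂ] ℂ).continuous.comp (continuous_surfGrad h)⟩

lemma comp_gradL2 (j : Fin 3) {ψ : E3 → ℂ} (h : ContDiff ℝ ∞ ψ) :
    comp j (gradL2 ψ h) = toL2 (gradC j ψ h) := by
  refine comp_eq_toL2 ?_
  filter_upwards [coeFn_gradL2 h] with x hx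
  rw [hx]
  rfl

lemma hasSum_comp {v : L2} (hv : v ∈ H) (i : Fin 3) :
    HasSum (fun p => coeff v p • toL2 (zComp i p)) (comp i v) := by
  have h := (comp i).hasSum (hasSum_coeff hv)
  simpa only [Function.comp_def, map_smul, comp_Z] using h

lemma integrable_mul_mul (k : C(S2, ℂ)) (a b : Lp ℂ 2 dS) :
    Integrable (fun x => a x * b x * k x) dS := by
  have h1 : Integrable (fun x => a x * b x) dS := (Lp.memLp a).integrable_mul (Lp.memLp b)
  exact h1.mul_bdd (c := ‖k‖) k.continuous.aestronglyMeasurable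
    (Eventually.of_forall fun x => k.norm_coe_le_norm x)

/-- The Cauchy-Schwarz inequality. -/
lemma integrable_mul_and_norm_integral_le (a : Lp ℂ 2 dS) {m : S2 → ℂ}
    (hm : AEStronglyMeasurable m dS) {C : ℝ} (hC : 0 ≤ C) (h : eLpNorm m 2 dS ≤ ENNReal.ofReal C) :
    Integrable (fun x => a x * m x) dS ∧ ‖∫ x, a x * m x ∂dS‖ ≤ ‖a‖ * C := by
  have hm2 : MemLp m 2 dS := ⟨hm, h.trans_lt ENNReal.ofReal_lt_top⟩
  have hc2 : MemLp (fun x => conj (m x)) 2 dS := hm2.star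
  have hn : ‖hc2.toLp _‖ ≤ C := by
    rw [Lp.norm_toLp]
    refine ENNReal.toReal_le_of_le_ofReal hC ((eLpNorm_congr_norm_ae ?_).trans_le h)
    exact Eventually.of_forall fun x => by simp
  have e : ∫ x, a x * m x ∂dS = inner ℂ (hc2.toLp _) a := by
    rw [L2.inner_def]
    refine integral_congr_ae ?_
    filter_upwards [hc2.coeFn_toLp] with x hx
    rw [hx]
    simp
  refine ⟨(Lp.memLp a).integrable_mul hm2, ?_⟩
  rw [e]
  refine (norm_inner_le_norm _ _).trans ?_
  rw [mul_comm]
  exact mul_le_mul_of_nonneg_left hn (norm_nonneg _)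

/-- The trilinear integral `∫ a b k dS`, with one continuous factor. -/
def triInt (k : C(S2, ℂ)) (a b : Lp ℂ 2 dS) : ℂ := ∫ x, a x * b x * k x ∂dS

lemma triInt_comm (k : C(S2, ℂ)) (a b : Lp ℂ 2 dS) : triInt k a b = triInt k b a := by
  simp only [triInt, mul_comm]

lemma triInt_add_left (k : C(S2, ℂ)) (a a' b : Lp ℂ 2 dS) :
    triInt k (a + a') b = triInt k a b + triInt k a' b := by
  rw [triInt, triInt, triInt, ← integral_add (integrable_mul_mul k a b) (integrable_mul_mul k a' b)]
  refine integral_congr_ae ?_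
  filter_upwards [Lp.coeFn_add a a'] with x hx
  rw [hx, Pi.add_apply]
  ring

lemma triInt_smul_left (k : C(S2, ℂ)) (c : ℂ) (a b : Lp ℂ 2 dS) :
    triInt k (c • a) b = c * triInt k a b := by
  rw [triInt, triInt, ← integral_const_mul]
  refine integral_congr_ae ?_
  filter_upwards [Lp.coeFn_smul c a] with x hx
  rw [hx, Pi.smul_apply, smul_eq_mul]
  ring

lemma triInt_sum_smul {ι : Type*} (F : Finset ι) (c : ι → ℂ) (k : ι → C(S2, ℂ)) (a b : Lp ℂ 2 dS) :
    triInt (∑ p ∈ F, c p • k p) a b = ∑ p ∈ F, c p * triInt (k p) a b := by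
  simp only [triInt, ← integral_const_mul]
  rw [← integral_finsetSum _ fun p _ => (integrable_mul_mul (k p) a b).const_mul _]
  refine integral_congr_ae (Eventually.of_forall fun x => ?_)
  simp only [ContinuousMap.sum_apply, ContinuousMap.smul_apply, smul_eq_mul, Finset.mul_sum]
  exact Finset.sum_congr rfl fun p _ => by ring

lemma norm_triInt_le (k : C(S2, ℂ)) (a b : Lp ℂ 2 dS) : ‖triInt k a b‖ ≤ ‖k‖ * ‖a‖ * ‖b‖ := by
  have h := integrable_mul_and_norm_integral_le a (m := fun x => b x * k x) (C := ‖b‖ * ‖k‖)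
    ((Lp.aestronglyMeasurable b).mul k.continuous.aestronglyMeasurable) (by positivity) (by
      refine (eLpNorm_le_mul_eLpNorm_of_ae_le_mul (g := b) (c := ‖k‖) ?_ 2).trans (le_of_eq ?_)
      · refine Eventually.of_forall fun x => ?_
        rw [norm_mul, mul_comm]
        exact mul_le_mul_of_nonneg_right (k.norm_coe_le_norm x) (norm_nonneg _)
      · rw [← Lp.enorm_def, ← ofReal_norm, ← ENNReal.ofReal_mul (norm_nonneg _), mul_comm])
  simp only [← mul_assoc] at h
  exact h.2.trans (le_of_eq (by ring))

lemma triInt_sub_left (k : C(S2, ℂ)) (a a' b : Lp ℂ 2 dS) :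
    triInt k (a - a') b = triInt k a b - triInt k a' b := by
  rw [eq_sub_iff_add_eq, ← triInt_add_left, sub_add_cancel]

lemma triInt_sub_right (k : C(S2, ℂ)) (a b b' : Lp ℂ 2 dS) :
    triInt k a (b - b') = triInt k a b - triInt k a b' := by
  rw [triInt_comm, triInt_sub_left, triInt_comm k b, triInt_comm k b']

lemma tendsto_triInt (k : C(S2, ℂ)) {a b : ℕ → Lp ℂ 2 dS} {a' b' : Lp ℂ 2 dS}
    (ha : Tendsto a atTop (𝓝 a')) (hb : Tendsto b atTop (𝓝 b')) :
    Tendsto (fun n => triInt k (a n) (b n)) atTop (𝓝 (triInt k a' b')) := by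
  rw [tendsto_iff_norm_sub_tendsto_zero] at ha ⊢
  have hb0 := tendsto_iff_norm_sub_tendsto_zero.1 hb
  have hlim : Tendsto (fun n => ‖k‖ * ‖a n - a'‖ * ‖b n‖ + ‖k‖ * ‖a'‖ * ‖b n - b'‖) atTop
      (𝓝 (‖k‖ * 0 * ‖b'‖ + ‖k‖ * ‖a'‖ * 0)) :=
    ((ha.const_mul _).mul hb.norm).add (hb0.const_mul _)
  rw [mul_zero, zero_mul, mul_zero, add_zero] at hlim
  refine squeeze_zero (fun n => norm_nonneg _) (fun n => ?_) hlim
  have e : triInt k (a n) (b n) - triInt k a' b'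
      = triInt k (a n - a') (b n) + triInt k a' (b n - b') := by
    rw [triInt_sub_left, triInt_sub_right]
    ring
  rw [e]
  exact (norm_add_le _ _).trans (add_le_add (norm_triInt_le _ _ _) (norm_triInt_le _ _ _))

lemma triInt_toL2 (k f g : C(S2, ℂ)) : triInt k (toL2 f) (toL2 g) = ∫ x, f x * g x * k x ∂dS := by
  refine integral_congr_ae ?_
  filter_upwards [ContinuousMap.coeFn_toLp (p := 2) (𝕜 := ℂ) dS f,
    ContinuousMap.coeFn_toLp (p := 2) (𝕜 := ℂ) dS g] with x h1 h2
  rw [h1, h2]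

/-! ### Weak gradients -/

lemma eq_zero_of_integral_mul_eq_zero {f : Lp ℂ 2 dS}
    (h : ∀ χ : E3 → ℂ, ContDiff ℝ ∞ χ → ∫ x : S2, f x * χ x ∂dS = 0) : f = 0 := by
  have h0 : ∀ p, harmBasis.repr f p = 0 := fun p => by
    rw [harmBasis.repr_apply_apply, harmBasis_apply, L2.inner_def,
      ← h _ (contDiff_conj (contDiff_sphHarm p.1.1 p.1.2))]
    refine integral_congr_ae ?_
    filter_upwards [ContinuousMap.coeFn_toLp (p := 2) (𝕜 := ℂ) dS (harmC p.1.1 p.1.2)] with x hx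
    rw [hx]
    rfl
  have h1 := harmBasis.hasSum_repr f
  simp only [h0, zero_smul] at h1
  exact h1.unique hasSum_zero

lemma memLp_apply (v : L2) (i : Fin 3) : MemLp (fun x => v x i) 2 dS :=
  (memLp_congr_ae (coeFn_comp i v)).1 (Lp.memLp _)

/-- Weak surface gradients are unique, because a tangential field is determined by its integrals
against the tangential parts of smooth fields. -/
lemma IsWeakGrad.unique {f : S2 → ℂ} {g g' : L2} (h : IsWeakGrad f (fun x => g x))
    (h' : IsWeakGrad f (fun x => g' x)) : g = g' := by
  have key : ∀ j, comp j (g - g') = 0 := fun j => by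
    refine eq_zero_of_integral_mul_eq_zero fun χ hχ => ?_
    set φ : E3 → C3 := fun y => tangProj y (EuclideanSpace.single j (χ y)) with hφ
    have hval : ∀ y i, φ y i = (if i = j then χ y else 0) - (y j : ℂ) * χ y * (y i : ℂ) :=
      fun y i => by
      simp [hφ, tangProj, dotC]
    have hφs : ContDiff ℝ ∞ φ := by
      rw [contDiff_piLp 2]
      intro i
      simp only [hval]
      refine ContDiff.sub ?_ (((contDiff_coord j).mul hχ).mul (contDiff_coord i))
      split_ifs
      · exact hχ
      · exact contDiff_const
    have hφt : ∀ x : S2, dotC x (φ x) = 0 := fun x => by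
      have hx := sum_coord_sq x
      have : dotC x (φ x) = (x : E3) j * χ x - (x : E3) j * χ x * ∑ k, ((x : E3) k : ℂ) ^ 2 := by
        simp only [dotC, hval, mul_sub, Finset.sum_sub_distrib, Finset.mul_sum]
        congr 1
        · simp
        · exact Finset.sum_congr rfl fun k _ => by ring
      rw [this, hx]
      ring
    have h1 := h.integral_eq φ hφs hφt
    have h2 := h'.integral_eq φ hφs hφt
    rw [h1, neg_inj] at h2
    have hint : ∀ G : L2, Integrable (fun x : S2 => ∑ i, G x i * φ x i) dS := fun G =>
      integrable_finsetSum _ fun i _ => (memLp_apply G i).integrable_mul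
        (memLp_of_continuous (continuous_res
          ((EuclideanSpace.proj i : C3 →L[ℂ] ℂ).continuous.comp hφs.continuous)) 2)
    have h3 : ∫ x : S2, (∑ i, g x i * φ x i - ∑ i, g' x i * φ x i) ∂dS = 0 := by
      rw [integral_sub (hint g) (hint g'), h2, sub_self]
    rw [← h3]
    refine integral_congr_ae ?_
    filter_upwards [coeFn_comp j (g - g'), Lp.coeFn_sub g g', h.tangential, h'.tangential]
      with x e1 e2 e3 e4
    rw [e1, e2]
    have key : ∀ G : C3, dotC x G = 0 → ∑ i, G i * φ x i = G j * χ x := fun G hG => by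
      have : ∑ i, G i * φ x i = G j * χ x - (x : E3) j * χ x * dotC x G := by
        simp only [dotC, hval, mul_sub, Finset.sum_sub_distrib, Finset.mul_sum]
        congr 1
        · simp
        · exact Finset.sum_congr rfl fun k _ => by ring
      rw [this, hG]
      ring
    rw [key _ e3, key _ e4]
    simp
    ring
  rw [← sub_eq_zero]
  refine Lp.ext ?_
  have h1 := ae_all_iff.2 fun j => coeFn_comp j (g - g')
  simp only [key] at h1
  filter_upwards [h1, Lp.coeFn_zero ℂ 2 dS, Lp.coeFn_zero C3 2 dS] with x hx h0 h0'
  rw [h0']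
  ext j
  rw [← hx j, h0]
  rfl

lemma weakJac_eq {v : L2} {G : Fin 3 → L2} (h : IsWeakJac v G) : weakJac v = G := by
  have hex : ∃ G, IsWeakJac v G := ⟨G, h⟩
  have h1 : IsWeakJac v (weakJac v) := by
    rw [weakJac, dif_pos hex]
    exact hex.choose_spec
  exact funext fun i => (h1 i).unique (h i)

lemma continuous_surfDiv {φ : E3 → C3} (h : ContDiff ℝ ∞ φ) :
    Continuous fun x : S2 => surfDiv φ x := by
  unfold surfDiv
  refine continuous_finsetSum _ fun j _ => ?_
  exact (gradC j (fun z => φ z j) ((contDiff_piLp 2).1 h j)).continuous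

lemma IsWeakJac.sub {v w : L2} {G G' : Fin 3 → L2} (h : IsWeakJac v G) (h' : IsWeakJac w G') :
    IsWeakJac (v - w) (G - G') := fun i => by
  refine ⟨memLp_apply _ i, Lp.memLp _, ?_, fun φ hφ hφt => ?_⟩
  · filter_upwards [(h i).tangential, (h' i).tangential, Lp.coeFn_sub (G i) (G' i)] with x h1 h2 h3
    rw [Pi.sub_apply, h3]
    simp only [dotC, Pi.sub_apply, PiLp.sub_apply, mul_sub, Finset.sum_sub_distrib] at h1 h2 ⊢
    rw [h1, h2, sub_zero]
  · have hd := memLp_of_continuous (continuous_surfDiv hφ) 2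
    have hint : ∀ G : L2, Integrable (fun x : S2 => ∑ i, G x i * φ x i) dS := fun G =>
      integrable_finsetSum _ fun i _ => (memLp_apply G i).integrable_mul
        (memLp_of_continuous (continuous_res
          ((EuclideanSpace.proj i : C3 →L[ℂ] ℂ).continuous.comp hφ.continuous)) 2)
    have e1 : ∫ x : S2, (v - w) x i * surfDiv φ x ∂dS
        = ∫ x : S2, v x i * surfDiv φ x ∂dS - ∫ x : S2, w x i * surfDiv φ x ∂dS := by
      have hi : ∀ u : L2, Integrable (fun x : S2 => u x i * surfDiv φ x) dS := fun u =>
        (memLp_apply u i).integrable_mul hd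
      rw [← integral_sub (hi v) (hi w)]
      refine integral_congr_ae ?_
      filter_upwards [Lp.coeFn_sub v w] with x hx
      rw [hx]
      simp [sub_mul]
    have e2 : ∫ x : S2, ∑ j, (G - G') i x j * φ x j ∂dS
        = ∫ x : S2, ∑ j, G i x j * φ x j ∂dS - ∫ x : S2, ∑ j, G' i x j * φ x j ∂dS := by
      rw [← integral_sub (hint _) (hint _)]
      refine integral_congr_ae ?_
      filter_upwards [Lp.coeFn_sub (G i) (G' i)] with x hx
      rw [Pi.sub_apply, hx]
      simp [sub_mul]
    rw [e1, e2, (h i).integral_eq φ hφ hφt, (h' i).integral_eq φ hφ hφt]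
    ring

/-! ### Differences of fields, and tangentiality -/

lemma tendsto_eLpNorm_sub_sub {F : Type*} [NormedAddCommGroup F] {f g : Lp F 2 dS}
    {a b c : ℕ → S2 → F} (ha : ∀ n, Continuous (a n)) (hb : ∀ n, Continuous (b n))
    (hc : ∀ n x, c n x = a n x - b n x)
    (hf : Tendsto (fun n => eLpNorm (fun x => f x - a n x) 2 dS) atTop (𝓝 0))
    (hg : Tendsto (fun n => eLpNorm (fun x => g x - b n x) 2 dS) atTop (𝓝 0)) :
    Tendsto (fun n => eLpNorm (fun x => (f - g) x - c n x) 2 dS) atTop (𝓝 0) := by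
  have h := hf.add hg
  rw [add_zero] at h
  refine tendsto_of_tendsto_of_tendsto_of_le_of_le tendsto_const_nhds h (fun n => zero_le)
    fun n => ?_
  have e : eLpNorm (fun x => (f - g) x - c n x) 2 dS
      = eLpNorm ((fun x => f x - a n x) - fun x => g x - b n x) 2 dS := by
    refine eLpNorm_congr_ae ?_
    filter_upwards [Lp.coeFn_sub f g] with x hx
    rw [hx, hc, Pi.sub_apply, Pi.sub_apply]
    abel
  simp only
  rw [e]
  exact eLpNorm_sub_le ((Lp.aestronglyMeasurable f).sub (memLp_of_continuous (ha n) 2).1)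
    ((Lp.aestronglyMeasurable g).sub (memLp_of_continuous (hb n) 2).1) (by norm_num)

lemma surfCurl_sub {φ ψ : E3 → ℂ} (hφ : ContDiff ℝ ∞ φ) (hψ : ContDiff ℝ ∞ ψ) (y : E3) :
    surfCurl (fun z => φ z - ψ z) y = surfCurl φ y - surfCurl ψ y := by
  ext k
  simp only [PiLp.sub_apply, surfCurl_apply, rot_sub hφ hψ]

lemma surfGrad_sub {φ ψ : E3 → ℂ} (hφ : ContDiff ℝ ∞ φ) (hψ : ContDiff ℝ ∞ ψ) (x : S2) :
    surfGrad (fun z => φ z - ψ z) x = surfGrad φ x - surfGrad ψ x := by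
  ext k
  simp only [PiLp.sub_apply, surfGrad_apply, rot_sub hφ hψ]
  ring

lemma sub_mem_V {v w : L2} (hv : v ∈ V) (hw : w ∈ V) : v - w ∈ V := by
  obtain ⟨G, hG, ψ, hψ, h1, h2⟩ := hv
  obtain ⟨G', hG', ψ', hψ', h1', h2'⟩ := hw
  have e : ∀ (χ : E3 → ℂ) (i : Fin 3), (fun y => surfCurl χ y i) = rot i χ := fun χ i =>
    funext fun y => surfCurl_apply χ y i
  refine ⟨G - G', hG.sub hG', fun n z => ψ n z - ψ' n z, fun n => (hψ n).sub (hψ' n), ?_,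
    fun i => ?_⟩
  · exact tendsto_eLpNorm_sub_sub (fun n => continuous_res (continuous_surfCurl (hψ n)))
      (fun n => continuous_res (continuous_surfCurl (hψ' n)))
      (fun n x => surfCurl_sub (hψ n) (hψ' n) x) h1 h1'
  · simp only [e] at h2 h2' ⊢
    refine tendsto_eLpNorm_sub_sub (fun n => continuous_surfGrad (contDiff_rot (hψ n) i))
      (fun n => continuous_surfGrad (contDiff_rot (hψ' n) i)) (fun n x => ?_) (h2 i) (h2' i)
    have : rot i (fun z => ψ n z - ψ' n z) = fun z => rot i (ψ n) z - rot i (ψ' n) z :=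
      funext fun z => rot_sub (hψ n) (hψ' n) i z
    rw [this, surfGrad_sub (contDiff_rot (hψ n) i) (contDiff_rot (hψ' n) i)]

lemma dotC_surfCurl (ψ : E3 → ℂ) (y : E3) : dotC y (surfCurl ψ y) = 0 := by
  simp only [dotC, surfCurl_apply, sum_coord_mul_rot]

lemma dotC_Z (p : Idx) : ∀ᵐ x : S2 ∂dS, dotC x (Z p x) = 0 := by
  filter_upwards [(memLp_zField p).coeFn_toLp] with x hx
  have h := dotC_surfCurl (sphHarm p.1.1 p.1.2) x
  have e : dotC x (zField p x) = ((lam p ^ (-(1 / 2) : ℝ) : ℝ) : ℂ) *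
      dotC x (surfCurl (sphHarm p.1.1 p.1.2) x) := by
    simp only [dotC, zField, PiLp.smul_apply, smul_eq_mul, Finset.mul_sum]
    exact Finset.sum_congr rfl fun k _ => by ring
  rw [Z, hx, e, h, mul_zero]

/-- The fields of `H` are tangential, as almost everywhere limits of a sequence of curls. -/
lemma dotC_of_mem_H {v : L2} (hv : v ∈ H) : ∀ᵐ x : S2 ∂dS, dotC x (v x) = 0 := by
  obtain ⟨ψ, hψ, h⟩ := hv
  obtain ⟨σ, -, h1⟩ := (tendstoInMeasure_of_tendsto_Lp
    (tendsto_toLp_of_eLpNorm (fun n => memLp_surfCurl (hψ n)) h)).exists_seq_tendsto_ae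
  filter_upwards [h1, ae_all_iff.2 fun n => (memLp_surfCurl (hψ (σ n))).coeFn_toLp] with x hx hc
  simp only [hc] at hx
  have hcont : Continuous fun a : C3 => dotC x a := by
    unfold dotC
    fun_prop
  have h2 := (hcont.tendsto (v x)).comp hx
  simp only [Function.comp_def, dotC_surfCurl] at h2
  exact tendsto_nhds_unique h2 tendsto_const_nhds

/-! ### The trilinear form -/

/-- Against a tangential field the projection in the covariant derivative has no effect. -/
lemma bIntegrand_ae_eq (u v : L2) {w : L2} (hw : ∀ᵐ x : S2 ∂dS, dotC x (w x) = 0) :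
    bIntegrand u v w =ᵐ[dS] fun x => ∑ i, ∑ j,
      comp j (weakJac v i) x * (comp j u x * conj (comp i w x)) := by
  filter_upwards [hw, ae_all_iff.2 fun i => ae_all_iff.2 fun j => coeFn_comp j (weakJac v i),
    ae_all_iff.2 fun j => coeFn_comp j u, ae_all_iff.2 fun i => coeFn_comp i w] with x h0 h1 h2 h3
  simp only [h1, h2, h3]
  have h4 : ∑ i, ((x : E3) i : ℂ) * conj (w x i) = 0 := by
    have := congrArg conj h0
    simpa [dotC] using this
  set a : C3 := WithLp.toLp 2 fun i => ∑ j, u x j * weakJac v i x j with ha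
  have e : bIntegrand u v w x = ∑ i, a i * conj (w x i)
      - dotC x a * ∑ i, ((x : E3) i : ℂ) * conj (w x i) := by
    rw [Finset.mul_sum, ← Finset.sum_sub_distrib]
    exact Finset.sum_congr rfl fun i _ => by
      simp only [covDeriv, tangProj, ← ha]
      ring
  rw [e, h4, mul_zero, sub_zero]
  refine Finset.sum_congr rfl fun i _ => ?_
  simp only [ha, Finset.sum_mul]
  exact Finset.sum_congr rfl fun j _ => by ring

/-- The product of two fields of `D(A^{1/4})` is square integrable. -/
lemma exists_eLpNorm_comp_mul_comp_le (i j : Fin 3) : ∃ C : ℝ, 0 ≤ C ∧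
    ∀ u ∈ domPow (1 / 4), ∀ w ∈ domPow (1 / 4),
      eLpNorm (fun x => comp j u x * conj (comp i w x)) 2 dS
        ≤ ENNReal.ofReal (C * (‖stokesPow (1 / 4) u‖ * ‖stokesPow (1 / 4) w‖)) := by
  obtain ⟨K, hK⟩ := isBernstein_zComp j
  obtain ⟨K', hK'⟩ := isBernstein_zComp i
  have hsum : ∀ v ∈ domPow (1 / 4), ∀ s : ℝ, s = 1 / 2 → ∀ F : Finset Idx,
      ∑ p ∈ F, lam p ^ s * ‖coeff v p‖ ^ 2 ≤ ‖stokesPow (1 / 4) v‖ ^ 2 := fun v hv s hs F => by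
    have h := norm_sq_stokesPow hv
    rw [hs]
    norm_num at h ⊢
    exact sum_le_hasSum F
      (fun p _ => mul_nonneg (Real.rpow_nonneg (lam_pos p).le _) (sq_nonneg _)) h
  refine ⟨productConst K K' (1 / 2), productConst_nonneg K K' (by norm_num)
    (by norm_num), fun u hu w hw => ?_⟩
  refine (le_of_eq (eLpNorm_congr_norm_ae (Eventually.of_forall fun x => ?_))).trans
    (eLpNorm_mul_le_of_hasSum hK hK' (by norm_num : (0 : ℝ) < 1 / 2) (by norm_num)
      (hasSum_comp hu.1 j) (hasSum_comp hw.1 i) (hsum u hu _ rfl) (norm_nonneg _)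
      (hsum w hw _ (by norm_num)) (norm_nonneg _))
  simp

/-- The integrand is a sum of products of `∇v ∈ L²` with products of components of `u` and `w`, which
are square integrable as `V ⊆ D(A^{1/4})`. -/
lemma integrable_bIntegrand_and_bound {u v : L2} (hu : u ∈ V) :
    (∀ w ∈ V, Integrable (bIntegrand u v w) dS) ∧
      ∃ K : ℝ, ∀ w ∈ V, ‖B u v w‖ ≤ K * ‖stokesPow (1 / 2) w‖ := by
  choose C hC0 hC using exists_eLpNorm_comp_mul_comp_le
  have hq : ∀ {w : L2}, w ∈ V → w ∈ domPow (1 / 4) := fun hw =>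
    mem_domPow_of_le (by norm_num) (mem_domPow_half hw)
  have hb : ∀ w ∈ V, ∀ i j, Integrable (fun x => comp j (weakJac v i) x *
      (comp j u x * conj (comp i w x))) dS ∧
      ‖∫ x, comp j (weakJac v i) x * (comp j u x * conj (comp i w x)) ∂dS‖ ≤
      ‖comp j (weakJac v i)‖ * (C i j * (‖stokesPow (1 / 4) u‖ * ‖stokesPow (1 / 4) w‖)) :=
    fun w hw i j => integrable_mul_and_norm_integral_le _
      ((Lp.aestronglyMeasurable _).mul (Lp.memLp (comp i w)).star.1)
      (by have := hC0 i j; positivity) (hC i j u (hq hu) w (hq hw))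
  refine ⟨fun w hw => ?_, ∑ i, ∑ j, ‖comp j (weakJac v i)‖ * (C i j * ‖stokesPow (1 / 4) u‖),
    fun w hw => ?_⟩
  · exact (integrable_finsetSum _ fun i _ => integrable_finsetSum _ fun j _ =>
      (hb w hw i j).1).congr (bIntegrand_ae_eq u v (dotC_of_mem_H (mem_H_of_mem_V hw))).symm
  · have e : B u v w = ∑ i, ∑ j,
        ∫ x, comp j (weakJac v i) x * (comp j u x * conj (comp i w x)) ∂dS := by
      refine (integral_congr_ae (bIntegrand_ae_eq u v
        (dotC_of_mem_H (mem_H_of_mem_V hw)))).trans ?_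
      rw [integral_finsetSum _ fun i _ => integrable_finsetSum _ fun j _ => (hb w hw i j).1]
      exact Finset.sum_congr rfl fun i _ => integral_finsetSum _ fun j _ => (hb w hw i j).1
    rw [e]
    simp only [Finset.sum_mul]
    refine norm_sum_le_of_le _ fun i _ => norm_sum_le_of_le _ fun j _ => (hb w hw i j).2.trans ?_
    have h1 := norm_stokesPow_le (by norm_num : (1 / 4 : ℝ) ≤ 1 / 2) (mem_domPow_half hw)
    have h2 := mul_le_mul_of_nonneg_left
      (mul_le_mul_of_nonneg_left h1 (norm_nonneg (stokesPow (1 / 4) u))) (hC0 i j)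
    exact (mul_le_mul_of_nonneg_left h2 (norm_nonneg _)).trans (le_of_eq (by ring))

lemma memVDual_B {u v : L2} (hu : u ∈ V) : MemVDual (B u v) := by
  obtain ⟨hint, hK⟩ := integrable_bIntegrand_and_bound (v := v) hu
  refine ⟨fun w hw z hz c => ?_, hK⟩
  rw [B, B, B, ← integral_const_mul, ← integral_add ((hint w hw).const_mul _) (hint z hz)]
  refine integral_congr_ae ?_
  filter_upwards [Lp.coeFn_add (c • w) z, Lp.coeFn_smul c w] with x h1 h2
  simp only [bIntegrand, h1, h2, Pi.add_apply, Pi.smul_apply, PiLp.add_apply, PiLp.smul_apply,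
    smul_eq_mul, map_add, map_mul, Finset.mul_sum, ← Finset.sum_add_distrib]
  exact Finset.sum_congr rfl fun i _ => by ring

lemma B_Z_eq_sum_grad (u v : L2) (p : Idx) : B u v (Z p) =
    ∑ i, ∑ j, triInt (star (zComp i p)) (comp j u) (comp j (weakJac v i)) := by
  have hint := fun i j => integrable_mul_mul (star (zComp i p)) (comp j u) (comp j (weakJac v i))
  have e : B u v (Z p) = ∫ x, ∑ i, ∑ j, comp j u x * comp j (weakJac v i) x *
      star (zComp i p) x ∂dS := by
    refine integral_congr_ae ((bIntegrand_ae_eq u v (dotC_Z p)).trans ?_)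
    filter_upwards [ae_all_iff.2 fun i => coeFn_comp i (Z p), (memLp_zField p).coeFn_toLp]
      with x h1 h2
    refine Finset.sum_congr rfl fun i _ => Finset.sum_congr rfl fun j _ => ?_
    rw [h1, Z, h2, ContinuousMap.star_apply, zComp_apply]
    simp only [RCLike.star_def]
    ring
  rw [e, integral_finsetSum _ fun i _ => integrable_finsetSum _ fun j _ => hint i j]
  exact Finset.sum_congr rfl fun i _ => integral_finsetSum _ fun j _ => hint i j

/-! ### Integration by parts -/

lemma surfGrad_mul_conj {f g : E3 → ℂ} (hf : ContDiff ℝ ∞ f) (hg : ContDiff ℝ ∞ g) (x : S2)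
    (j : Fin 3) : surfGrad (fun z => f z * conj (g z)) x j
      = surfGrad f x j * conj (g x) + f x * conj (surfGrad g x j) := by
  simp only [surfGrad_apply, rot_mul hf (contDiff_conj hg), rot_conj hg, map_sub, map_mul,
    Complex.conj_ofReal]
  ring

/-- Curls have no divergence, so the derivative passes to the test function. -/
lemma sum_triInt_curl_grad {φ f g : E3 → ℂ} (hφ : ContDiff ℝ ∞ φ) (hf : ContDiff ℝ ∞ f)
    (hg : ContDiff ℝ ∞ g) :
    ∑ j, triInt (star (resC g hg)) (comp j (curlL2 φ hφ)) (comp j (gradL2 f hf))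
      = - ∑ j, triInt (star (gradC j g hg)) (comp j (curlL2 φ hφ)) (toL2 (resC f hf)) := by
  rw [eq_neg_iff_add_eq_zero, ← Finset.sum_add_distrib]
  simp only [comp_curlL2, comp_gradL2]
  have hi : ∀ a b k : C(S2, ℂ), Integrable (fun x => a x * b x * k x) dS := fun a b k =>
    integrable_of_continuous ((a.continuous.mul b.continuous).mul k.continuous)
  have e : ∀ j, triInt (star (resC g hg)) (toL2 (resC (rot j φ) (contDiff_rot hφ j)))
        (toL2 (gradC j f hf)) + triInt (star (gradC j g hg))
        (toL2 (resC (rot j φ) (contDiff_rot hφ j))) (toL2 (resC f hf))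
      = ∫ x : S2, surfCurl φ x j * surfGrad (fun z => f z * conj (g z)) x j ∂dS := fun j => by
    rw [triInt_toL2, triInt_toL2, ← integral_add (hi _ _ _) (hi _ _ _)]
    refine integral_congr_ae (Eventually.of_forall fun x => ?_)
    have hr : ∀ {ψ : E3 → ℂ} (h : ContDiff ℝ ∞ ψ), resC ψ h x = ψ x := fun _ => rfl
    have hG : ∀ {ψ : E3 → ℂ} (h : ContDiff ℝ ∞ ψ), gradC j ψ h x = surfGrad ψ x j := fun _ => rfl
    simp only [surfGrad_mul_conj hf hg, surfCurl_apply, hr, hG, ContinuousMap.star_apply,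
      RCLike.star_def]
    ring
  simp only [e]
  rw [← integral_surfCurl_mul_surfGrad hφ (hf.mul (contDiff_conj hg)), integral_finsetSum]
  intro j _
  have hF := hf.mul (contDiff_conj hg)
  exact integrable_of_continuous
    (((EuclideanSpace.proj j : C3 →L[ℂ] ℂ).continuous.comp
      (continuous_res (continuous_surfCurl hφ))).mul
    ((EuclideanSpace.proj j : C3 →L[ℂ] ℂ).continuous.comp (continuous_surfGrad hF)))

lemma triInt_star_smul (c : ℂ) (k : C(S2, ℂ)) (a b : Lp ℂ 2 dS) :
    triInt (star (c • k)) a b = conj c * triInt (star k) a b := by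
  have h := triInt_sum_smul {()} (fun _ : Unit => conj c) (fun _ => star k) a b
  simpa [star_smul] using h

/-- Skew-symmetry of the trilinear form, tested with an eigenfield. -/
lemma B_Z_eq {u v : L2} (hu : u ∈ V) (hv : v ∈ V) (p : Idx) : B u v (Z p) =
    - ∑ i, ∑ j, triInt (star (zGrad i j p)) (comp j u) (comp i v) := by
  obtain ⟨-, φ, hφ, -, hu1, -⟩ := exists_approx_of_mem_V hu
  obtain ⟨G, ψ, hψ, hG, hv1, hv2⟩ := exists_approx_of_mem_V hv
  have hc : ∀ j, Tendsto (fun n => comp j (curlL2 (φ n) (hφ n))) atTop (𝓝 (comp j u)) := fun j =>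
    ((comp j).continuous.tendsto _).comp hu1
  have hd : ∀ i, Tendsto (fun n => comp i (curlL2 (ψ n) (hψ n))) atTop (𝓝 (comp i v)) := fun i =>
    ((comp i).continuous.tendsto _).comp hv1
  have hg : ∀ i j, Tendsto (fun n => comp j (gradL2 (rot i (ψ n)) (contDiff_rot (hψ n) i))) atTop
      (𝓝 (comp j (G i))) := fun i j => ((comp j).continuous.tendsto _).comp (hv2 i)
  rw [B_Z_eq_sum_grad, weakJac_eq hG, ← Finset.sum_neg_distrib]
  refine Finset.sum_congr rfl fun i _ => ?_
  have hY := contDiff_rot (contDiff_sphHarm p.1.1 p.1.2) i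
  have hz : ∀ j, zGrad i j p = ((lam p ^ (-(1 / 2) : ℝ) : ℝ) : ℂ) • gradC j _ hY := fun j => rfl
  simp only [zComp, hz, triInt_star_smul, ← Finset.mul_sum]
  rw [← mul_neg]
  congr 1
  have h1 := tendsto_finsetSum Finset.univ fun j _ =>
    tendsto_triInt (star (resC _ hY)) (hc j) (hg i j)
  have h2 := (tendsto_finsetSum Finset.univ fun j _ =>
    tendsto_triInt (star (gradC j _ hY)) (hc j) (hd i)).neg
  refine tendsto_nhds_unique h1 (h2.congr fun n => ?_)
  simp only [comp_curlL2 i]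
  exact (sum_triInt_curl_grad (hφ n) (contDiff_rot (hψ n) i) hY).symm

/-! ### The estimates -/

/-- The integral of `a w_k` against a component of the gradient of `A^{-δ} g`, where `g` has the
coefficients `β`. The product estimate is applied to `w_k` and the gradient, with `s = 2(1 - δ)`. -/
lemma exists_norm_triInt_zGrad_le {δ : ℝ} (hδ₁ : 1 / 2 < δ) (hδ₂ : δ < 1) (i j k : Fin 3) :
    ∃ C : ℝ, ∀ (a : Lp ℂ 2 dS), ∀ w ∈ domPow (1 - δ), ∀ (F : Finset Idx) (β : Idx → ℂ),
      ‖triInt (star (∑ p ∈ F, (((lam p ^ (-δ) : ℝ) : ℂ) * β p) • zGrad i j p)) a (comp k w)‖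
        ≤ C * (‖a‖ * (‖stokesPow (1 - δ) w‖ * √(∑ p ∈ F, ‖β p‖ ^ 2))) := by
  classical
  obtain ⟨K, hK⟩ := isBernstein_zComp k
  obtain ⟨K', hK'⟩ := isBernstein_zGrad i j
  have hs0 : 0 < 2 * (1 - δ) := by linarith
  have hs1 : 2 * (1 - δ) < 1 := by linarith
  have hC := productConst_nonneg K K' hs0 hs1
  refine ⟨productConst K K' (2 * (1 - δ)), fun a w hw F β => ?_⟩
  set h : C(S2, ℂ) := ∑ p ∈ F, (((lam p ^ (-δ) : ℝ) : ℂ) * β p) • zGrad i j p with hh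
  -- The coefficients of `h` with respect to the normalized gradients `λ^{-1/2} ∇Z`. With the weight
  -- `λ^{2δ-1}` their squares are the `|β p|²`.
  set d : Idx → ℂ := fun p => if p ∈ F then ((lam p ^ (1 / 2 - δ) : ℝ) : ℂ) * β p else 0 with hd
  have hsum : HasSum (fun p => d p • toL2 (((lam p ^ (-(1 / 2) : ℝ) : ℝ) : ℂ) • zGrad i j p))
      (toL2 h) := by
    have e : toL2 h = ∑ p ∈ F, d p • toL2 (((lam p ^ (-(1 / 2) : ℝ) : ℝ) : ℂ) • zGrad i j p) := by
      rw [hh, map_sum]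
      refine Finset.sum_congr rfl fun p hp => ?_
      rw [map_smul, map_smul, smul_smul, hd]
      simp only [if_pos hp]
      congr 1
      rw [mul_right_comm, ← Complex.ofReal_mul, ← Real.rpow_add (lam_pos p)]
      congr 4
      ring
    rw [e]
    refine hasSum_sum_of_ne_finset_zero fun p hp => ?_
    simp [hd, hp]
  have hA : ∀ G : Finset Idx, ∑ p ∈ G, lam p ^ (2 * (1 - δ)) * ‖coeff w p‖ ^ 2
      ≤ ‖stokesPow (1 - δ) w‖ ^ 2 := fun G => sum_le_hasSum G
    (fun p _ => mul_nonneg (Real.rpow_nonneg (lam_pos p).le _) (sq_nonneg _)) (norm_sq_stokesPow hw)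
  have hB : ∀ G : Finset Idx, ∑ p ∈ G, lam p ^ (1 - 2 * (1 - δ)) * ‖d p‖ ^ 2
      ≤ √(∑ p ∈ F, ‖β p‖ ^ 2) ^ 2 := fun G => by
    rw [Real.sq_sqrt (Finset.sum_nonneg fun p _ => sq_nonneg _)]
    have e : ∀ p, lam p ^ (1 - 2 * (1 - δ)) * ‖d p‖ ^ 2 = if p ∈ F then ‖β p‖ ^ 2 else 0 :=
      fun p => by
      simp only [hd]
      split_ifs with hp
      · rw [norm_mul, mul_pow, ← mul_assoc, Complex.norm_real, Real.norm_eq_abs, sq_abs,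
          ← Real.rpow_natCast, ← Real.rpow_mul (lam_pos p).le, ← Real.rpow_add (lam_pos p)]
        have : 1 - 2 * (1 - δ) + (1 / 2 - δ) * ((2 : ℕ) : ℝ) = 0 := by push_cast; ring
        rw [this, Real.rpow_zero, one_mul]
      · simp
    simp only [e]
    rw [← Finset.sum_filter]
    refine Finset.sum_le_sum_of_subset_of_nonneg (fun p hp => (Finset.mem_filter.1 hp).2)
      fun p _ _ => sq_nonneg _
  have hprod := eLpNorm_mul_le_of_hasSum hK hK' hs0 hs1 (hasSum_comp hw.1 k) hsum hA (norm_nonneg _)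
    hB (Real.sqrt_nonneg _)
  have hm : eLpNorm (fun x => comp k w x * star h x) 2 dS ≤ ENNReal.ofReal
      (productConst K K' (2 * (1 - δ)) * (‖stokesPow (1 - δ) w‖ * √(∑ p ∈ F, ‖β p‖ ^ 2))) := by
    refine (le_of_eq (eLpNorm_congr_norm_ae ?_)).trans hprod
    filter_upwards [ContinuousMap.coeFn_toLp (p := 2) (𝕜 := ℂ) dS h] with x hx
    rw [hx]
    simp
  have h1 := (integrable_mul_and_norm_integral_le a ((Lp.aestronglyMeasurable _).mul
    (star h).continuous.aestronglyMeasurable) (by positivity) hm).2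
  have e : triInt (star h) a (comp k w) = ∫ x, a x * (comp k w x * star h x) ∂dS := by
    simp only [triInt, mul_assoc]
  rw [e]
  exact h1.trans (le_of_eq (by ring))

/-- Duality: the coefficients of `A^{-δ} B(u, v)` are taken as the weights `β`, which gives
`S ≤ 9 X √S` for the sum `S` of their squares. -/
lemma sum_norm_sq_B_Z_le {δ X : ℝ} {u v : L2} (hu : u ∈ V) (hv : v ∈ V)
    (h : ∀ (i j : Fin 3) (F : Finset Idx) (β : Idx → ℂ),
      ‖triInt (star (∑ p ∈ F, (((lam p ^ (-δ) : ℝ) : ℂ) * β p) • zGrad i j p))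
        (comp j u) (comp i v)‖ ≤ X * √(∑ p ∈ F, ‖β p‖ ^ 2)) (F : Finset Idx) :
    ∑ p ∈ F, lam p ^ (2 * -δ) * ‖B u v (Z p)‖ ^ 2 ≤ (9 * X) ^ 2 := by
  set β : Idx → ℂ := fun p => ((lam p ^ (-δ) : ℝ) : ℂ) * B u v (Z p) with hβ
  have e1 : ∀ p, lam p ^ (2 * -δ) * ‖B u v (Z p)‖ ^ 2 = ‖β p‖ ^ 2 := fun p => by
    rw [hβ, norm_sq_rpow_mul]
  simp only [e1]
  set S : ℝ := ∑ p ∈ F, ‖β p‖ ^ 2 with hS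
  have hS0 : 0 ≤ S := Finset.sum_nonneg fun p _ => sq_nonneg _
  have e2 : (S : ℂ) = - ∑ i, ∑ j, triInt (star (∑ p ∈ F, (((lam p ^ (-δ) : ℝ) : ℂ) * β p) •
      zGrad i j p)) (comp j u) (comp i v) := by
    have e3 : ∀ i j, triInt (star (∑ p ∈ F, (((lam p ^ (-δ) : ℝ) : ℂ) * β p) • zGrad i j p))
        (comp j u) (comp i v) = ∑ p ∈ F, ((lam p ^ (-δ) : ℝ) : ℂ) * conj (β p) *
        triInt (star (zGrad i j p)) (comp j u) (comp i v) := fun i j => by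
      rw [star_sum]
      simp only [star_smul]
      rw [triInt_sum_smul]
      simp
    simp only [e3]
    rw [Finset.sum_congr rfl fun i _ => Finset.sum_comm, Finset.sum_comm, ← Finset.sum_neg_distrib,
      hS, Complex.ofReal_sum]
    refine Finset.sum_congr rfl fun p _ => ?_
    simp only [← Finset.mul_sum]
    rw [← mul_neg, ← B_Z_eq hu hv, Complex.ofReal_pow, ← Complex.conj_mul', hβ]
    ring
  have h2 : S ≤ 9 * X * √S := by
    have h3 : ‖(S : ℂ)‖ ≤ ∑ _i : Fin 3, ∑ _j : Fin 3, X * √S := by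
      rw [e2, norm_neg]
      exact norm_sum_le_of_le _ fun i _ => norm_sum_le_of_le _ fun j _ => h i j F β
    rw [Complex.norm_real, Real.norm_eq_abs, abs_of_nonneg hS0] at h3
    simp only [Finset.sum_const, Finset.card_univ, Fintype.card_fin, nsmul_eq_mul] at h3
    norm_num at h3
    linarith
  have h4 := Real.sq_sqrt hS0
  rcases (Real.sqrt_nonneg S).eq_or_lt with h5 | h5
  · rw [← h4, ← h5]
    simpa using sq_nonneg (9 * X)
  · have h6 : √S ≤ 9 * X := by
      refine le_of_mul_le_mul_right ?_ h5
      nlinarith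
    rw [← h4]
    exact pow_le_pow_left₀ h5.le h6 2

/-- Both estimates for finite partial sums. As `triInt` is symmetric, either of the two fields can
take the role of the factor with `1 - δ` powers of `A`. -/
lemma exists_sum_norm_sq_B_Z_le {δ : ℝ} (hδ₁ : 1 / 2 < δ) (hδ₂ : δ < 1) :
    ∃ C : ℝ, 0 ≤ C ∧ ∀ u ∈ V, ∀ v ∈ V, ∀ F : Finset Idx,
      ∑ p ∈ F, lam p ^ (2 * -δ) * ‖B u v (Z p)‖ ^ 2 ≤ (C * ‖stokesPow (1 - δ) u‖ * ‖v‖) ^ 2 ∧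
      ∑ p ∈ F, lam p ^ (2 * -δ) * ‖B u v (Z p)‖ ^ 2 ≤ (C * ‖u‖ * ‖stokesPow (1 - δ) v‖) ^ 2 := by
  choose D hD using exists_norm_triInt_zGrad_le hδ₁ hδ₂
  obtain ⟨M, hM⟩ := (Set.finite_range fun q : Fin 3 × Fin 3 × Fin 3 => D q.1 q.2.1 q.2.2).bddAbove
  have hDM : ∀ i j k, D i j k ≤ max M 0 := fun i j k =>
    (hM ⟨(i, j, k), rfl⟩).trans (le_max_left _ _)
  have hM0 : 0 ≤ max M 0 := le_max_right _ _
  have hdom : ∀ {v : L2}, v ∈ V → v ∈ domPow (1 - δ) := fun hv =>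
    mem_domPow_of_le (by linarith) (mem_domPow_half hv)
  have key : ∀ (i j k l : Fin 3) (a w : L2), w ∈ V → ∀ (F : Finset Idx) (β : Idx → ℂ),
      ‖triInt (star (∑ p ∈ F, (((lam p ^ (-δ) : ℝ) : ℂ) * β p) • zGrad i j p))
        (comp l a) (comp k w)‖ ≤ max M 0 * (‖a‖ * ‖stokesPow (1 - δ) w‖) * √(∑ p ∈ F, ‖β p‖ ^ 2) :=
    fun i j k l a w hw F β => by
      refine (hD i j k (comp l a) w (hdom hw) F β).trans ?_
      rw [mul_assoc, mul_assoc]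
      exact mul_le_mul (hDM i j k) (mul_le_mul_of_nonneg_right (norm_comp_le l a) (by positivity))
        (by positivity) hM0
  refine ⟨9 * max M 0, by positivity, fun u hu v hv F => ⟨?_, ?_⟩⟩
  · refine (sum_norm_sq_B_Z_le hu hv (X := max M 0 * (‖v‖ * ‖stokesPow (1 - δ) u‖))
      (fun i j F β => ?_) F).trans (le_of_eq (by ring))
    rw [triInt_comm]
    exact key i j j i v u hu F β
  · exact (sum_norm_sq_B_Z_le hu hv (X := max M 0 * (‖u‖ * ‖stokesPow (1 - δ) v‖))
      (fun i j F β => key i j i j u v hv F β) F).trans (le_of_eq (by ring))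

section StokesPowDual

variable {s : ℝ} {F G : L2 → ℂ}

lemma dualInDom_of_sum_le {X : ℝ}
    (h : ∀ T : Finset Idx, ∑ p ∈ T, lam p ^ (2 * s) * ‖F (Z p)‖ ^ 2 ≤ X) : DualInDom s F :=
  summable_of_sum_le (fun p => mul_nonneg (Real.rpow_nonneg (lam_pos p).le _) (sq_nonneg _)) h

lemma norm_stokesPowDual_le {X : ℝ} (hX : 0 ≤ X)
    (h : ∀ T : Finset Idx, ∑ p ∈ T, lam p ^ (2 * s) * ‖F (Z p)‖ ^ 2 ≤ X ^ 2) :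
    ‖stokesPowDual s F‖ ≤ X := by
  have hs : Summable fun p => ‖((lam p ^ s : ℝ) : ℂ) * F (Z p)‖ ^ 2 := by
    simp only [norm_sq_rpow_mul]
    exact dualInDom_of_sum_le h
  have h1 := hasSum_norm_sq_of_orthonormal orthonormal_Z hs
  simp only [norm_sq_rpow_mul] at h1
  exact (sq_le_sq₀ (norm_nonneg _) hX).1 (hasSum_le_of_sum_le h1 h)

lemma DualInDom.summable (h : DualInDom s F) :
    Summable fun p => (((lam p ^ s : ℝ) : ℂ) * F (Z p)) • Z p :=
  summable_smul_of_orthonormal orthonormal_Z (by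
    simp only [norm_sq_rpow_mul]
    exact h)

end StokesPowDual

/-- `B(v, v) - B(w, w) = B(v - w, v) + B(w, v - w)`, after `A^s`, which only sees the values at the
eigenfields. -/
lemma stokesPowDual_B_sub {s : ℝ} {v w : L2} (hv : v ∈ V) (hw : w ∈ V)
    (h1 : DualInDom s (B (v - w) v)) (h2 : DualInDom s (B w (v - w))) :
    stokesPowDual s (B v v - B w w)
      = stokesPowDual s (B (v - w) v) + stokesPowDual s (B w (v - w)) := by
  rw [stokesPowDual, stokesPowDual, stokesPowDual, ← h1.summable.tsum_add h2.summable]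
  refine tsum_congr fun p => ?_
  rw [← add_smul, ← mul_add]
  congr 2
  have hd := sub_mem_V hv hw
  simp only [Pi.sub_apply, B_Z_eq hv hv, B_Z_eq hw hw, B_Z_eq hd hv, B_Z_eq hw hd, map_sub,
    triInt_sub_left, triInt_sub_right, Finset.sum_sub_distrib]
  ring

end SphereNSE

end

theorem lemma6p2 (δ : ℝ) (hδ₁ : 1 / 2 < δ) (hδ₂ : δ < 1) :
    -- all expressions below are meaningful
    (∀ u ∈ SphereNSE.V, ∀ v ∈ SphereNSE.V,
      (∀ w ∈ SphereNSE.V, MeasureTheory.Integrable (SphereNSE.bIntegrand u v w) SphereNSE.dS) ∧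
      SphereNSE.MemVDual (SphereNSE.B u v) ∧
      SphereNSE.DualInDom (-δ) (SphereNSE.B u v) ∧
      u ∈ SphereNSE.domPow (1 - δ) ∧ u ∈ SphereNSE.domPow (1 / 2)) ∧
    -- the two estimates
    (∃ C : ℝ, ∀ u ∈ SphereNSE.V, ∀ v ∈ SphereNSE.V,
      ‖SphereNSE.stokesPowDual (-δ) (SphereNSE.B u v)‖
        ≤ C * ‖SphereNSE.stokesPow (1 - δ) u‖ * ‖v‖ ∧
      ‖SphereNSE.stokesPowDual (-δ) (SphereNSE.B u v)‖
        ≤ C * ‖u‖ * ‖SphereNSE.stokesPow (1 - δ) v‖) ∧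
    -- the weak Lipschitz property
    (∀ M : ℝ, ∃ C : ℝ, ∀ v ∈ SphereNSE.V, ∀ w ∈ SphereNSE.V,
      ‖SphereNSE.stokesPow (1 / 2) v‖ ≤ M → ‖SphereNSE.stokesPow (1 / 2) w‖ ≤ M →
      ‖SphereNSE.stokesPowDual (-δ) (SphereNSE.B v v - SphereNSE.B w w)‖ ≤ C * ‖v - w‖) := by
  obtain ⟨C, hC0, hC⟩ := SphereNSE.exists_sum_norm_sq_B_Z_le hδ₁ hδ₂
  have hdual : ∀ u ∈ SphereNSE.V, ∀ v ∈ SphereNSE.V,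
      SphereNSE.DualInDom (-δ) (SphereNSE.B u v) := fun u hu v hv =>
    SphereNSE.dualInDom_of_sum_le fun F => (hC u hu v hv F).1
  have h1 : ∀ u ∈ SphereNSE.V, ∀ v ∈ SphereNSE.V, ‖SphereNSE.stokesPowDual (-δ) (SphereNSE.B u v)‖
      ≤ C * ‖SphereNSE.stokesPow (1 - δ) u‖ * ‖v‖ := fun u hu v hv =>
    SphereNSE.norm_stokesPowDual_le (by positivity) fun F => (hC u hu v hv F).1
  have h2 : ∀ u ∈ SphereNSE.V, ∀ v ∈ SphereNSE.V, ‖SphereNSE.stokesPowDual (-δ) (SphereNSE.B u v)‖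
      ≤ C * ‖u‖ * ‖SphereNSE.stokesPow (1 - δ) v‖ := fun u hu v hv =>
    SphereNSE.norm_stokesPowDual_le (by positivity) fun F => (hC u hu v hv F).2
  have hpow : ∀ u ∈ SphereNSE.V, ‖SphereNSE.stokesPow (1 - δ) u‖ ≤ ‖SphereNSE.stokesPow (1 / 2) u‖ :=
    fun u hu => SphereNSE.norm_stokesPow_le (by linarith) (SphereNSE.mem_domPow_half hu)
  refine ⟨fun u hu v hv => ⟨(SphereNSE.integrable_bIntegrand_and_bound hu).1,
    SphereNSE.memVDual_B hu, hdual u hu v hv, SphereNSE.mem_domPow_of_le (by linarith)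
      (SphereNSE.mem_domPow_half hu), SphereNSE.mem_domPow_half hu⟩,
    ⟨C, fun u hu v hv => ⟨h1 u hu v hv, h2 u hu v hv⟩⟩, fun M => ⟨2 * (C * M), ?_⟩⟩
  intro v hv w hw hvM hwM
  have hd := SphereNSE.sub_mem_V hv hw
  rw [SphereNSE.stokesPowDual_B_sub hv hw (hdual _ hd _ hv) (hdual _ hw _ hd)]
  calc _ ≤ C * ‖v - w‖ * ‖SphereNSE.stokesPow (1 - δ) v‖
        + C * ‖SphereNSE.stokesPow (1 - δ) w‖ * ‖v - w‖ :=
        (norm_add_le _ _).trans (add_le_add (h2 _ hd _ hv) (h1 _ hw _ hd))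
    _ ≤ C * ‖v - w‖ * M + C * M * ‖v - w‖ :=
        add_le_add (mul_le_mul_of_nonneg_left ((hpow v hv).trans hvM) (by positivity))
          (mul_le_mul_of_nonneg_right (mul_le_mul_of_nonneg_left ((hpow w hw).trans hwM) hC0)
            (norm_nonneg _))
    _ = 2 * (C * M) * ‖v - w‖ := by ring
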